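/- Let $n\ge 2$ be an integer, $\tau>0$, and let $G\subset\mathbb{R}^n$ be a bounded domain with infinitely smooth boundary $\Gamma$. Put $S=\Gamma\times(0,\tau)$, $\overline S=\Gamma\times[0,\tau]$ and $\Pi=\mathbb{R}^{n-1}\times(0,\tau)$. All functions are complex-valued. \emph{Notation.} $\mathcal M$ is the class of all Borel measurable $\varphi:[1,\infty)\to(0,\infty)$ such that $\varphi$ and $1/\varphi$ are bounded on every $[1,b]$, $1<b<\infty$, and $\varphi(\lambda\rho)/\varphi(\rho)\to1$ as $\rho\to\infty$ for every $\lambda>0$. For a weight $\mu:\mathbb{R}^k\to(0,\infty)$, $H^\mu(\mathbb{R}^k)$ is the space of tempered distributions $w$ whose Fourier transform $\widehat w$ is a locally integrable function with $\|w\|^2:=\int\mu^2|\widehat w|^2\,d\xi<\infty$ (here $\widehat w(\xi)=\int e^{-2\pi i x\cdot\xi}w(x)\,dx$ for integrable $w$; for the weights below other normalizations give equivalent norms), and, for open $V\subseteq\mathbb{R}^k$, $H^\mu(V)$ is the space of restrictions to $V$ of elements of $H^\mu(\mathbb{R}^k)$ with the quotient norm. For real $s$ and $\varphi\in\mathcal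 M$, $H^{s;\varphi}(\mathbb{R}^{n-1})$ is $H^\mu(\mathbb{R}^{n-1})$ with $\mu(\xi)=(1+|\xi|^2)^{s/2}\varphi((1+|\xi|^2)^{1/2})$, and $H^{s,s/2;\varphi}(\Pi)$ is $H^\mu(\Pi)$ with $\mu(\xi',\xi_n)=(1+|\xi'|^2+|\xi_n|)^{s/2}\varphi((1+|\xi'|^2+|\xi_n|)^{1/2})$. Choose any finite atlas of local charts $\theta_j:\mathbb{R}^{n-1}\leftrightarrow\Gamma_j$ of $\Gamma$ and functions $\chi_j\in C^\infty(\Gamma)$ with $\operatorname{supp}\chi_j\subset\Gamma_j$ and $\sum_j\chi_j=1$. For $s>0$, $H^{s,s/2;\varphi}(S)$ consists of all $g\in L_2(S)$ such that every $g_j(x,t)=\chi_j(\theta_j(x))\,g(\theta_j(x),t)$ belongs to $H^{s,s/2;\varphi}(\Pi)$, with norm $\bigl(\sum_j\|g_j\|^2\bigr)^{1/2}$; for $\sigma>0$, $H^{\sigma;\varphi}(\Gamma)$ consists of all $v\in L_2(\Gamma)$ such that every $\chi_j(\theta_j(x))\,v(\theta_j(x))$ belongs to $H^{\sigma;\varphi}(\mathbb{R}^{n-1})$,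 with the analogous norm. \emph{Lemma.} Let $r\ge1$ be an integer, and consider the linear mapping $$R:g\mapsto\bigl(g|_{t=0},\,\partial_tg|_{t=0},\dots,\partial_t^{r-1}g|_{t=0}\bigr),\qquad g\in C^\infty(\overline S).$$ For all $s>2r-1$ and $\varphi\in\mathcal M$ this mapping extends uniquely (by continuity) to a bounded linear operator $$R:H^{s,s/2;\varphi}(S)\to\bigoplus_{k=0}^{r-1}H^{s-2k-1;\varphi}(\Gamma)=:\mathbb{H}^{s;\varphi}(\Gamma).$$ This operator is right invertible; moreover, there exists a linear mapping $T:(L_2(\Gamma))^r\to L_2(S)$ such that for all $s>2r-1$ and $\varphi\in\mathcal M$ the restriction of $T$ to $\mathbb{H}^{s;\varphi}(\Gamma)$ is a bounded linear operator $T:\mathbb{H}^{s;\varphi}(\Gamma)\to H^{s,s/2;\varphi}(S)$ and $RTv=v$ for every $v\in\mathbb{H}^{s;\varphi}(\Gamma)$. -/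

import Mathlib

open MeasureTheory Set Filter Topology
open scoped ENNReal NNReal ContDiff SchwartzMap FourierTransform

namespace CauchyData

/-- Euclidean space `ℝ^d`. -/
abbrev Eucl (d : ℕ) : Type := EuclideanSpace ℝ (Fin d)

/-- `ℝ^d × ℝ` with its Euclidean structure, i.e. the space `ℝ^(d+1)` of the points `(x, t)`. -/
abbrev SpaceTime (d : ℕ) : Type := WithLp 2 (Eucl d × ℝ)

noncomputable section

/-! ### The function parameters -/

/-- The class `𝓜` of functions `φ : [1, ∞) → (0, ∞)` (only the values of `φ` on `[1, ∞)` matter). -/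
structure ClassM (φ : ℝ → ℝ) : Prop where
  measurable : Measurable (fun x : Ici (1 : ℝ) => φ x)
  pos : ∀ x, 1 ≤ x → 0 < φ x
  bounded : ∀ b, 1 < b → ∃ C, ∀ x ∈ Icc 1 b, φ x ≤ C ∧ 1 / φ x ≤ C
  slowlyVarying : ∀ c, 0 < c → Tendsto (fun x => φ (c * x) / φ x) atTop (𝓝 1)

/-- The isotropic regularity index `(1 + |ξ|²)^(s/2) φ((1 + |ξ|²)^(1/2))` on `ℝ^d`. -/
def isoIndex (d : ℕ) (s : ℝ) (φ : ℝ → ℝ) (ξ : Eucl d) : ℝ :=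
  (1 + ‖ξ‖ ^ 2) ^ (s / 2) * φ ((1 + ‖ξ‖ ^ 2) ^ (1 / 2 : ℝ))

/-- The anisotropic (parabolic) regularity index
`(1 + |ξ'|² + |ξ_k|)^(s/2) φ((1 + |ξ'|² + |ξ_k|)^(1/2))` on `ℝ^d × ℝ`. -/
def anisoIndex (d : ℕ) (s : ℝ) (φ : ℝ → ℝ) (ζ : SpaceTime d) : ℝ :=
  (1 + ‖ζ.fst‖ ^ 2 + |ζ.snd|) ^ (s / 2) * φ ((1 + ‖ζ.fst‖ ^ 2 + |ζ.snd|) ^ (1 / 2 : ℝ))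

/-! ### Hörmander spaces over Euclidean open sets

All norms below are extended: they take the value `∞` exactly outside the space. -/

section Euclidean

variable {E : Type} [NormedAddCommGroup E] [InnerProductSpace ℝ E] [FiniteDimensional ℝ E]
  [MeasurableSpace E] [BorelSpace E]

/-- The Fourier transform of the tempered distribution `w` is the locally integrable function `f`.
-/
def HasFourierDensity (w : 𝓢'(E, ℂ)) (f : E → ℂ) : Prop :=
  LocallyIntegrable f volume ∧ ∀ u : 𝓢(E, ℂ), (𝓕 w) u = ∫ ξ, f ξ * u ξ

/-- The norm `(∫ μ² |ŵ|²)^(1/2)` in `H^μ(E)`. The function `f` representing `ŵ` is unique up to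
equality almost everywhere, so that the infimum is over at most one number. -/
def hormanderNorm (μ : E → ℝ) (w : 𝓢'(E, ℂ)) : ℝ≥0∞ :=
  ⨅ (f : E → ℂ) (_ : HasFourierDensity w f),
    (∫⁻ ξ, ENNReal.ofReal (μ ξ) ^ 2 * ‖f ξ‖ₑ ^ 2) ^ (1 / 2 : ℝ)

/-- The restriction of the distribution `w` to the open set `V` is the locally integrable
function `u`. -/
def RestrictsTo (w : 𝓢'(E, ℂ)) (V : Set E) (u : E → ℂ) : Prop :=
  LocallyIntegrableOn u V volume ∧
    ∀ ψ : 𝓢(E, ℂ), HasCompactSupport ψ → tsupport ψ ⊆ V → w ψ = ∫ x in V, u x * ψ x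

/-- The (quotient) norm in `H^μ(V)` of a function `u` on the open set `V`. -/
def hormanderNormOn (μ : E → ℝ) (V : Set E) (u : E → ℂ) : ℝ≥0∞ :=
  ⨅ (w : 𝓢'(E, ℂ)) (_ : RestrictsTo w V u), hormanderNorm μ w

end Euclidean

/-- The strip `Π = ℝ^d × (0, τ)`. -/
def strip (d : ℕ) (τ : ℝ) : Set (SpaceTime d) := {z | z.snd ∈ Ioo 0 τ}

/-! ### The boundary of a smooth domain, its charts, and function spaces on it -/

/-- `G` has an infinitely smooth boundary: near each boundary point a smooth diffeomorphism between
open sets carries `G` to the part of its target in the half-space `{y_{d+1} > 0}`. -/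
def HasSmoothBoundary {d : ℕ} (G : Set (Eucl (d + 1))) : Prop :=
  ∀ x ∈ frontier G, ∃ Φ : OpenPartialHomeomorph (Eucl (d + 1)) (Eucl (d + 1)),
    x ∈ Φ.source ∧ ContDiffOn ℝ ∞ Φ Φ.source ∧ ContDiffOn ℝ ∞ Φ.symm Φ.target ∧
      ∀ y ∈ Φ.source, y ∈ G ↔ 0 < Φ y (Fin.last d)

/-- `θ : ℝ^d → Γ` is (the inverse of) a local chart, with image an open subset of `Γ`, of the smooth
structure on `Γ` induced by `ℝ^(d+1)`. -/
structure IsChart {d : ℕ} (Γ : Set (Eucl (d + 1))) (θ : Eucl d → Eucl (d + 1)) : Prop where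
  contDiff : ContDiff ℝ ∞ θ
  immersion : ∀ x, Function.Injective (fderiv ℝ θ x)
  embedding : IsEmbedding θ
  subset : range θ ⊆ Γ
  open_range : ∃ U, IsOpen U ∧ range θ = U ∩ Γ

/-- A choice of a finite atlas `θ_j : ℝ^d ↔ Γ_j` on `Γ`, and of smooth (complex-valued) functions
`χ_j` on `Γ` with `supp χ_j ⊆ Γ_j` and `∑ χ_j = 1`. -/
structure AtlasWithPartition {d : ℕ} (Γ : Set (Eucl (d + 1))) (ι : Type) [Fintype ι] where
  θ : ι → Eucl d → Eucl (d + 1)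
  χ : ι → Eucl (d + 1) → ℂ
  isChart : ∀ j, IsChart Γ (θ j)
  cover : Γ ⊆ ⋃ j, range (θ j)
  smooth : ∀ i j, ContDiff ℝ ∞ (fun x => χ i (θ j x))
  supp : ∀ j, closure {y ∈ Γ | χ j y ≠ 0} ⊆ range (θ j)
  sum_eq_one : ∀ y ∈ Γ, ∑ j, χ j y = 1

/-- The surface measure on `Γ`. -/
def surfaceMeasure {d : ℕ} (Γ : Set (Eucl (d + 1))) : Measure (Eucl (d + 1)) :=
  (Measure.euclideanHausdorffMeasure d).restrict Γ

/-- The measure on the lateral surface `S = Γ × (0, τ)`. -/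
def lateralMeasure {d : ℕ} (Γ : Set (Eucl (d + 1))) (τ : ℝ) : Measure (Eucl (d + 1) × ℝ) :=
  (surfaceMeasure Γ).prod (volume.restrict (Ioo 0 τ))

/-- `L₂(Γ)`. -/
abbrev L2Γ {d : ℕ} (Γ : Set (Eucl (d + 1))) : Type := Lp ℂ 2 (surfaceMeasure Γ)

/-- `L₂(S)`. -/
abbrev L2S {d : ℕ} (Γ : Set (Eucl (d + 1))) (τ : ℝ) : Type := Lp ℂ 2 (lateralMeasure Γ τ)

namespace AtlasWithPartition

variable {d : ℕ} {Γ : Set (Eucl (d + 1))} {ι : Type} [Fintype ι] (A : AtlasWithPartition Γ ι)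

/-- The norm in `H^{σ;φ}(Γ)`, for `σ > 0`. (For such `σ` this space consists of square integrable
functions, because `H^{σ;φ}(ℝ^d) ⊆ L₂(ℝ^d)`.) -/
def normΓ (σ : ℝ) (φ : ℝ → ℝ) (v : L2Γ Γ) : ℝ≥0∞ :=
  (∑ j, hormanderNormOn (isoIndex d σ φ) univ
    (fun x => A.χ j (A.θ j x) * v (A.θ j x)) ^ 2) ^ (1 / 2 : ℝ)

/-- The norm in the orthogonal sum of the spaces `H^{s-2k-1;φ}(Γ)` over `0 ≤ k < r`. -/
def normData {r : ℕ} (s : ℝ) (φ : ℝ → ℝ) (v : Fin r → L2Γ Γ) : ℝ≥0∞ :=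
  (∑ k : Fin r, A.normΓ (s - 2 * (k : ℕ) - 1) φ (v k) ^ 2) ^ (1 / 2 : ℝ)

/-- The norm in `H^{s,s/2;φ}(S)`, for `s > 0`. -/
def normS (τ s : ℝ) (φ : ℝ → ℝ) (g : L2S Γ τ) : ℝ≥0∞ :=
  (∑ j, hormanderNormOn (anisoIndex d s φ) (strip d τ)
    (fun z => A.χ j (A.θ j z.fst) * g (A.θ j z.fst, z.snd)) ^ 2) ^ (1 / 2 : ℝ)

/-- `g ∈ C^∞(S̄)`, where `S̄ = Γ × [0, τ]`. -/
def SmoothOnClosure (τ : ℝ) (g : Eucl (d + 1) × ℝ → ℂ) : Prop :=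
  ∀ j, ContDiffOn ℝ ∞ (fun p : Eucl d × ℝ => g (A.θ j p.1, p.2)) (univ ×ˢ Icc 0 τ)

/-- The linear operator `R`, defined exactly on `H^{s,s/2;φ}(S)`, is bounded from this space to
`⊕_{k<r} H^{s-2k-1;φ}(Γ)` and extends the mapping `g ↦ (∂_t^k g|_{t=0})_{k<r}` given on
`C^∞(S̄)` (which is contained in `H^{s,s/2;φ}(S)`). -/
structure IsCauchyDataOperator (τ : ℝ) (r : ℕ) (s : ℝ) (φ : ℝ → ℝ)
    (R : L2S Γ τ →ₗ.[ℂ] (Fin r → L2Γ Γ)) : Prop where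
  domain : ∀ g : L2S Γ τ, g ∈ R.domain ↔ A.normS τ s φ g < ⊤
  bounded : ∃ C : ℝ≥0, ∀ g : R.domain, A.normData s φ (R g) ≤ C * A.normS τ s φ (g : L2S Γ τ)
  extends_smooth : ∀ g : Eucl (d + 1) × ℝ → ℂ, A.SmoothOnClosure τ g →
    ∃ h : R.domain, (h : L2S Γ τ) =ᵐ[lateralMeasure Γ τ] g ∧
      ∀ k : Fin r, R h k =ᵐ[surfaceMeasure Γ]
        fun y => iteratedDerivWithin k (fun t => g (y, t)) (Icc 0 τ) 0

end AtlasWithPartition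

end

end CauchyData

open scoped LineDeriv

namespace CauchyData

noncomputable section

/-! ### Slowly varying functions -/

/-! On the whole space-time everything happens on the Fourier side. If `g = 𝓕⁻ f`, then the Fourier
transform of `∂_t^k g` at `t = 0` is the moment `∫ (2πiη)^k f(ξ, η) dη`. By Cauchy–Schwarz it is
controlled by the energy of `f` with weight `μ`, at the cost of `∫ |η|^(2k) μ(ξ, η)^(-2) dη`. The
substitution `η = λu`, `λ = 1 + |ξ|²`, together with the Potter bounds for `φ`, turns this integral
into a constant times the inverse square of the isotropic weight of order `s - 2k - 1`; it converges
because `s > 2k + 1` (`lintegral_moment_div_anisoIndex_le`, `exists_moment`). Conversely, datum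
number `k` is extended by `λ^(-k-1) B_k(η/λ) v̂(ξ)`, where the profiles `B_k` are Schwartz functions
with `∫ (2πiη)^l B_k = δ_kl` (`exists_schwartz_moments`, `energy_scaleOp_le`, `moment_scaleOp`).
This formula involves neither `s` nor `φ`, which is why a single `T` serves all the spaces.

Passing to `Γ` uses localizations `χ_j g ∘ θ_j` and gluing by cutoffs. Gluing is bounded because the
anisotropic spaces are invariant under smooth changes of the spatial variables
(`energy_aniso_comp_le`). At orders `0` and `2n` this follows from a change of variables in `L₂` and
the chain rule. The orders between, with any `φ`, follow by interpolation: a radial weight of order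
`s ∈ (0, N)` is equivalent to a dyadic superposition of truncated powers `min(1, (ρ/y)^N)`
(`radial_equiv_tsum`), and for each of these the bound results from splitting a function at the
level `ρ = y` (`energy_truncPow_le`).

Traces are defined intrinsically in `L₂` by `IsTrace`, as limits of time averages against `(-1)^k
∂^k h_n`, where the densities `h_n` have support in `(0, τ)` and concentrate at `0`. Such traces are
unique and linear, commute with changes of charts, agree with one-sided derivatives for smooth
functions and with moments for inverse Fourier transforms. The operator `R` is the trace operator on
the functions of finite norm. Smooth functions have finite norm since their localizations extend
across `t = 0` and `t = τ` by reflections (`exists_contDiff_extension`). Uniqueness of `R` holds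
because gluing inverse transforms truncated in frequency gives smooth functions dense in the space
(`IsCauchyDataOperator.eq`). -/

/-- A measurable additively slowly varying function has bounded increments over unit intervals. -/
theorem abs_increment_le_of_slowlyVarying {h : ℝ → ℝ} (hm : Measurable h)
    (hs : ∀ u, Tendsto (fun x => h (x + u) - h x) atTop (𝓝 0)) :
    ∃ X, ∀ x, X ≤ x → ∀ u ∈ Icc (0 : ℝ) 1, |h (x + u) - h x| ≤ 2 := by
  set F : ℝ → Set ℝ := fun x => {u | 1 ≤ |h (x + u) - h x|} with hF
  have hFm : ∀ x, MeasurableSet (F x) := fun x =>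
    measurableSet_le measurable_const
      (((hm.comp (measurable_const.add measurable_id)).sub measurable_const).abs)
  -- For each fixed `u` the indicator of the bad set `F x` vanishes eventually, so by dominated
  -- convergence the measure of `F x` in `[0, 2]` tends to zero, although no uniformity in `u` is
  -- assumed.
  have hlim : Tendsto (fun x => ∫⁻ u in Icc (0 : ℝ) 2, (F x).indicator 1 u) atTop
      (𝓝 (∫⁻ u in Icc (0 : ℝ) 2, (0 : ℝ≥0∞))) := by
    refine tendsto_lintegral_filter_of_dominated_convergence (fun _ => 1) ?_ ?_ ?_ ?_
    · exact Eventually.of_forall fun x => measurable_one.indicator (hFm x)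
    · exact Eventually.of_forall fun x => Eventually.of_forall fun u =>
        indicator_le_self' (fun _ _ => zero_le_one) u |>.trans le_rfl
    · simp
    · refine Eventually.of_forall fun u => tendsto_const_nhds.congr' ?_
      have := (hs u).abs
      rw [abs_zero] at this
      filter_upwards [this.eventually (gt_mem_nhds (zero_lt_one))] with x hx
      simp [hF, hx]
  simp only [lintegral_zero] at hlim
  have hev := hlim.eventually (gt_mem_nhds (show (0 : ℝ≥0∞) < 1 / 2 by simp))
  obtain ⟨X, hX⟩ := eventually_atTop.1 hev
  have hbad : ∀ x, X ≤ x → volume (F x ∩ Icc (0 : ℝ) 2) < 1 / 2 := by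
    intro x hx
    have := hX x hx
    rwa [lintegral_indicator_one (hFm x), Measure.restrict_apply (hFm x)] at this
  refine ⟨X, fun x hx l hl => ?_⟩
  -- Two bad sets of measure below `1/2`, one for the base point `x` and one for `x + l`, cannot
  -- cover `[1, 2]`. A common good point `x + u` lies within `1` in value of both base points,
  -- whence the bound `2`.
  have hcov : ∃ u ∈ Icc (1 : ℝ) 2, u ∉ F x ∧ u - l ∉ F (x + l) := by
    by_contra! hcon
    have hsub : Icc (1 : ℝ) 2 ⊆ (F x ∩ Icc 0 2) ∪ (fun u => u - l) ⁻¹' (F (x + l) ∩ Icc 0 2) := by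
      intro u hu
      by_cases h1 : u ∈ F x
      · exact Or.inl ⟨h1, by linarith [hu.1], hu.2⟩
      · exact Or.inr ⟨hcon u hu h1, by simp; linarith [hu.1, hl.2], by simp; linarith [hu.2, hl.1]⟩
    have := (measure_mono hsub).trans (measure_union_le (μ := volume) _ _)
    simp_rw [sub_eq_add_neg] at this
    rw [measure_preimage_add_right, Real.volume_Icc] at this
    have h2 := ENNReal.add_lt_add (hbad x hx) (hbad (x + l) (by linarith [hl.1]))
    rw [ENNReal.add_halves] at h2
    norm_num at this
    exact absurd this (not_le.2 h2)
  obtain ⟨u, -, hu1, hu2⟩ := hcov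
  simp only [hF, mem_ofPred_eq, not_le] at hu1 hu2
  rw [show x + l + (u - l) = x + u by ring] at hu2
  rw [abs_lt] at hu1 hu2
  rw [abs_le]
  constructor <;> linarith [hu1.1, hu1.2, hu2.1, hu2.2]

/-- Additive form of the Potter bounds. -/
theorem abs_sub_le_of_slowlyVarying {h : ℝ → ℝ} (hm : Measurable h)
    (hs : ∀ u, Tendsto (fun x => h (x + u) - h x) atTop (𝓝 0))
    (hb : ∀ b, ∃ M, ∀ x ∈ Icc 0 b, |h x| ≤ M) {ε : ℝ} (hε : 0 < ε) :
    ∃ C, ∀ a b, 0 ≤ a → a ≤ b → |h b - h a| ≤ C + ε * (b - a) := by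
  obtain ⟨X₁, hX₁⟩ := abs_increment_le_of_slowlyVarying hm hs
  have h1 := (hs 1).abs
  rw [abs_zero] at h1
  obtain ⟨X₂, hX₂⟩ := eventually_atTop.1 (h1.eventually (gt_mem_nhds hε))
  set X := max 0 (max X₁ X₂)
  have hXX₁ : X₁ ≤ X := (le_max_left _ _).trans (le_max_right _ _)
  have hXX₂ : X₂ ≤ X := (le_max_right _ _).trans (le_max_right _ _)
  obtain ⟨M, hM⟩ := hb X
  -- Beyond `X` each unit step costs at most `ε`, which yields the linear drift; the fractional
  -- remainder of a longer interval costs at most `2`.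
  have hstep : ∀ n : ℕ, ∀ a, X ≤ a → |h (a + n) - h a| ≤ ε * n := by
    intro n
    induction n with
    | zero => intro a _; simp
    | succ n ih =>
      intro a ha
      have h3 := ih a ha
      have h4 := (hX₂ (a + n) (by have : (0 : ℝ) ≤ n := n.cast_nonneg; linarith)).le
      rw [abs_le] at h3 h4 ⊢
      push_cast
      rw [show a + ((n : ℝ) + 1) = a + n + 1 by ring]
      constructor <;> linarith [h3.1, h3.2, h4.1, h4.2]
  have hbig : ∀ a b, X ≤ a → a ≤ b → |h b - h a| ≤ 2 + ε * (b - a) := by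
    intro a b ha hab
    set n := ⌊b - a⌋₊
    have hn : (n : ℝ) ≤ b - a := Nat.floor_le (by linarith)
    have hn' : b - a < n + 1 := Nat.lt_floor_add_one _
    have h3 := hstep n a ha
    have h4 := hX₁ (a + n) (by have : (0 : ℝ) ≤ n := n.cast_nonneg; linarith) (b - a - n)
      ⟨by linarith, by linarith⟩
    rw [show a + n + (b - a - n) = b by ring] at h4
    have h5 : ε * n ≤ ε * (b - a) := mul_le_mul_of_nonneg_left hn hε.le
    rw [abs_le] at h3 h4 ⊢
    constructor <;> linarith [h3.1, h3.2, h4.1, h4.2]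
  -- On `[0, X]` only boundedness is available: moving a point up to `X` changes `h` by at most
  -- `2|M|`.
  have hsmall : ∀ a, 0 ≤ a → |h a - h (max a X)| ≤ 2 * |M| := by
    intro a ha
    rcases le_total a X with hle | hle
    · rw [max_eq_right hle]
      have h3 := (hM a ⟨ha, hle⟩).trans (le_abs_self M)
      have h4 := (hM X ⟨le_max_left _ _, le_rfl⟩).trans (le_abs_self M)
      rw [abs_le] at h3 h4 ⊢
      constructor <;> linarith [h3.1, h3.2, h4.1, h4.2]
    · rw [max_eq_left hle]; simp
  refine ⟨4 * |M| + 2, fun a b ha hab => ?_⟩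
  have h3 := hsmall a ha
  have h4 := hsmall b (ha.trans hab)
  have h5 := hbig (max a X) (max b X) (le_max_right _ _) (max_le_max hab le_rfl)
  have h6 : max b X - max a X ≤ b - a := by
    rcases le_total b X with hb' | hb'
    · rw [max_eq_right hb', max_eq_right (hab.trans hb')]; linarith
    · rw [max_eq_left hb']; linarith [le_max_left a X]
  have h7 := mul_le_mul_of_nonneg_left h6 hε.le
  rw [abs_le] at h3 h4 h5 ⊢
  constructor <;> linarith [h3.1, h3.2, h4.1, h4.2, h5.1, h5.2]

namespace ClassM

variable {φ : ℝ → ℝ}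

/-- Nothing is known about `φ` off `[1, ∞)`; clamping the argument yields a function measurable on
the whole line. -/
theorem measurable_comp_max (hφ : ClassM φ) : Measurable fun x : ℝ => φ (max 1 x) :=
  hφ.measurable.comp
    (g := fun x : Ici (1 : ℝ) => φ x) (f := fun x : ℝ => (⟨max 1 x, mem_Ici.2 (le_max_left _ _)⟩ : Ici (1 : ℝ)))
    ((measurable_const.max measurable_id).subtype_mk)

/-- The Potter bounds. -/
theorem potter (hφ : ClassM φ) {ε : ℝ} (hε : 0 < ε) :
    ∃ C, 0 < C ∧ ∀ x y, 1 ≤ x → x ≤ y →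
      φ y ≤ C * (y / x) ^ ε * φ x ∧ φ x ≤ C * (y / x) ^ ε * φ y := by
  -- The logarithm of `φ ∘ exp` turns multiplicative slow variation into additive slow variation,
  -- and the additive bound `C + ε(b - a)` into the power bound.
  set h : ℝ → ℝ := fun x => Real.log (φ (max 1 (Real.exp x))) with hh
  have hpos : ∀ x, 0 < φ (max 1 x) := fun x => hφ.pos _ (le_max_left _ _)
  have hexp : ∀ x, 0 ≤ x → h x = Real.log (φ (Real.exp x)) := fun x hx => by
    simp [hh, max_eq_right (Real.one_le_exp hx)]
  have hm : Measurable h :=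
    Real.measurable_log.comp (hφ.measurable_comp_max.comp Real.measurable_exp)
  have hs : ∀ u, Tendsto (fun x => h (x + u) - h x) atTop (𝓝 0) := by
    intro u
    have h1 := (hφ.slowlyVarying (Real.exp u) (Real.exp_pos u)).comp Real.tendsto_exp_atTop
    have h2 := ((Real.continuousAt_log one_ne_zero).tendsto.comp h1)
    rw [Real.log_one] at h2
    refine h2.congr' ?_
    filter_upwards [eventually_ge_atTop 0, eventually_ge_atTop (-u)] with x hx hx'
    rw [hexp x hx, hexp (x + u) (by linarith), Function.comp, Function.comp, ← Real.exp_add,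
      add_comm u x, Real.log_div]
    · exact (hφ.pos _ (Real.one_le_exp (by linarith))).ne'
    · exact (hφ.pos _ (Real.one_le_exp (by linarith))).ne'
  have hb : ∀ b, ∃ M, ∀ x ∈ Icc 0 b, |h x| ≤ M := by
    intro b
    obtain ⟨C, hC⟩ := hφ.bounded (Real.exp (max b 1)) (by
      rw [Real.one_lt_exp_iff]; exact lt_of_lt_of_le one_pos (le_max_right _ _))
    refine ⟨Real.log C, fun x hx => ?_⟩
    have h1 := Real.one_le_exp hx.1
    obtain ⟨h2, h3⟩ := hC (Real.exp x) ⟨h1, Real.exp_le_exp.2 (hx.2.trans (le_max_left _ _))⟩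
    have h4 := hφ.pos _ h1
    rw [hexp x hx.1, abs_le]
    constructor
    · rw [neg_le, ← Real.log_inv, ← one_div]
      exact Real.log_le_log (by positivity) h3
    · exact Real.log_le_log h4 h2
  obtain ⟨C, hC⟩ := abs_sub_le_of_slowlyVarying hm hs hb hε
  refine ⟨Real.exp C, Real.exp_pos _, fun x y hx hxy => ?_⟩
  have hx0 : 0 < x := by linarith
  have hy0 : 0 < y := by linarith
  have key := hC (Real.log x) (Real.log y) (Real.log_nonneg hx) (Real.log_le_log hx0 hxy)
  rw [hexp _ (Real.log_nonneg hx), hexp _ (Real.log_nonneg (hx.trans hxy)), Real.exp_log hx0,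
    Real.exp_log hy0, ← Real.log_div hy0.ne' hx0.ne'] at key
  have hpx := hφ.pos x hx
  have hpy := hφ.pos y (hx.trans hxy)
  have hpow : (y / x) ^ ε = Real.exp (ε * Real.log (y / x)) := by
    rw [Real.rpow_def_of_pos (by positivity), mul_comm]
  rw [abs_le] at key
  rw [hpow, ← Real.exp_add]
  constructor
  · rw [← Real.log_le_log_iff hpy (by positivity), Real.log_mul (Real.exp_pos _).ne' hpx.ne',
      Real.log_exp]
    linarith [key.2]
  · rw [← Real.log_le_log_iff hpx (by positivity), Real.log_mul (Real.exp_pos _).ne' hpy.ne',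
      Real.log_exp]
    linarith [key.1]

end ClassM

/-- The radial weight `ρ ^ s φ(ρ)`. -/
def radial (s : ℝ) (φ : ℝ → ℝ) (x : ℝ) : ℝ := x ^ s * φ x

theorem radial_pos {s : ℝ} {φ : ℝ → ℝ} (hφ : ClassM φ) {x : ℝ} (hx : 1 ≤ x) : 0 < radial s φ x :=
  mul_pos (Real.rpow_pos_of_pos (by linarith) s) (hφ.pos x hx)

/-- Two-sided comparison of the values of a radial weight. -/
theorem radial_potter {s : ℝ} {φ : ℝ → ℝ} (hφ : ClassM φ) {ε : ℝ} (hε : 0 < ε) :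
    ∃ C, 0 < C ∧ ∀ x y, 1 ≤ x → x ≤ y →
      radial s φ y ≤ C * (y / x) ^ (s + ε) * radial s φ x ∧
      radial s φ x ≤ C * (x / y) ^ (s - ε) * radial s φ y := by
  obtain ⟨C, hC0, hC⟩ := hφ.potter hε
  refine ⟨C, hC0, fun x y hx hxy => ?_⟩
  have hx0 : 0 < x := by linarith
  have hy0 : 0 < y := by linarith
  obtain ⟨h1, h2⟩ := hC x y hx hxy
  unfold radial
  constructor
  · calc y ^ s * φ y ≤ y ^ s * (C * (y / x) ^ ε * φ x) := by gcongr
      _ = C * (y / x) ^ (s + ε) * (x ^ s * φ x) := by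
        rw [Real.rpow_add (by positivity), Real.div_rpow hy0.le hx0.le s]
        field_simp
  · calc x ^ s * φ x ≤ x ^ s * (C * (y / x) ^ ε * φ y) := by gcongr
      _ = C * (x / y) ^ (s - ε) * (y ^ s * φ y) := by
        rw [Real.rpow_sub (by positivity), Real.div_rpow hx0.le hy0.le s,
          ← inv_div x y, Real.inv_rpow (by positivity)]
        field_simp

/-- The Potter bound with `ε = s/2` leaves the positive power `s/2`, which slow variation cannot
destroy. This lower bound is what places the spaces of positive order inside `L₂`. -/
theorem exists_le_radial {s : ℝ} (hs : 0 < s) {φ : ℝ → ℝ} (hφ : ClassM φ) :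
    ∃ c, 0 < c ∧ ∀ x, 1 ≤ x → c ≤ radial s φ x := by
  obtain ⟨C, hC0, hC⟩ := radial_potter (s := s) hφ (half_pos hs)
  refine ⟨radial s φ 1 / C, div_pos (radial_pos hφ le_rfl) hC0, fun x hx => ?_⟩
  rw [div_le_iff₀' hC0]
  refine (hC 1 x le_rfl hx).2.trans ?_
  have : (1 / x) ^ (s - s / 2) ≤ 1 :=
    Real.rpow_le_one (by positivity) (by rw [div_le_one (by linarith)]; exact hx) (by linarith)
  have h2 := radial_pos (s := s) hφ hx
  nlinarith [mul_pos hC0 h2]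

/-- The exponent is the distance `|k - l|`, so the series is dominated by one geometric series on
each side of `l`, uniformly in `l`. -/
theorem tsum_pow_dist_le (q : ℝ≥0∞) (l : ℕ) :
    ∑' k : ℕ, q ^ (if k ≤ l then l - k else k - l) ≤ 2 * (1 - q)⁻¹ := by
  rw [← Summable.sum_add_tsum_nat_add' (k := l + 1) ENNReal.summable, two_mul,
    ← ENNReal.tsum_geometric]
  refine add_le_add ?_ ?_
  · refine le_trans (le_of_eq ?_) (ENNReal.sum_le_tsum (Finset.range (l + 1)))
    rw [← Finset.sum_range_reflect]
    refine Finset.sum_congr rfl fun k hk => ?_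
    have := Finset.mem_range.1 hk
    rw [if_pos (by omega)]
    congr 1
    omega
  · have : ∀ k : ℕ, q ^ (if k + (l + 1) ≤ l then l - (k + (l + 1)) else k + (l + 1) - l) =
        q ^ (k + 1) := fun k => by
      rw [if_neg (by omega)]
      congr 1
      omega
    simp_rw [this]
    exact ENNReal.tsum_comp_le_tsum_of_injective (add_left_injective 1) (fun k => q ^ k)

/-- The truncated power `min(1, (x / y)^N)`. -/
def truncPow (N : ℝ) (y x : ℝ) : ℝ := if x ≤ y then (x / y) ^ N else 1

theorem exists_two_pow_near {x : ℝ} (hx : 1 ≤ x) :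
    ∃ l : ℕ, (2 : ℝ) ^ l ≤ x ∧ x < 2 ^ (l + 1) :=
  exists_nat_pow_near hx one_lt_two

/-- A radial weight of order `s ∈ (0, N)` is equivalent to a superposition of truncated powers. -/
theorem radial_equiv_tsum {s N : ℝ} (hs : 0 < s) (hN : s < N) {φ : ℝ → ℝ} (hφ : ClassM φ) :
    ∃ C : ℝ≥0, ∀ x, 1 ≤ x →
      ENNReal.ofReal (radial s φ x) ^ 2 ≤ C * ∑' k : ℕ, ENNReal.ofReal (radial s φ (2 ^ k)) ^ 2 *
        ENNReal.ofReal (truncPow N (2 ^ k) x) ^ 2 ∧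
      ∑' k : ℕ, ENNReal.ofReal (radial s φ (2 ^ k)) ^ 2 *
        ENNReal.ofReal (truncPow N (2 ^ k) x) ^ 2 ≤ C * ENNReal.ofReal (radial s φ x) ^ 2 := by
  -- Since `2ε ≤ min(s, N - s)`, both exponents `s - ε` and `N - (s + ε)` are at least `ε`, which
  -- gives geometric decay of the dyadic terms at rate `2^(-ε)` in both directions.
  set ε := min s (N - s) / 2 with hε
  have hε0 : 0 < ε := by have := lt_min hs (sub_pos.2 hN); positivity
  have hεs : ε < s := by have := min_le_left s (N - s); linarith
  have hεN : ε < N - s := by have := min_le_right s (N - s); linarith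
  obtain ⟨C, hC0, hC⟩ := radial_potter (s := s) hφ hε0
  have hone : ∀ k : ℕ, (1 : ℝ) ≤ 2 ^ k := fun k => one_le_pow₀ one_le_two
  -- upper estimate of a single term
  have hterm : ∀ x, 1 ≤ x → ∀ l : ℕ, (2 : ℝ) ^ l ≤ x → x < 2 ^ (l + 1) → ∀ k : ℕ,
      radial s φ (2 ^ k) * truncPow N (2 ^ k) x ≤
        (C * 2 ^ ε) * ((1 / 2 : ℝ) ^ ε) ^ (if k ≤ l then l - k else k - l) * radial s φ x := by
    intro x hx l hl hl' k
    have hx0 : 0 < x := by linarith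
    have hrx := radial_pos (s := s) hφ hx
    have h2e : (1 : ℝ) ≤ 2 ^ ε := Real.one_le_rpow one_le_two hε0.le
    -- Below the scale of `x` the truncated power is `1` and the growth of the weight gives the
    -- decay; above that scale the truncated power `(x/2^k)^N` beats the growth, because `N > s`.
    split_ifs with hkl
    · have hk : (2 : ℝ) ^ k ≤ x := (pow_le_pow_right₀ one_le_two hkl).trans hl
      have htr : truncPow N (2 ^ k) x = 1 := by
        unfold truncPow
        split_ifs with h
        · rw [le_antisymm h hk, div_self (by positivity), Real.one_rpow]
        · rfl
      rw [htr, mul_one]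
      refine (hC _ x (hone k) hk).2.trans ?_
      gcongr ?_ * _
      rw [mul_assoc]
      gcongr
      have hq1 : (2 : ℝ) ^ k / x ≤ (1 / 2) ^ (l - k) := by
        rw [div_le_iff₀ hx0]
        calc (2 : ℝ) ^ k = (1 / 2) ^ (l - k) * 2 ^ l := by
              obtain ⟨m, rfl⟩ := Nat.exists_eq_add_of_le hkl
              rw [Nat.add_sub_cancel_left, add_comm, pow_add, ← mul_assoc, ← mul_pow]
              simp
          _ ≤ _ := by gcongr
      have hq2 : (2 : ℝ) ^ k / x ≤ 1 := (div_le_one hx0).2 hk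
      have : ((2 : ℝ) ^ k / x) ^ (s - ε) ≤ ((2 : ℝ) ^ k / x) ^ ε :=
        Real.rpow_le_rpow_of_exponent_ge (by positivity) hq2 (by
          have := min_le_left s (N - s); linarith)
      refine this.trans ((Real.rpow_le_rpow (by positivity) hq1 hε0.le).trans ?_)
      rw [← Real.rpow_natCast, ← Real.rpow_mul (by norm_num), mul_comm, Real.rpow_mul (by norm_num),
        Real.rpow_natCast]
      exact le_mul_of_one_le_left (by positivity) h2e
    · have hk : x ≤ (2 : ℝ) ^ k := hl'.le.trans (pow_le_pow_right₀ one_le_two (by omega))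
      have h1 := (hC x _ hx hk).1
      rw [truncPow, if_pos hk]
      calc radial s φ (2 ^ k) * (x / 2 ^ k) ^ N
          ≤ (C * (2 ^ k / x) ^ (s + ε) * radial s φ x) * (x / 2 ^ k) ^ N := by gcongr
        _ = C * (x / 2 ^ k) ^ (N - (s + ε)) * radial s φ x := by
          rw [Real.rpow_sub (by positivity), ← inv_div x, Real.inv_rpow (by positivity)]
          ring
        _ ≤ _ := by
          gcongr ?_ * _
          rw [mul_assoc]
          gcongr
          have hq1 : x / (2 : ℝ) ^ k ≤ 2 * (1 / 2) ^ (k - l) := by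
            rw [div_le_iff₀ (by positivity)]
            calc x ≤ 2 ^ (l + 1) := hl'.le
              _ = 2 * (1 / 2) ^ (k - l) * 2 ^ k := by
                rw [show (2 : ℝ) ^ k = 2 ^ (k - l) * 2 ^ l by rw [← pow_add]; congr 1; omega,
                  mul_assoc, ← mul_assoc _ _ ((2 : ℝ) ^ l), ← mul_pow]
                simp [pow_succ, mul_comm]
          have hq2 : x / (2 : ℝ) ^ k ≤ 1 := (div_le_one (by positivity)).2 hk
          have : (x / (2 : ℝ) ^ k) ^ (N - (s + ε)) ≤ (x / (2 : ℝ) ^ k) ^ ε :=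
            Real.rpow_le_rpow_of_exponent_ge (by positivity) hq2 (by
              have := min_le_right s (N - s); linarith)
          refine this.trans ((Real.rpow_le_rpow (by positivity) hq1 hε0.le).trans ?_)
          rw [Real.mul_rpow (by positivity) (by positivity)]
          gcongr
          rw [← Real.rpow_natCast, ← Real.rpow_mul (by norm_num), mul_comm,
            Real.rpow_mul (by norm_num), Real.rpow_natCast]
  set q : ℝ≥0∞ := ENNReal.ofReal ((1 / 2 : ℝ) ^ ε) ^ 2 with hq
  have hq1 : q < 1 := by
    rw [hq]
    refine pow_lt_one₀ (by simp) ?_ two_ne_zero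
    rw [← ENNReal.ofReal_one, ENNReal.ofReal_lt_ofReal_iff one_pos]
    exact Real.rpow_lt_one (by norm_num) (by norm_num) hε0
  set C₁ : ℝ≥0∞ := ENNReal.ofReal (C * 2 ^ ε) ^ 2 * (2 * (1 - q)⁻¹)
  set C₂ : ℝ≥0∞ := ENNReal.ofReal (C * 2 ^ (s + ε)) ^ 2
  have hC₁ : C₁ ≠ ⊤ := by
    refine ENNReal.mul_ne_top (by finiteness) (ENNReal.mul_ne_top (by simp) ?_)
    exact ENNReal.inv_ne_top.2 (tsub_pos_of_lt hq1).ne'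
  have hC₂ : C₂ ≠ ⊤ := by finiteness
  refine ⟨(C₁ + C₂).toNNReal, fun x hx => ?_⟩
  rw [ENNReal.coe_toNNReal (by finiteness)]
  obtain ⟨l, hl, hl'⟩ := exists_two_pow_near hx
  constructor
  -- The single term at the scale `2^l ≤ x < 2^(l+1)` already dominates: its truncated power is `1`
  -- and the two arguments of the weight differ by a factor of at most `2`.
  · have h1 := (hC _ x (hone l) hl).1
    have h2 : x / 2 ^ l ≤ 2 := by rw [div_le_iff₀ (by positivity)]; rw [pow_succ] at hl'; linarith
    have h3 : radial s φ x ≤ C * 2 ^ (s + ε) * radial s φ (2 ^ l) :=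
      h1.trans (by
        have := radial_pos (s := s) hφ (hone l)
        gcongr)
    have htr : truncPow N (2 ^ l) x = 1 := by
      unfold truncPow
      split_ifs with h
      · rw [le_antisymm h hl, div_self (by positivity), Real.one_rpow]
      · rfl
    calc ENNReal.ofReal (radial s φ x) ^ 2
        ≤ ENNReal.ofReal (C * 2 ^ (s + ε) * radial s φ (2 ^ l)) ^ 2 := by gcongr
      _ = C₂ * (ENNReal.ofReal (radial s φ (2 ^ l)) ^ 2 *
          ENNReal.ofReal (truncPow N (2 ^ l) x) ^ 2) := by
        rw [htr, ENNReal.ofReal_mul (by positivity), mul_pow]; simp [C₂]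
      _ ≤ (C₁ + C₂) * ∑' k : ℕ, ENNReal.ofReal (radial s φ (2 ^ k)) ^ 2 *
          ENNReal.ofReal (truncPow N (2 ^ k) x) ^ 2 := by
        gcongr
        · exact le_add_self
        · exact ENNReal.le_tsum (f := fun k : ℕ => ENNReal.ofReal (radial s φ (2 ^ k)) ^ 2 *
            ENNReal.ofReal (truncPow N (2 ^ k) x) ^ 2) l
  · calc ∑' k : ℕ, ENNReal.ofReal (radial s φ (2 ^ k)) ^ 2 *
          ENNReal.ofReal (truncPow N (2 ^ k) x) ^ 2
        ≤ ∑' k : ℕ, ENNReal.ofReal (C * 2 ^ ε) ^ 2 * ENNReal.ofReal (radial s φ x) ^ 2 *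
          q ^ (if k ≤ l then l - k else k - l) := by
          refine ENNReal.tsum_le_tsum fun k => ?_
          have hr := radial_pos (s := s) hφ hx
          rw [← mul_pow, ← ENNReal.ofReal_mul (radial_pos hφ (hone k)).le, hq, ← pow_mul,
            mul_comm 2, pow_mul, ← mul_pow, ← mul_pow, ← ENNReal.ofReal_mul (by positivity),
            ← ENNReal.ofReal_pow (p := (1 / 2 : ℝ) ^ ε) (by positivity),
            ← ENNReal.ofReal_mul (by positivity)]
          refine pow_le_pow_left' (ENNReal.ofReal_le_ofReal ?_) 2
          rw [mul_right_comm]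
          exact hterm x hx l hl hl' k
      _ ≤ (C₁ + C₂) * ENNReal.ofReal (radial s φ x) ^ 2 := by
        rw [ENNReal.tsum_mul_left]
        calc _ ≤ ENNReal.ofReal (C * 2 ^ ε) ^ 2 * ENNReal.ofReal (radial s φ x) ^ 2 *
              (2 * (1 - q)⁻¹) := by gcongr; exact tsum_pow_dist_le q l
          _ = C₁ * ENNReal.ofReal (radial s φ x) ^ 2 := by simp only [C₁]; ring
          _ ≤ _ := by gcongr; exact le_self_add

end

end CauchyData

namespace CauchyData

noncomputable section

/-! ### Weighted energies and the space `H^μ` inside `L₂` -/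

/-- The weighted energy `∫ μ² |f|²`. -/
def energy {X : Type*} [MeasurableSpace X] (ν : Measure X) (μ : X → ℝ) (f : X → ℂ) : ℝ≥0∞ :=
  ∫⁻ ξ, ENNReal.ofReal (μ ξ) ^ 2 * ‖f ξ‖ₑ ^ 2 ∂ν

theorem energy_congr {X : Type*} [MeasurableSpace X] {ν : Measure X} (μ : X → ℝ) {f g : X → ℂ}
    (h : f =ᵐ[ν] g) : energy ν μ f = energy ν μ g :=
  lintegral_congr_ae (h.mono fun x hx => by simp only [hx])

theorem eLpNorm_two_sq {X : Type*} [MeasurableSpace X] {ν : Measure X} (f : X → ℂ) :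
    eLpNorm f 2 ν ^ 2 = ∫⁻ x, ‖f x‖ₑ ^ 2 ∂ν := by
  have := eLpNorm_nnreal_pow_eq_lintegral (f := f) (μ := ν) (p := 2) two_ne_zero
  simpa using this

theorem memLp_two_iff {X : Type*} [MeasurableSpace X] {ν : Measure X} {f : X → ℂ}
    (hf : AEStronglyMeasurable f ν) : MemLp f 2 ν ↔ ∫⁻ x, ‖f x‖ₑ ^ 2 ∂ν < ⊤ := by
  rw [← eLpNorm_two_sq, MemLp]
  simp [hf]

theorem lintegral_sq_lt_top {X : Type*} [MeasurableSpace X] {ν : Measure X} {f : X → ℂ}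
    (hf : MemLp f 2 ν) : ∫⁻ x, ‖f x‖ₑ ^ 2 ∂ν < ⊤ :=
  (memLp_two_iff hf.1).1 hf

theorem memLp_of_energy_lt_top {X : Type*} [MeasurableSpace X] {ν : Measure X} {μ : X → ℝ}
    {f : X → ℂ} (hf : AEStronglyMeasurable f ν) {c : ℝ} (hc : 0 < c) (hμ : ∀ x, c ≤ μ x)
    (h : energy ν μ f < ⊤) : MemLp f 2 ν := by
  rw [memLp_two_iff hf]
  have h1 : ENNReal.ofReal c ^ 2 * ∫⁻ x, ‖f x‖ₑ ^ 2 ∂ν ≤ energy ν μ f := by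
    rw [← lintegral_const_mul' _ _ (by finiteness)]
    exact lintegral_mono fun x => by dsimp only; gcongr; exact hμ x
  have h2 : ENNReal.ofReal c ^ 2 ≠ 0 := by positivity
  exact ENNReal.lt_top_of_mul_ne_top_right (h1.trans_lt h).ne h2

theorem lintegral_sq_le_energy {X : Type*} [MeasurableSpace X] {ν : Measure X} {μ : X → ℝ}
    {c : ℝ} (hc : 0 < c) (hμ : ∀ x, c ≤ μ x) :
    ∃ C : ℝ≥0, ∀ f : X → ℂ, ∫⁻ x, ‖f x‖ₑ ^ 2 ∂ν ≤ C * energy ν μ f := by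
  have h2 : ENNReal.ofReal c ^ 2 ≠ 0 := by positivity
  refine ⟨((ENNReal.ofReal c ^ 2)⁻¹).toNNReal, fun f => ?_⟩
  rw [ENNReal.coe_toNNReal (ENNReal.inv_ne_top.2 h2), energy,
    ← lintegral_const_mul' _ _ (ENNReal.inv_ne_top.2 h2)]
  refine lintegral_mono fun x => ?_
  dsimp only
  rw [← mul_assoc]
  refine le_mul_of_one_le_left zero_le ?_
  rw [← ENNReal.inv_mul_cancel h2 (by finiteness)]
  gcongr
  exact hμ x

section Euclidean

variable {E : Type} [NormedAddCommGroup E] [InnerProductSpace ℝ E] [FiniteDimensional ℝ E]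
  [MeasurableSpace E] [BorelSpace E]

variable (E) in
/-- The space `L₂(E)` of complex-valued functions. -/
abbrev L2 : Type := Lp (α := E) ℂ 2 volume

theorem locallyIntegrable_of_memLp_two {f : E → ℂ} (hf : MemLp f 2 volume) :
    LocallyIntegrable f volume := hf.locallyIntegrable one_le_two

/-- Two functions with the same integrals against Schwartz functions with compact support in the
open set `V` agree almost everywhere on `V`. -/
theorem ae_eq_of_schwartz {V : Set E} (hV : IsOpen V) {f g : E → ℂ}
    (hf : LocallyIntegrableOn f V volume) (hg : LocallyIntegrableOn g V volume)
    (h : ∀ ψ : 𝓢(E, ℂ), HasCompactSupport ψ → tsupport ψ ⊆ V →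
      ∫ x in V, f x * ψ x = ∫ x in V, g x * ψ x) : f =ᵐ[volume.restrict V] g := by
  have key : ∀ᵐ x, x ∈ V → (f - g) x = 0 := by
    refine hV.ae_eq_zero_of_integral_contDiff_smul_eq_zero (hf.sub hg) fun u hu hc hs => ?_
    set u' : E → ℂ := fun x => (u x : ℂ) with hu'
    have hu's : Function.support u' = Function.support u := by
      ext x; simp [hu']
    have hc' : HasCompactSupport u' := by
      rw [HasCompactSupport, tsupport, hu's]; exact hc
    have hsm : ContDiff ℝ ∞ u' := Complex.ofRealCLM.contDiff.comp hu
    have ht : tsupport u' ⊆ V := by rw [tsupport, hu's]; exact hs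
    have h1 := h (hc'.toSchwartzMap hsm) hc' ht
    have hint : ∀ w : E → ℂ, LocallyIntegrableOn w V volume →
        IntegrableOn (fun x => w x * u' x) V volume := by
      intro w hw
      have h2 : IntegrableOn w (tsupport u') volume :=
        hw.integrableOn_compact_subset ht hc'
      have h3 : IntegrableOn (fun x => u' x * w x) (tsupport u') volume :=
        h2.continuousOn_mul hsm.continuous.continuousOn hc'
      have h4 : Integrable (fun x => u' x * w x) volume := by
        rw [← integrableOn_iff_integrable_of_support_subset (s := tsupport u')]
        · exact h3
        · intro x hx
          apply subset_tsupport
          intro h0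
          apply hx
          simp [h0]
      exact (h4.congr (Eventually.of_forall fun x => mul_comm _ _)).integrableOn
    have h5 : ∀ x, (hc'.toSchwartzMap hsm) x = u' x := fun x => rfl
    simp only [h5] at h1
    have h6 : ∫ x, u x • (f - g) x = ∫ x in V, (f x * u' x - g x * u' x) := by
      rw [setIntegral_eq_integral_of_forall_compl_eq_zero]
      · congr 1
        ext x
        simp only [hu', Pi.sub_apply, Complex.real_smul]
        ring
      · intro x hx
        have : u' x = 0 := by
          by_contra hne
          exact hx (ht (subset_tsupport _ hne))
        simp [this]
    rw [h6, integral_sub (hint f hf) (hint g hg), h1, sub_self]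
  rw [Filter.EventuallyEq, ae_restrict_iff' hV.measurableSet]
  filter_upwards [key] with x hx hxV
  exact sub_eq_zero.1 (hx hxV)

theorem ae_eq_of_schwartz_univ {f g : E → ℂ} (hf : LocallyIntegrable f) (hg : LocallyIntegrable g)
    (h : ∀ ψ : 𝓢(E, ℂ), HasCompactSupport ψ → ∫ x, f x * ψ x = ∫ x, g x * ψ x) :
    f =ᵐ[volume] g := by
  rw [← Measure.restrict_univ (μ := volume (α := E))]
  exact ae_eq_of_schwartz isOpen_univ (hf.locallyIntegrableOn _) (hg.locallyIntegrableOn _)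
    fun ψ hψ _ => by simpa using h ψ hψ

theorem hasFourierDensity_toTemperedDistribution (f : L2 E) :
    HasFourierDensity (Lp.toTemperedDistribution (𝓕⁻ f : L2 E)) f := by
  refine ⟨locallyIntegrable_of_memLp_two (Lp.memLp f), fun u => ?_⟩
  rw [Lp.fourier_toTemperedDistribution_eq, FourierTransform.fourier_fourierInv_eq,
    Lp.toTemperedDistribution_apply]
  exact integral_congr_ae (Eventually.of_forall fun x => by simp [mul_comm])

theorem hormanderNormOn_le {μ : E → ℝ} {V : Set E} {u : E → ℂ}
    {f : L2 E} (h : (𝓕⁻ f : L2 E) =ᵐ[volume.restrict V] u) :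
    hormanderNormOn μ V u ≤ energy volume μ f ^ (1 / 2 : ℝ) := by
  have hr : RestrictsTo (Lp.toTemperedDistribution (𝓕⁻ f : L2 E)) V u := by
    refine ⟨?_, fun ψ _ hs => ?_⟩
    · have h1 := (locallyIntegrable_of_memLp_two (Lp.memLp (𝓕⁻ f))).locallyIntegrableOn V
      intro x hx
      obtain ⟨t, ht, hti⟩ := h1 x hx
      refine ⟨t ∩ V, inter_mem ht self_mem_nhdsWithin, ?_⟩
      refine (hti.mono_set inter_subset_left).congr ?_
      exact ae_restrict_of_ae_restrict_of_subset inter_subset_right h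
    · rw [Lp.toTemperedDistribution_apply, ← setIntegral_eq_integral_of_forall_compl_eq_zero
        (s := V)]
      · refine integral_congr_ae (h.mono fun x hx => ?_)
        simp only [hx, smul_eq_mul, mul_comm]
      · intro x hx
        have : ψ x = 0 := by
          by_contra hne
          exact hx (hs (subset_tsupport _ hne))
        simp [this]
  unfold hormanderNormOn hormanderNorm
  refine (iInf₂_le (Lp.toTemperedDistribution (𝓕⁻ f : L2 E)) hr).trans ?_
  exact iInf₂_le _ (hasFourierDensity_toTemperedDistribution f)

/-- A weight bounded away from zero forces every density of finite energy into `L₂`, so a nearly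
optimal extension is the inverse `L₂` transform of its density. Openness of `V` lets test functions
identify it with `u` there. -/
theorem exists_of_hormanderNormOn_lt {μ : E → ℝ} {V : Set E} (hV : IsOpen V) {u : E → ℂ}
    {c : ℝ} (hc : 0 < c) (hμ : ∀ x, c ≤ μ x) {b : ℝ≥0∞} (h : hormanderNormOn μ V u < b) :
    ∃ f : L2 E, (𝓕⁻ f : L2 E) =ᵐ[volume.restrict V] u ∧
      energy volume μ f ^ (1 / 2 : ℝ) < b := by
  unfold hormanderNormOn hormanderNorm at h
  simp only [iInf_lt_iff] at h
  obtain ⟨w, hw, f, hf, hlt⟩ := h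
  have hen : energy volume μ f < ⊤ := by
    by_contra hcon
    rw [not_lt, top_le_iff] at hcon
    unfold energy at hcon
    rw [hcon] at hlt
    simp at hlt
  have hm : MemLp f 2 volume := memLp_of_energy_lt_top hf.1.aestronglyMeasurable hc hμ hen
  set F : L2 E := hm.toLp f with hF
  have hFf : F =ᵐ[volume] f := hm.coeFn_toLp
  refine ⟨F, ?_, by rw [energy_congr μ hFf]; exact hlt⟩
  have hwF : 𝓕 w = Lp.toTemperedDistribution F := by
    ext ψ
    rw [hf.2, Lp.toTemperedDistribution_apply]
    refine integral_congr_ae (hFf.mono fun x hx => ?_)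
    simp only [hx, smul_eq_mul, mul_comm]
  have hw' : w = Lp.toTemperedDistribution (𝓕⁻ F : L2 E) := by
    rw [← Lp.fourierInv_toTemperedDistribution_eq, ← hwF, FourierTransform.fourierInv_fourier_eq]
  refine ae_eq_of_schwartz hV
    ((locallyIntegrable_of_memLp_two (Lp.memLp (𝓕⁻ F))).locallyIntegrableOn V) hw.1
    fun ψ hψ hs => ?_
  rw [← hw.2 ψ hψ hs, hw', Lp.toTemperedDistribution_apply,
    setIntegral_eq_integral_of_forall_compl_eq_zero]
  · simp [mul_comm]
  · intro x hx
    have : ψ x = 0 := by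
      by_contra hne
      exact hx (hs (subset_tsupport _ hne))
    simp [this]

end Euclidean

end

end CauchyData

namespace CauchyData

noncomputable section

/-! ### Weighted composition operators on `L₂` -/

section Composition

variable {X Y Z : Type*} [MeasurableSpace X] [MeasurableSpace Y] [MeasurableSpace Z]

/-- The hypotheses under which `f ↦ a · (f ∘ ρ)` is a bounded operator from `L₂(μ)` to `L₂(ν)`. -/
structure BoundedComp (a : Y → ℂ) (ρ : Y → X) (ν : Measure Y) (μ : Measure X) : Prop where
  measurable_weight : Measurable a
  measurable_map : Measurable ρ
  bounded : ∃ M : ℝ≥0, ∀ y, ‖a y‖ₑ ≤ M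
  map_le : ∃ C : ℝ≥0, (ν.restrict {y | a y ≠ 0}).map ρ ≤ (C : ℝ≥0∞) • μ

namespace BoundedComp

variable {a : Y → ℂ} {ρ : Y → X} {ν : Measure Y} {μ : Measure X}

theorem measurableSet_ne (h : BoundedComp a ρ ν μ) : MeasurableSet {y | a y ≠ 0} :=
  (h.measurable_weight (measurableSet_singleton 0)).compl

theorem absolutelyContinuous (h : BoundedComp a ρ ν μ) :
    (ν.restrict {y | a y ≠ 0}).map ρ ≪ μ := by
  obtain ⟨C, hC⟩ := h.map_le
  exact hC.absolutelyContinuous.trans Measure.smul_absolutelyContinuous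

theorem ae_of_ae (h : BoundedComp a ρ ν μ) {p : X → Prop} (hp : ∀ᵐ x ∂μ, p x) :
    ∀ᵐ y ∂ν, a y ≠ 0 → p (ρ y) := by
  have h1 := h.absolutelyContinuous.ae_le hp
  have h2 := ae_of_ae_map h.measurable_map.aemeasurable h1
  exact (ae_restrict_iff' h.measurableSet_ne).1 h2

theorem ae_eq (h : BoundedComp a ρ ν μ) {f g : X → ℂ} (hfg : f =ᵐ[μ] g) :
    (fun y => a y * f (ρ y)) =ᵐ[ν] fun y => a y * g (ρ y) := by
  filter_upwards [h.ae_of_ae hfg] with y hy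
  by_cases h0 : a y = 0
  · simp [h0]
  · rw [hy h0]

theorem aestronglyMeasurable (h : BoundedComp a ρ ν μ) {f : X → ℂ}
    (hf : AEStronglyMeasurable f μ) : AEStronglyMeasurable (fun y => a y * f (ρ y)) ν := by
  refine AEStronglyMeasurable.congr ?_ (h.ae_eq hf.ae_eq_mk).symm
  exact (h.measurable_weight.mul
    (hf.stronglyMeasurable_mk.measurable.comp h.measurable_map)).aestronglyMeasurable

/-- The comparison of measures is needed only where the weight does not vanish. Hence `ρ` may be
arbitrary elsewhere, for instance an inverse chart extended by zero. -/
theorem lintegral_le (h : BoundedComp a ρ ν μ) : ∃ C : ℝ≥0, ∀ f : X → ℂ, AEStronglyMeasurable f μ →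
    ∫⁻ y, ‖a y * f (ρ y)‖ₑ ^ 2 ∂ν ≤ C * ∫⁻ x, ‖f x‖ₑ ^ 2 ∂μ := by
  obtain ⟨M, hM⟩ := h.bounded
  obtain ⟨C, hC⟩ := h.map_le
  refine ⟨M ^ 2 * C, fun f hf => ?_⟩
  calc ∫⁻ y, ‖a y * f (ρ y)‖ₑ ^ 2 ∂ν
      ≤ ∫⁻ y, {y | a y ≠ 0}.indicator (fun y => (M : ℝ≥0∞) ^ 2 * ‖f (ρ y)‖ₑ ^ 2) y ∂ν := by
        refine lintegral_mono fun y => ?_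
        by_cases h0 : a y = 0
        · simp [h0]
        · rw [indicator_of_mem (by exact h0), enorm_mul, mul_pow]
          gcongr
          exact hM y
    _ = (M : ℝ≥0∞) ^ 2 * ∫⁻ y in {y | a y ≠ 0}, ‖f (ρ y)‖ₑ ^ 2 ∂ν := by
        rw [lintegral_indicator h.measurableSet_ne, lintegral_const_mul' _ _ (by finiteness)]
    _ = (M : ℝ≥0∞) ^ 2 * ∫⁻ x, ‖f x‖ₑ ^ 2 ∂((ν.restrict {y | a y ≠ 0}).map ρ) := by
        rw [lintegral_map' _ h.measurable_map.aemeasurable]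
        exact ((hf.mono_ac h.absolutelyContinuous).enorm.pow_const 2)
    _ ≤ (M : ℝ≥0∞) ^ 2 * ∫⁻ x, ‖f x‖ₑ ^ 2 ∂((C : ℝ≥0∞) • μ) := by
        gcongr
    _ = _ := by
        rw [lintegral_smul_measure, smul_eq_mul, ← mul_assoc]
        push_cast
        rfl

theorem memLp (h : BoundedComp a ρ ν μ) {f : X → ℂ} (hf : MemLp f 2 μ) :
    MemLp (fun y => a y * f (ρ y)) 2 ν := by
  obtain ⟨C, hC⟩ := h.lintegral_le
  rw [memLp_two_iff (h.aestronglyMeasurable hf.1)]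
  exact (hC f hf.1).trans_lt (ENNReal.mul_lt_top (by simp) (lintegral_sq_lt_top hf))

/-- The weighted composition operator on `L₂`. -/
def op (h : BoundedComp a ρ ν μ) : Lp ℂ 2 μ →ₗ[ℂ] Lp ℂ 2 ν where
  toFun f := (h.memLp (Lp.memLp f)).toLp _
  map_add' f g := by
    rw [← MemLp.toLp_add]
    refine MemLp.toLp_congr _ _ ?_
    filter_upwards [h.ae_eq (Lp.coeFn_add f g)] with y hy
    rw [hy]
    simp [mul_add]
  map_smul' c f := by
    rw [RingHom.id_apply, ← MemLp.toLp_const_smul]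
    refine MemLp.toLp_congr _ _ ?_
    filter_upwards [h.ae_eq (Lp.coeFn_smul c f)] with y hy
    rw [hy]
    simp only [Pi.smul_apply, smul_eq_mul]
    ring

theorem coeFn_op (h : BoundedComp a ρ ν μ) (f : Lp ℂ 2 μ) :
    h.op f =ᵐ[ν] fun y => a y * f (ρ y) := (h.memLp (Lp.memLp f)).coeFn_toLp

/-- A weighted composition acting in the first variable of a product. -/
theorem prod (h : BoundedComp a ρ ν μ) (κ : Measure Z) [SFinite ν] [SFinite μ] [SFinite κ] :
    BoundedComp (fun z : Y × Z => a z.1) (Prod.map ρ id) (ν.prod κ) (μ.prod κ) where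
  measurable_weight := h.measurable_weight.comp measurable_fst
  measurable_map := h.measurable_map.prodMap measurable_id
  bounded := let ⟨M, hM⟩ := h.bounded; ⟨M, fun z => hM z.1⟩
  map_le := by
    obtain ⟨C, hC⟩ := h.map_le
    refine ⟨C, ?_⟩
    have h1 : {z : Y × Z | a z.1 ≠ 0} = {y | a y ≠ 0} ×ˢ univ := by ext; simp
    rw [h1, ← Measure.prod_restrict, Measure.restrict_univ,
      ← Measure.map_prod_map _ _ h.measurable_map measurable_id, Measure.map_id]
    refine Measure.le_iff.2 fun s hs => ?_
    rw [Measure.smul_apply, Measure.prod_apply hs, Measure.prod_apply hs, smul_eq_mul,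
      ← smul_eq_mul, ← lintegral_smul_measure]
    exact lintegral_mono' hC le_rfl

theorem mono_weight (h : BoundedComp a ρ ν μ) {b : Y → ℂ} (hb : Measurable b)
    (hbb : ∃ M : ℝ≥0, ∀ y, ‖b y‖ₑ ≤ M) (hab : ∀ y, a y = 0 → b y = 0) :
    BoundedComp b ρ ν μ where
  measurable_weight := hb
  measurable_map := h.measurable_map
  bounded := hbb
  map_le := by
    obtain ⟨C, hC⟩ := h.map_le
    refine ⟨C, le_trans ?_ hC⟩
    have hsub : {y | b y ≠ 0} ⊆ {y | a y ≠ 0} := fun y (hy : b y ≠ 0) (h0 : a y = 0) =>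
      hy (hab y h0)
    exact Measure.map_mono (Measure.restrict_mono hsub le_rfl) h.measurable_map

/-- The composite weight is nonzero only where both factors are, so the two measure bounds apply one
after the other. -/
theorem comp {W : Type*} [MeasurableSpace W] {b : X → ℂ} {σ : X → W} {κ : Measure W}
    (h : BoundedComp a ρ ν μ) (h' : BoundedComp b σ μ κ) :
    BoundedComp (fun y => a y * b (ρ y)) (σ ∘ ρ) ν κ where
  measurable_weight := h.measurable_weight.mul (h'.measurable_weight.comp h.measurable_map)
  measurable_map := h'.measurable_map.comp h.measurable_map
  bounded := by
    obtain ⟨M, hM⟩ := h.bounded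
    obtain ⟨M', hM'⟩ := h'.bounded
    refine ⟨M * M', fun y => ?_⟩
    rw [enorm_mul, ENNReal.coe_mul]
    exact mul_le_mul' (hM y) (hM' _)
  map_le := by
    obtain ⟨C, hC⟩ := h.map_le
    obtain ⟨C', hC'⟩ := h'.map_le
    refine ⟨C * C', Measure.le_iff.2 fun s hs => ?_⟩
    have hs' := h'.measurable_map hs
    calc ((ν.restrict {y | a y * b (ρ y) ≠ 0}).map (σ ∘ ρ)) s
        ≤ ((ν.restrict {y | a y ≠ 0}).map ρ) (σ ⁻¹' s ∩ {x | b x ≠ 0}) := by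
          rw [Measure.map_apply (h'.measurable_map.comp h.measurable_map) hs,
            Measure.map_apply h.measurable_map (hs'.inter h'.measurableSet_ne),
            preimage_comp, Measure.restrict_apply (h.measurable_map hs'),
            Measure.restrict_apply (h.measurable_map (hs'.inter h'.measurableSet_ne))]
          refine measure_mono fun y hy => ?_
          exact ⟨⟨hy.1, right_ne_zero_of_mul hy.2⟩, left_ne_zero_of_mul hy.2⟩
      _ ≤ C * μ (σ ⁻¹' s ∩ {x | b x ≠ 0}) := hC _
      _ = C * ((μ.restrict {x | b x ≠ 0}).map σ) s := by
          rw [Measure.map_apply h'.measurable_map hs, Measure.restrict_apply hs']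
      _ ≤ C * (C' * κ s) := by gcongr; exact hC' s
      _ = _ := by simp [mul_assoc]

end BoundedComp

end Composition

/-! ### Interpolation with a function parameter -/

section Interpolation

variable {X : Type*} [MeasurableSpace X] {ν : Measure X}

theorem enorm_add_sq_le (a b : ℂ) : ‖a + b‖ₑ ^ 2 ≤ 2 * ‖a‖ₑ ^ 2 + 2 * ‖b‖ₑ ^ 2 := by
  have h1 : ‖a + b‖ ^ 2 ≤ 2 * ‖a‖ ^ 2 + 2 * ‖b‖ ^ 2 := by
    nlinarith [norm_add_le a b, norm_nonneg a, norm_nonneg b, norm_nonneg (a + b),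
      sq_nonneg (‖a‖ - ‖b‖)]
  have h2 : ∀ z : ℂ, ‖z‖ₑ ^ 2 = ENNReal.ofReal (‖z‖ ^ 2) := fun z => by
    rw [← ofReal_norm, ENNReal.ofReal_pow (norm_nonneg z)]
  rw [h2, h2, h2, show (2 : ℝ≥0∞) = ENNReal.ofReal 2 by simp, ← ENNReal.ofReal_mul (by norm_num),
    ← ENNReal.ofReal_mul (by norm_num), ← ENNReal.ofReal_add (by positivity) (by positivity)]
  exact ENNReal.ofReal_le_ofReal h1

theorem truncPow_le_one {N y x : ℝ} (hN : 0 ≤ N) (hy : 0 < y) (hx : 0 ≤ x) :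
    truncPow N y x ≤ 1 := by
  unfold truncPow
  split_ifs with h
  · exact Real.rpow_le_one (by positivity) ((div_le_one hy).2 h) hN
  · exact le_rfl

theorem truncPow_le_rpow {N y x : ℝ} (hN : 0 ≤ N) (hy : 0 < y) : truncPow N y x ≤ (x / y) ^ N := by
  unfold truncPow
  split_ifs with h
  · exact le_rfl
  · exact Real.one_le_rpow ((one_le_div hy).2 (not_le.1 h).le) hN

theorem measurable_truncPow {N y : ℝ} : Measurable (truncPow N y) := by
  unfold truncPow
  exact Measurable.ite measurableSet_Iic (by fun_prop) measurable_const

theorem measurable_radial_comp {s : ℝ} {φ : ℝ → ℝ} (hφ : ClassM φ) {ρ : X → ℝ} (hρ : Measurable ρ)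
    (hρ1 : ∀ x, 1 ≤ ρ x) : Measurable fun x => radial s φ (ρ x) := by
  have : (fun x => radial s φ (ρ x)) = fun x => ρ x ^ s * φ (max 1 (ρ x)) := by
    ext x; rw [radial, max_eq_right (hρ1 x)]
  rw [this]
  exact (hρ.pow_const s).mul (hφ.measurable_comp_max.comp hρ)

/-- The function is split at the level `ρ = y`. On the part `a` with `ρ > y` the truncated power is
`1` and the `L₂` bound is used; on the part `b` with `ρ ≤ y` it is `(ρ/y)^N` and the bound of order
`N` is used. Both weights dominate the truncated power everywhere, so it does not matter that `K`
may mix the two regions. The constant `4C` is independent of `y`. -/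
theorem energy_truncPow_le {ρ : X → ℝ} (hρ : Measurable ρ) (hρ1 : ∀ x, 1 ≤ ρ x) {N : ℝ} (hN : 0 ≤ N)
    (K : Lp ℂ 2 ν →ₗ[ℂ] Lp ℂ 2 ν) {C : ℝ≥0}
    (h0 : ∀ f, ∫⁻ x, ‖K f x‖ₑ ^ 2 ∂ν ≤ C * ∫⁻ x, ‖f x‖ₑ ^ 2 ∂ν)
    (hKN : ∀ f, energy ν (fun x => ρ x ^ N) (K f) ≤ C * energy ν (fun x => ρ x ^ N) f)
    {y : ℝ} (hy : 0 < y) (f : Lp ℂ 2 ν) :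
    energy ν (fun x => truncPow N y (ρ x)) (K f) ≤
      4 * C * energy ν (fun x => truncPow N y (ρ x)) f := by
  have hS : MeasurableSet {x | ρ x ≤ y} := hρ measurableSet_Iic
  set a : Lp ℂ 2 ν := ((Lp.memLp f).indicator hS.compl).toLp _
  set b : Lp ℂ 2 ν := ((Lp.memLp f).indicator hS).toLp _
  have ha : a =ᵐ[ν] {x | ρ x ≤ y}ᶜ.indicator f := MemLp.coeFn_toLp _
  have hb : b =ᵐ[ν] {x | ρ x ≤ y}.indicator f := MemLp.coeFn_toLp _
  have hab : f = a + b := by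
    apply Lp.ext
    filter_upwards [ha, hb, Lp.coeFn_add a b] with x h1 h2 h3
    rw [h3, Pi.add_apply, h1, h2, indicator_compl_add_self_apply]
  -- The weight `(ρ/y)^N` differs from `ρ^N` by a constant factor, so the bound of order `N`
  -- rescales with the same constant.
  have hsc : ∀ g : X → ℂ, energy ν (fun x => (ρ x / y) ^ N) g =
      ENNReal.ofReal ((y ^ N)⁻¹) ^ 2 * energy ν (fun x => ρ x ^ N) g := by
    intro g
    unfold energy
    rw [← lintegral_const_mul' _ _ (by finiteness)]
    refine lintegral_congr fun x => ?_
    dsimp only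
    rw [← mul_assoc, ← mul_pow (ENNReal.ofReal _) (ENNReal.ofReal _),
      ← ENNReal.ofReal_mul (by positivity), Real.div_rpow (by linarith [hρ1 x]) hy.le,
      div_eq_inv_mul]
  have h1 : energy ν (fun x => truncPow N y (ρ x)) (K f) ≤
      2 * ∫⁻ x, ‖K a x‖ₑ ^ 2 ∂ν + 2 * energy ν (fun x => (ρ x / y) ^ N) (K b) := by
    have hKf : K f =ᵐ[ν] fun x => K a x + K b x := by
      rw [hab, map_add]
      exact Lp.coeFn_add _ _
    rw [energy_congr _ hKf, energy, energy, ← lintegral_const_mul' _ _ (by simp),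
      ← lintegral_const_mul' _ _ (by simp), ← lintegral_add_left']
    · refine lintegral_mono fun x => ?_
      dsimp only
      calc ENNReal.ofReal (truncPow N y (ρ x)) ^ 2 * ‖K a x + K b x‖ₑ ^ 2
          ≤ ENNReal.ofReal (truncPow N y (ρ x)) ^ 2 * (2 * ‖K a x‖ₑ ^ 2 + 2 * ‖K b x‖ₑ ^ 2) := by
            gcongr; exact enorm_add_sq_le _ _
        _ = 2 * (ENNReal.ofReal (truncPow N y (ρ x)) ^ 2 * ‖K a x‖ₑ ^ 2) +
            2 * (ENNReal.ofReal (truncPow N y (ρ x)) ^ 2 * ‖K b x‖ₑ ^ 2) := by ring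
        _ ≤ _ := by
            refine add_le_add (mul_le_mul_right ?_ _) (mul_le_mul_right ?_ _)
            · refine mul_le_of_le_one_left zero_le (pow_le_one₀ zero_le ?_)
              rw [ENNReal.ofReal_le_one]
              exact truncPow_le_one hN hy (by linarith [hρ1 x])
            · gcongr
              exact truncPow_le_rpow hN hy
    · exact ((Lp.aestronglyMeasurable (K a)).enorm.pow_const 2).const_mul 2
  have h2 : ∫⁻ x, ‖a x‖ₑ ^ 2 ∂ν ≤ energy ν (fun x => truncPow N y (ρ x)) f := by
    rw [lintegral_congr_ae (ha.mono fun x hx => by rw [hx])]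
    refine lintegral_mono fun x => ?_
    dsimp only
    by_cases hx : ρ x ≤ y
    · simp [hx]
    · simp [hx, truncPow]
  have h3 : energy ν (fun x => (ρ x / y) ^ N) b ≤ energy ν (fun x => truncPow N y (ρ x)) f := by
    rw [energy_congr _ hb]
    refine lintegral_mono fun x => ?_
    dsimp only
    by_cases hx : ρ x ≤ y
    · simp [hx, truncPow]
    · simp [hx]
  refine h1.trans ?_
  rw [hsc]
  calc 2 * ∫⁻ x, ‖K a x‖ₑ ^ 2 ∂ν +
        2 * (ENNReal.ofReal ((y ^ N)⁻¹) ^ 2 * energy ν (fun x => ρ x ^ N) (K b))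
      ≤ 2 * (C * ∫⁻ x, ‖a x‖ₑ ^ 2 ∂ν) +
        2 * (ENNReal.ofReal ((y ^ N)⁻¹) ^ 2 * (C * energy ν (fun x => ρ x ^ N) b)) := by
        gcongr
        · exact h0 a
        · exact hKN b
    _ = 2 * C * ∫⁻ x, ‖a x‖ₑ ^ 2 ∂ν + 2 * C * energy ν (fun x => (ρ x / y) ^ N) b := by
        rw [hsc]; ring
    _ ≤ 2 * C * energy ν (fun x => truncPow N y (ρ x)) f +
        2 * C * energy ν (fun x => truncPow N y (ρ x)) f := by gcongr
    _ = _ := by ring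

/-- Interpolation with a function parameter between the weights `1` and `ρ ^ N`. -/
theorem energy_radial_le {ρ : X → ℝ} (hρ : Measurable ρ) (hρ1 : ∀ x, 1 ≤ ρ x) {s N : ℝ}
    (hs : 0 < s) (hN : s < N) {φ : ℝ → ℝ} (hφ : ClassM φ) (K : Lp ℂ 2 ν →ₗ[ℂ] Lp ℂ 2 ν) {C : ℝ≥0}
    (h0 : ∀ f, ∫⁻ x, ‖K f x‖ₑ ^ 2 ∂ν ≤ C * ∫⁻ x, ‖f x‖ₑ ^ 2 ∂ν)
    (hKN : ∀ f, energy ν (fun x => ρ x ^ N) (K f) ≤ C * energy ν (fun x => ρ x ^ N) f) :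
    ∃ C' : ℝ≥0, ∀ f, energy ν (fun x => radial s φ (ρ x)) (K f) ≤
      C' * energy ν (fun x => radial s φ (ρ x)) f := by
  -- The truncated estimates may be summed over the dyadic levels because their constant does not
  -- depend on the level.
  obtain ⟨D, hD⟩ := radial_equiv_tsum hs hN hφ
  have hsum : ∀ g : Lp ℂ 2 ν, ∫⁻ x, (∑' k : ℕ, ENNReal.ofReal (radial s φ (2 ^ k)) ^ 2 *
        ENNReal.ofReal (truncPow N (2 ^ k) (ρ x)) ^ 2) * ‖g x‖ₑ ^ 2 ∂ν =
      ∑' k : ℕ, ENNReal.ofReal (radial s φ (2 ^ k)) ^ 2 *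
        energy ν (fun x => truncPow N (2 ^ k) (ρ x)) g := by
    intro g
    simp_rw [← ENNReal.tsum_mul_right]
    rw [lintegral_tsum]
    · refine tsum_congr fun k => ?_
      rw [energy, ← lintegral_const_mul' _ _ (by finiteness)]
      simp_rw [mul_assoc]
    · intro k
      have h1 : Measurable fun x => ENNReal.ofReal (truncPow N (2 ^ k) (ρ x)) ^ 2 :=
        (measurable_truncPow.comp hρ).ennreal_ofReal.pow_const 2
      exact ((h1.const_mul _).aemeasurable).mul
        ((Lp.aestronglyMeasurable g).enorm.pow_const 2)
  refine ⟨D * (4 * C) * D, fun f => ?_⟩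
  calc energy ν (fun x => radial s φ (ρ x)) (K f)
      ≤ ∫⁻ x, D * ((∑' k : ℕ, ENNReal.ofReal (radial s φ (2 ^ k)) ^ 2 *
        ENNReal.ofReal (truncPow N (2 ^ k) (ρ x)) ^ 2) * ‖K f x‖ₑ ^ 2) ∂ν := by
        refine lintegral_mono fun x => ?_
        dsimp only
        rw [← mul_assoc]
        gcongr
        exact (hD _ (hρ1 x)).1
    _ = D * ∑' k : ℕ, ENNReal.ofReal (radial s φ (2 ^ k)) ^ 2 *
        energy ν (fun x => truncPow N (2 ^ k) (ρ x)) (K f) := by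
        rw [lintegral_const_mul' _ _ (by simp), hsum]
    _ ≤ D * ∑' k : ℕ, (4 * C) * (ENNReal.ofReal (radial s φ (2 ^ k)) ^ 2 *
        energy ν (fun x => truncPow N (2 ^ k) (ρ x)) f) := by
        refine mul_le_mul_right (ENNReal.tsum_le_tsum fun k => ?_) _
        rw [mul_left_comm]
        gcongr
        exact energy_truncPow_le hρ hρ1 (hs.trans hN).le K h0 hKN (by positivity) f
    _ = D * (4 * C) * ∫⁻ x, (∑' k : ℕ, ENNReal.ofReal (radial s φ (2 ^ k)) ^ 2 *
        ENNReal.ofReal (truncPow N (2 ^ k) (ρ x)) ^ 2) * ‖f x‖ₑ ^ 2 ∂ν := by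
        rw [ENNReal.tsum_mul_left, hsum]; ring
    _ ≤ D * (4 * C) * ∫⁻ x, D * (ENNReal.ofReal (radial s φ (ρ x)) ^ 2 * ‖f x‖ₑ ^ 2) ∂ν := by
        refine mul_le_mul_right (lintegral_mono fun x => ?_) _
        dsimp only
        rw [← mul_assoc]
        gcongr
        exact (hD _ (hρ1 x)).2
    _ = _ := by
        rw [lintegral_const_mul' _ _ (by simp), energy]
        push_cast
        ring

end Interpolation

end

end CauchyData

namespace CauchyData

noncomputable section

/-! ### Fourier transform in `L₂` -/

section Plancherel

variable {E : Type} [NormedAddCommGroup E] [InnerProductSpace ℝ E] [FiniteDimensional ℝ E]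
  [MeasurableSpace E] [BorelSpace E]

theorem lintegral_enorm_fourier_sq (f : L2 E) :
    ∫⁻ x, ‖(𝓕 f : L2 E) x‖ₑ ^ 2 = ∫⁻ x, ‖f x‖ₑ ^ 2 := by
  rw [← eLpNorm_two_sq, ← eLpNorm_two_sq, ← Lp.enorm_def, ← Lp.enorm_def, ← ofReal_norm,
    ← ofReal_norm, Lp.norm_fourier_eq]

theorem lintegral_enorm_fourierInv_sq (f : L2 E) :
    ∫⁻ x, ‖(𝓕⁻ f : L2 E) x‖ₑ ^ 2 = ∫⁻ x, ‖f x‖ₑ ^ 2 := by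
  rw [← lintegral_enorm_fourier_sq, FourierTransform.fourier_fourierInv_eq]

theorem lintegral_enorm_schwartz_fourier_sq (f : 𝓢(E, ℂ)) :
    ∫⁻ x, ‖𝓕 f x‖ₑ ^ 2 = ∫⁻ x, ‖f x‖ₑ ^ 2 := by
  have h1 := lintegral_enorm_fourier_sq (f.toLp 2)
  rw [SchwartzMap.toLp_fourier_eq] at h1
  have h2 : ∀ g : 𝓢(E, ℂ), ∫⁻ x, ‖g.toLp 2 volume x‖ₑ ^ 2 = ∫⁻ x, ‖g x‖ₑ ^ 2 := fun g =>
    lintegral_congr_ae ((g.coeFn_toLp 2 volume).mono fun x hx => by simp only [hx])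
  rwa [h2, h2] at h1

theorem enorm_fourier_lineDeriv (f : 𝓢(E, ℂ)) (m ξ : E) :
    ‖𝓕 (∂_{m} f) ξ‖ₑ ^ 2 =
      ENNReal.ofReal ((2 * Real.pi) ^ 2) * ENNReal.ofReal (inner ℝ ξ m ^ 2) * ‖𝓕 f ξ‖ₑ ^ 2 := by
  rw [SchwartzMap.fourier_lineDerivOp_eq, smul_apply,
    SchwartzMap.smulLeftCLM_apply_apply (by fun_prop), smul_eq_mul, enorm_mul, enorm_smul, mul_pow,
    mul_pow]
  have h1 : ‖(2 * (Real.pi : ℂ) * Complex.I)‖ₑ ^ 2 = ENNReal.ofReal ((2 * Real.pi) ^ 2) := by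
    rw [← ofReal_norm, ← ENNReal.ofReal_pow (norm_nonneg _)]
    congr 2
    simp [abs_of_pos Real.pi_pos]
  have h2 : ‖inner ℝ ξ m‖ₑ ^ 2 = ENNReal.ofReal (inner ℝ ξ m ^ 2) := by
    rw [← ofReal_norm, ← ENNReal.ofReal_pow (norm_nonneg _), Real.norm_eq_abs, sq_abs]
  rw [h1, h2, mul_assoc]

end Plancherel

theorem fderiv_mul_apply {E : Type*} [NormedAddCommGroup E] [NormedSpace ℝ E] {A B : E → ℂ}
    {A' B' : E →L[ℝ] ℂ} {z : E} (hA : HasFDerivAt A A' z) (hB : HasFDerivAt B B' z) (m : E) :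
    fderiv ℝ (fun z => A z * B z) z m = A' m * B z + A z * B' m := by
  rw [(hA.fun_mul hB).fderiv]
  simp only [add_apply, smul_apply, smul_eq_mul]
  ring

/-! ### Changes of the spatial variables in Schwartz functions on `ℝ^d × ℝ` -/

section SpaceTime

variable {d : ℕ}

theorem measurable_fst' : Measurable fun z : SpaceTime d => z.fst :=
  (WithLp.prod_continuous_ofLp 2 _ _).fst.measurable

/-- The projection to the spatial variables. -/
def fstCLM (d : ℕ) : SpaceTime d →L[ℝ] Eucl d :=
  (ContinuousLinearMap.fst ℝ _ _).comp (WithLp.prodContinuousLinearEquiv 2 ℝ (Eucl d) ℝ).toContinuousLinearMap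

/-- The projection to the time variable. -/
def sndCLM (d : ℕ) : SpaceTime d →L[ℝ] ℝ :=
  (ContinuousLinearMap.snd ℝ _ _).comp (WithLp.prodContinuousLinearEquiv 2 ℝ (Eucl d) ℝ).toContinuousLinearMap

/-- The inclusion of the spatial directions. -/
def inlCLM (d : ℕ) : Eucl d →L[ℝ] SpaceTime d :=
  (WithLp.prodContinuousLinearEquiv 2 ℝ (Eucl d) ℝ).symm.toContinuousLinearMap.comp
    (ContinuousLinearMap.inl ℝ _ _)

/-- The inclusion of the time direction. -/
def inrCLM (d : ℕ) : ℝ →L[ℝ] SpaceTime d :=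
  (WithLp.prodContinuousLinearEquiv 2 ℝ (Eucl d) ℝ).symm.toContinuousLinearMap.comp
    (ContinuousLinearMap.inr ℝ _ _)

@[simp] theorem fstCLM_apply (z : SpaceTime d) : fstCLM d z = z.fst := rfl
@[simp] theorem sndCLM_apply (z : SpaceTime d) : sndCLM d z = z.snd := rfl
@[simp] theorem inlCLM_apply (x : Eucl d) : inlCLM d x = WithLp.toLp 2 (x, 0) := rfl
@[simp] theorem inrCLM_apply (t : ℝ) : inrCLM d t = WithLp.toLp 2 (0, t) := rfl

/-- A self-map of `ℝ^d` extended to `ℝ^d × ℝ` by the identity in time. -/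
def lift (α : Eucl d → Eucl d) (z : SpaceTime d) : SpaceTime d := WithLp.toLp 2 (α z.fst, z.snd)

theorem lift_eq (α : Eucl d → Eucl d) (z : SpaceTime d) :
    lift α z = z + inlCLM d (α z.fst - z.fst) := by
  apply WithLp.ofLp_injective
  ext1 <;> simp [lift]

/-- A smooth self-map of `ℝ^d` which is the identity outside a compact set. -/
structure IsCompactPerturbation (α : Eucl d → Eucl d) : Prop where
  contDiff : ContDiff ℝ ∞ α
  compact : HasCompactSupport fun x => α x - x

namespace IsCompactPerturbation

variable {α : Eucl d → Eucl d}

theorem contDiff_sub (hα : IsCompactPerturbation α) : ContDiff ℝ ∞ fun x => α x - x := hα.contDiff.sub contDiff_id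

theorem hasTemperateGrowth_lift (hα : IsCompactPerturbation α) : (lift α).HasTemperateGrowth := by
  have h1 : lift α = fun z => id z + (inlCLM d ∘ (fun x => α x - x) ∘ fstCLM d) z := by
    ext1 z; exact lift_eq α z
  rw [h1]
  have h2 : (inlCLM d ∘ (fun x => α x - x) ∘ fstCLM d).HasTemperateGrowth :=
    (inlCLM d).hasTemperateGrowth.comp
      ((hα.compact.hasTemperateGrowth hα.contDiff_sub).comp (fstCLM d).hasTemperateGrowth)
  exact Function.HasTemperateGrowth.id.add h2

/-- Points are moved by a bounded distance only. This is the growth condition under which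
composition with `lift α` preserves Schwartz functions; `α` need not be injective for it. -/
theorem norm_le_lift (hα : IsCompactPerturbation α) :
    ∃ (k : ℕ) (C : ℝ), ∀ z : SpaceTime d, ‖z‖ ≤ C * (1 + ‖lift α z‖) ^ k := by
  obtain ⟨M, hM⟩ := hα.compact.exists_bound_of_continuous hα.contDiff_sub.continuous
  set D := ‖inlCLM d‖ * |M|
  refine ⟨1, 1 + D, fun z => ?_⟩
  have h1 : z = lift α z - inlCLM d (α z.fst - z.fst) := by rw [lift_eq]; abel
  have h2 : ‖inlCLM d (α z.fst - z.fst)‖ ≤ D :=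
    (ContinuousLinearMap.le_opNorm _ _).trans
      (mul_le_mul_of_nonneg_left ((hM z.fst).trans (le_abs_self M)) (norm_nonneg _))
  have hD : 0 ≤ D := by positivity
  have h3 : ‖z‖ ≤ ‖lift α z‖ + D := by
    nth_rewrite 1 [h1]
    exact (norm_sub_le _ _).trans (by linarith)
  rw [pow_one]
  nlinarith [norm_nonneg (lift α z)]

end IsCompactPerturbation

/-- The operator `W ↦ b(x) W(α(x), t)` on Schwartz functions. -/
def schwartzComp {α : Eucl d → Eucl d} (hα : IsCompactPerturbation α) (b : Eucl d → ℂ) :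
    𝓢(SpaceTime d, ℂ) →L[ℂ] 𝓢(SpaceTime d, ℂ) :=
  (SchwartzMap.smulLeftCLM ℂ fun z : SpaceTime d => b z.fst).comp
    (SchwartzMap.compCLM ℂ hα.hasTemperateGrowth_lift hα.norm_le_lift)

theorem hasTemperateGrowth_comp_fst {b : Eucl d → ℂ} (hb : ContDiff ℝ ∞ b)
    (hc : HasCompactSupport b) : (fun z : SpaceTime d => b z.fst).HasTemperateGrowth :=
  (hc.hasTemperateGrowth hb).comp (fstCLM d).hasTemperateGrowth

variable {α : Eucl d → Eucl d}

theorem schwartzComp_apply (hα : IsCompactPerturbation α) {b : Eucl d → ℂ} (hb : ContDiff ℝ ∞ b) (hc : HasCompactSupport b)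
    (W : 𝓢(SpaceTime d, ℂ)) (z : SpaceTime d) :
    schwartzComp hα b W z = b z.fst * W (lift α z) := by
  rw [schwartzComp, ContinuousLinearMap.comp_apply,
    SchwartzMap.smulLeftCLM_apply_apply (hasTemperateGrowth_comp_fst hb hc)]
  rfl

/-- The unit vector of the `l`-th spatial direction. -/
def spaceDir (l : Fin d) : SpaceTime d := inlCLM d (EuclideanSpace.single l 1)

/-- The unit vector of the time direction. -/
def timeDir (d : ℕ) : SpaceTime d := inrCLM d 1

theorem inner_spaceDir (ξ : SpaceTime d) (l : Fin d) : inner ℝ ξ (spaceDir l) = ξ.fst l := by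
  simp [spaceDir, WithLp.prod_inner_apply, EuclideanSpace.inner_single_right]

theorem inner_timeDir (ξ : SpaceTime d) : inner ℝ ξ (timeDir d) = ξ.snd := by
  simp [timeDir, WithLp.prod_inner_apply]

theorem hasFDerivAt_lift (hα : IsCompactPerturbation α) (z : SpaceTime d) :
    HasFDerivAt (lift α) ((ContinuousLinearMap.id ℝ _) +
      (inlCLM d).comp ((fderiv ℝ α z.fst - ContinuousLinearMap.id ℝ _).comp (fstCLM d))) z := by
  have h1 : lift α = fun z => z + inlCLM d (α (fstCLM d z) - fstCLM d z) := by
    ext1 z; exact lift_eq α z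
  rw [h1]
  have h2 : HasFDerivAt α (fderiv ℝ α z.fst) (fstCLM d z) :=
    (hα.contDiff.differentiable (by simp) _).hasFDerivAt
  exact (hasFDerivAt_id z).add ((inlCLM d).hasFDerivAt.comp z
    ((h2.sub (hasFDerivAt_id _)).comp z (fstCLM d).hasFDerivAt))

theorem hasFDerivAt_comp_fst {b : Eucl d → ℂ} (hb : Differentiable ℝ b) (z : SpaceTime d) :
    HasFDerivAt (fun z : SpaceTime d => b z.fst) ((fderiv ℝ b z.fst).comp (fstCLM d)) z := by
  have h0 : HasFDerivAt b (fderiv ℝ b z.fst) (fstCLM d z) := (hb z.fst).hasFDerivAt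
  exact h0.comp z (fstCLM d).hasFDerivAt

theorem hasFDerivAt_schwartz_lift (hα : IsCompactPerturbation α) (W : 𝓢(SpaceTime d, ℂ))
    (z : SpaceTime d) :
    HasFDerivAt (fun z => W (lift α z)) ((fderiv ℝ W (lift α z)).comp
      (ContinuousLinearMap.id ℝ _ + (inlCLM d).comp
        ((fderiv ℝ α z.fst - ContinuousLinearMap.id ℝ _).comp (fstCLM d)))) z :=
  HasFDerivAt.comp z (W.hasFDerivAt (lift α z)) (hasFDerivAt_lift hα z)

theorem fderiv_comp_lift (hα : IsCompactPerturbation α) {b : Eucl d → ℂ} (hb : ContDiff ℝ ∞ b)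
    (W : 𝓢(SpaceTime d, ℂ)) (z m : SpaceTime d) :
    fderiv ℝ (fun z : SpaceTime d => b z.fst * W (lift α z)) z m =
      fderiv ℝ b z.fst m.fst * W (lift α z) + b z.fst * fderiv ℝ W (lift α z)
        (m + inlCLM d (fderiv ℝ α z.fst m.fst - m.fst)) :=
  fderiv_mul_apply (hasFDerivAt_comp_fst (hb.differentiable (by simp)) z)
    (hasFDerivAt_schwartz_lift hα W z) m

/-- By the chain rule, a spatial derivative of a weighted composition is a sum of weighted
compositions of `W` and its first spatial derivatives. The new coefficients remain supported in the
support of `b`, which permits an induction on the order. -/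
theorem lineDeriv_spaceDir_schwartzComp (hα : IsCompactPerturbation α) {b : Eucl d → ℂ} (hb : ContDiff ℝ ∞ b)
    (hc : HasCompactSupport b) (W : 𝓢(SpaceTime d, ℂ)) (i : Fin d) :
    ∂_{spaceDir i} (schwartzComp hα b W) =
      schwartzComp hα (fun x => fderiv ℝ b x (EuclideanSpace.single i 1)) W +
      ∑ l, schwartzComp hα (fun x => b x * (fderiv ℝ α x (EuclideanSpace.single i 1) l : ℂ))
        (∂_{spaceDir l} W) := by
  have hb1 : ContDiff ℝ ∞ fun x => fderiv ℝ b x (EuclideanSpace.single i 1) :=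
    (hb.fderiv_right (m := ∞) (by simp)).clm_apply contDiff_const
  have hc1 : HasCompactSupport fun x => fderiv ℝ b x (EuclideanSpace.single i 1) :=
    hc.fderiv_apply ℝ _
  have hb2 : ∀ l, ContDiff ℝ ∞
      fun x => b x * (fderiv ℝ α x (EuclideanSpace.single i 1) l : ℂ) := fun l =>
    hb.mul (Complex.ofRealCLM.contDiff.comp ((EuclideanSpace.proj (𝕜 := ℝ) l).contDiff.comp
      ((hα.contDiff.fderiv_right (m := ∞) (by simp)).clm_apply contDiff_const)))
  have hc2 : ∀ l, HasCompactSupport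
      fun x => b x * (fderiv ℝ α x (EuclideanSpace.single i 1) l : ℂ) := fun l => hc.mul_right
  ext z
  rw [SchwartzMap.lineDerivOp_apply_eq_fderiv, add_apply, sum_apply,
    schwartzComp_apply hα hb1 hc1]
  simp_rw [schwartzComp_apply hα (hb2 _) (hc2 _), SchwartzMap.lineDerivOp_apply_eq_fderiv]
  have h0 : (schwartzComp hα b W : SpaceTime d → ℂ) = fun z => b z.fst * W (lift α z) := by
    ext1 z; exact schwartzComp_apply hα hb hc W z
  rw [h0, fderiv_comp_lift hα hb]
  have hfst : (spaceDir i : SpaceTime d).fst = EuclideanSpace.single i 1 := rfl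
  rw [hfst, map_sub]
  have h4 : spaceDir i + (inlCLM d (fderiv ℝ α z.fst (EuclideanSpace.single i 1)) -
      inlCLM d (EuclideanSpace.single i 1)) =
      ∑ l, (fderiv ℝ α z.fst (EuclideanSpace.single i 1) l) • (spaceDir l : SpaceTime d) := by
    rw [spaceDir, add_sub_cancel]
    simp_rw [spaceDir, ← map_smul, ← map_sum]
    congr 1
    ext k
    simp [Finset.sum_apply, Pi.single_apply]
  rw [h4, map_sum, Finset.mul_sum]
  congr 1
  refine Finset.sum_congr rfl fun l _ => ?_
  rw [map_smul, Complex.real_smul]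
  ring

/-- Neither the coefficient nor the displacement of the spatial variables depends on time, so no
extra terms appear. -/
theorem lineDeriv_timeDir_schwartzComp (hα : IsCompactPerturbation α) {b : Eucl d → ℂ} (hb : ContDiff ℝ ∞ b)
    (hc : HasCompactSupport b) (W : 𝓢(SpaceTime d, ℂ)) :
    ∂_{timeDir d} (schwartzComp hα b W) = schwartzComp hα b (∂_{timeDir d} W) := by
  ext z
  rw [schwartzComp_apply hα hb hc, SchwartzMap.lineDerivOp_apply_eq_fderiv,
    SchwartzMap.lineDerivOp_apply_eq_fderiv]
  have h0 : (schwartzComp hα b W : SpaceTime d → ℂ) = fun z => b z.fst * W (lift α z) := by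
    ext1 z; exact schwartzComp_apply hα hb hc W z
  rw [h0, fderiv_comp_lift hα hb]
  have hfst : (timeDir d : SpaceTime d).fst = 0 := rfl
  simp only [hfst, map_zero, sub_zero, zero_mul, zero_add, add_zero]

end SpaceTime

end

end CauchyData

namespace CauchyData

noncomputable section

/-! ### Weighted energies under limits in `L₂`. -/

section Limits

variable {X : Type*} [MeasurableSpace X] {ν : Measure X}

theorem energy_add_le {μ : X → ℝ} (hμ : Measurable μ) {f g : X → ℂ}
    (hf : AEStronglyMeasurable f ν) :
    energy ν μ (fun x => f x + g x) ≤ 2 * energy ν μ f + 2 * energy ν μ g := by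
  unfold energy
  rw [← lintegral_const_mul' _ _ (by simp), ← lintegral_const_mul' _ _ (by simp),
    ← lintegral_add_left']
  · refine lintegral_mono fun x => ?_
    dsimp only
    calc _ ≤ ENNReal.ofReal (μ x) ^ 2 * (2 * ‖f x‖ₑ ^ 2 + 2 * ‖g x‖ₑ ^ 2) := by
          gcongr; exact enorm_add_sq_le _ _
      _ = _ := by ring
  · exact (((hμ.ennreal_ofReal.pow_const 2).aemeasurable).mul (hf.enorm.pow_const 2)).const_mul 2

theorem lintegral_sq_congr {f g : X → ℂ} (h : f =ᵐ[ν] g) :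
    ∫⁻ x, ‖f x‖ₑ ^ 2 ∂ν = ∫⁻ x, ‖g x‖ₑ ^ 2 ∂ν :=
  lintegral_congr_ae (h.mono fun x hx => by simp only [hx])

theorem lintegral_map_sub {Y : Type*} [MeasurableSpace Y] {κ : Measure Y}
    (K : Lp ℂ 2 ν →ₗ[ℂ] Lp ℂ 2 κ) (f g : Lp ℂ 2 ν) :
    ∫⁻ x, ‖K (f - g) x‖ₑ ^ 2 ∂κ = ∫⁻ x, ‖K f x - K g x‖ₑ ^ 2 ∂κ := by
  have h1 : (K (f - g) : Y → ℂ) =ᵐ[κ] K f - K g := by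
    rw [map_sub]
    exact Lp.coeFn_sub _ _
  exact lintegral_congr_ae (h1.mono fun x hx => by simp only [hx, Pi.sub_apply])

theorem tendsto_eLpNorm_of_lintegral {ι : Type*} {l : Filter ι} {F : ι → X → ℂ} {G : X → ℂ}
    (h : Tendsto (fun j => ∫⁻ x, ‖F j x - G x‖ₑ ^ 2 ∂ν) l (𝓝 0)) :
    Tendsto (fun j => eLpNorm (F j - G) 2 ν) l (𝓝 0) := by
  have h6 := ((ENNReal.continuous_rpow_const (y := (1 / 2 : ℝ))).tendsto 0).comp h
  rw [ENNReal.zero_rpow_of_pos (by norm_num)] at h6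
  refine h6.congr fun j => ?_
  have h7 := eLpNorm_two_sq (ν := ν) (F j - G)
  simp only [Pi.sub_apply] at h7
  rw [Function.comp, ← h7, ← ENNReal.rpow_natCast, ← ENNReal.rpow_mul]
  norm_num

/-- Lower semicontinuity of weighted energies under convergence in `L₂`. -/
theorem energy_le_of_tendsto {μ : X → ℝ} (hμ : Measurable μ) {F : ℕ → X → ℂ} {G : X → ℂ}
    (hF : ∀ j, AEStronglyMeasurable (F j) ν) (hG : AEStronglyMeasurable G ν)
    (hlim : Tendsto (fun j => ∫⁻ x, ‖F j x - G x‖ₑ ^ 2 ∂ν) atTop (𝓝 0)) {B : ℝ≥0∞}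
    (hB : ∀ j, energy ν μ (F j) ≤ B) : energy ν μ G ≤ B := by
  replace hlim := tendsto_eLpNorm_of_lintegral hlim
  -- A subsequence converges almost everywhere, and Fatou's lemma applies along it.
  obtain ⟨ns, -, hns⟩ :=
    (tendstoInMeasure_of_tendsto_eLpNorm two_ne_zero hF hG hlim).exists_seq_tendsto_ae
  have h1 : energy ν μ G ≤
      ∫⁻ x, liminf (fun j => ENNReal.ofReal (μ x) ^ 2 * ‖F (ns j) x‖ₑ ^ 2) atTop ∂ν := by
    refine lintegral_mono_ae ?_
    filter_upwards [hns] with x hx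
    have h2 : Tendsto (fun j => ENNReal.ofReal (μ x) ^ 2 * ‖F (ns j) x‖ₑ ^ 2) atTop
        (𝓝 (ENNReal.ofReal (μ x) ^ 2 * ‖G x‖ₑ ^ 2)) :=
      ENNReal.Tendsto.const_mul
        (((ENNReal.continuous_pow 2).comp continuous_enorm).continuousAt.tendsto.comp hx)
        (Or.inr (by finiteness))
    exact h2.liminf_eq.ge
  refine h1.trans ((lintegral_liminf_le' fun j => ?_).trans ?_)
  · exact ((hμ.ennreal_ofReal.pow_const 2).aemeasurable).mul ((hF _).enorm.pow_const 2)
  · exact liminf_le_of_frequently_le' (Eventually.of_forall fun j => hB (ns j)).frequently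

end Limits

/-! ### Density of Schwartz functions in weighted `L₂` spaces. -/

section Density

variable {E : Type} [NormedAddCommGroup E] [InnerProductSpace ℝ E] [FiniteDimensional ℝ E]
  [MeasurableSpace E] [BorelSpace E]

/-- The energy is the squared `L₂` norm for the measure with density `μ²`. Continuity of `μ` makes
this measure locally finite, so smooth functions of compact support are dense. -/
theorem exists_schwartz_energy_sub_le {μ : E → ℝ} (hμ : Continuous μ) {f : L2 E}
    (hf : energy volume μ f < ⊤) {δ : ℝ} (hδ : 0 < δ) :
    ∃ g : 𝓢(E, ℂ), energy volume μ (fun x => f x - g x) ≤ ENNReal.ofReal δ ^ 2 := by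
  -- The maximum with `0` reproduces the truncation of negative values by `ENNReal.ofReal`.
  set w : E → ℝ≥0∞ := fun x => ENNReal.ofReal (max (μ x) 0 ^ 2) with hw
  have hw' : ∀ x, ENNReal.ofReal (μ x) ^ 2 = w x := fun x => by
    simp only [hw]
    rw [ENNReal.ofReal_pow (le_max_right _ _), ENNReal.ofReal_max]; simp
  have hwm : Measurable w := by fun_prop
  have : IsLocallyFiniteMeasure ((volume : Measure E).withDensity w) :=
    IsLocallyFiniteMeasure.withDensity_ofReal (by fun_prop)
  have hac : (volume : Measure E).withDensity w ≪ volume := withDensity_absolutelyContinuous _ _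
  have hen : ∀ g : E → ℂ, AEStronglyMeasurable g volume →
      ∫⁻ x, ‖g x‖ₑ ^ 2 ∂((volume : Measure E).withDensity w) = energy volume μ g := by
    intro g hg
    rw [lintegral_withDensity_eq_lintegral_mul₀ hwm.aemeasurable (hg.enorm.pow_const 2)]
    simp only [Pi.mul_apply, energy, hw']
  have hfm := Lp.aestronglyMeasurable f
  have hfL : MemLp f 2 ((volume : Measure E).withDensity w) := by
    rw [memLp_two_iff (hfm.mono_ac hac), hen f hfm]
    exact hf
  obtain ⟨g, hg1, hg2, hg3⟩ := MemLp.exist_eLpNorm_sub_le (by simp) one_le_two hfL hδ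
  refine ⟨hg1.toSchwartzMap hg2, ?_⟩
  have h1 : ∀ x, hg1.toSchwartzMap hg2 x = g x := fun x => rfl
  simp only [h1]
  change energy volume μ (f - g) ≤ _
  rw [← hen _ (hfm.sub hg2.continuous.aestronglyMeasurable), ← eLpNorm_two_sq]
  gcongr

/-- A weighted estimate for a bounded operator in `L₂` extends from Schwartz functions. -/
theorem energy_le_of_schwartz {μ : E → ℝ} (hμ : Continuous μ) (hμ1 : ∀ x, 1 ≤ μ x)
    (K : L2 E →ₗ[ℂ] L2 E) {C₀ C : ℝ≥0}
    (h0 : ∀ f, ∫⁻ x, ‖K f x‖ₑ ^ 2 ≤ C₀ * ∫⁻ x, ‖f x‖ₑ ^ 2)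
    (hS : ∀ g : 𝓢(E, ℂ), energy volume μ (K (g.toLp 2 volume)) ≤ C * energy volume μ g) (f : L2 E) :
    energy volume μ (K f) ≤ (2 * C + 1 : ℝ≥0) * energy volume μ f := by
  rcases eq_top_or_lt_top (energy volume μ f) with htop | hlt
  -- The summand `1` in the constant keeps the factor nonzero, so that the right-hand side really is
  -- infinite here even if `C = 0`.
  · rw [htop, ENNReal.mul_top (by simp)]
    exact le_top
  -- The approximants are within `min δ (1/(j+1))` of `f` in the weighted norm. The second bound
  -- yields convergence of their images in `L₂`, because `μ ≥ 1`; the first bounds their energies.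
  -- Lower semicontinuity then applies, and `δ → 0` at the end.
  · have key : ∀ δ : ℝ, 0 < δ → energy volume μ (K f) ≤
        C * (2 * energy volume μ f + 2 * ENNReal.ofReal δ ^ 2) := by
      intro δ hδ
      have hex : ∀ j : ℕ, ∃ g : 𝓢(E, ℂ), energy volume μ (fun x => f x - g x) ≤
          ENNReal.ofReal (min δ (1 / (j + 1))) ^ 2 := fun j =>
        exists_schwartz_energy_sub_le hμ hlt (lt_min hδ Nat.one_div_pos_of_nat)
      choose g hg using hex
      have hgL : ∀ j, ((g j).toLp 2 volume : E → ℂ) =ᵐ[volume] g j := fun j =>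
        (g j).coeFn_toLp 2 volume
      refine energy_le_of_tendsto hμ.measurable (F := fun j => K ((g j).toLp 2 volume))
        (fun j => Lp.aestronglyMeasurable _) (Lp.aestronglyMeasurable _) ?_ fun j => ?_
      · have hb : ∀ j, ∫⁻ x, ‖K ((g j).toLp 2 volume) x - K f x‖ₑ ^ 2 ≤
            C₀ * ENNReal.ofReal (1 / (j + 1)) ^ 2 := by
          intro j
          rw [← lintegral_map_sub K]
          refine (h0 _).trans (mul_le_mul_right ?_ _)
          refine le_trans ?_ ((hg j).trans
            (pow_le_pow_left' (ENNReal.ofReal_le_ofReal (min_le_right _ _)) 2))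
          have h3 : ((g j).toLp 2 volume - f : L2 E) =ᵐ[volume] fun x => g j x - f x := by
            filter_upwards [Lp.coeFn_sub ((g j).toLp 2 volume) f, hgL j] with x h4 h5
            rw [h4, Pi.sub_apply, h5]
          rw [lintegral_sq_congr h3]
          refine lintegral_mono fun x => ?_
          rw [enorm_sub_rev]
          exact le_mul_of_one_le_left zero_le (one_le_pow₀ (by simpa using hμ1 x))
        refine tendsto_of_tendsto_of_tendsto_of_le_of_le tendsto_const_nhds ?_
          (fun j => zero_le) hb
        have h4 : Tendsto (fun j : ℕ => ENNReal.ofReal (1 / ((j : ℝ) + 1))) atTop (𝓝 0) := by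
          have := ENNReal.tendsto_ofReal (tendsto_one_div_add_atTop_nhds_zero_nat (𝕜 := ℝ))
          simpa using this
        have h5 := ENNReal.Tendsto.const_mul (a := (C₀ : ℝ≥0∞)) (ENNReal.Tendsto.pow (n := 2) h4)
          (Or.inr (by simp))
        simpa using h5
      · refine (hS (g j)).trans (mul_le_mul_right ?_ _)
        have h7 : (g j : E → ℂ) = fun x => f x + -(f x - g j x) := by ext x; ring
        have h8 : energy volume μ (fun x => -(f x - g j x)) ≤ ENNReal.ofReal δ ^ 2 := by
          have : energy volume μ (fun x => -(f x - g j x)) = energy volume μ (fun x => f x - g j x) := by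
            simp only [energy, enorm_neg]
          rw [this]
          exact (hg j).trans (pow_le_pow_left' (ENNReal.ofReal_le_ofReal (min_le_left _ _)) 2)
        rw [h7]
        refine (energy_add_le hμ.measurable (Lp.aestronglyMeasurable f)).trans ?_
        gcongr
    have hlim : Tendsto (fun δ : ℝ => (C : ℝ≥0∞) * (2 * energy volume μ f + 2 * ENNReal.ofReal δ ^ 2))
        (𝓝[>] 0) (𝓝 (C * (2 * energy volume μ f + 2 * ENNReal.ofReal 0 ^ 2))) := by
      refine Tendsto.mono_left ?_ nhdsWithin_le_nhds
      refine ENNReal.Tendsto.const_mul (tendsto_const_nhds.add (ENNReal.Tendsto.const_mul ?_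
        (Or.inr (by simp)))) (Or.inr (by simp))
      exact ((ENNReal.continuous_pow 2).comp ENNReal.continuous_ofReal).tendsto 0
    have := ge_of_tendsto hlim (eventually_mem_nhdsWithin.mono fun δ hδ => key δ hδ)
    refine this.trans (le_trans (le_of_eq ?_) (mul_le_mul_left (show ((2 * C : ℝ≥0) : ℝ≥0∞) ≤
      ((2 * C + 1 : ℝ≥0) : ℝ≥0∞) from mod_cast le_self_add) _))
    simp only [ENNReal.ofReal_zero, ne_eq, OfNat.ofNat_ne_zero, not_false_eq_true, zero_pow,
      mul_zero, add_zero]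
    push_cast
    ring

end Density

end

end CauchyData

namespace CauchyData

noncomputable section

/-! ### Spatial Sobolev energies of Schwartz functions -/

section Sobolev

variable {d : ℕ}

/-- The energy `∫ (1 + |ξ'|²)^m |V̂|²`. -/
def sobolev (m : ℕ) (V : 𝓢(SpaceTime d, ℂ)) : ℝ≥0∞ :=
  ∫⁻ z, ENNReal.ofReal (1 + ‖z.fst‖ ^ 2) ^ m * ‖𝓕 V z‖ₑ ^ 2

theorem measurable_one_add_norm_fst_sq :
    Measurable fun z : SpaceTime d => ENNReal.ofReal (1 + ‖z.fst‖ ^ 2) :=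
  (measurable_const.add (measurable_fst'.norm.pow_const 2)).ennreal_ofReal

theorem sobolev_le_succ (m : ℕ) (V : 𝓢(SpaceTime d, ℂ)) : sobolev m V ≤ sobolev (m + 1) V := by
  refine lintegral_mono fun z => ?_
  dsimp only
  gcongr
  · simp
  · omega

theorem sobolev_lineDeriv (m : ℕ) (V : 𝓢(SpaceTime d, ℂ)) (l : Fin d) :
    sobolev m (∂_{spaceDir l} V) = ENNReal.ofReal ((2 * Real.pi) ^ 2) *
      ∫⁻ z, ENNReal.ofReal (1 + ‖z.fst‖ ^ 2) ^ m * (ENNReal.ofReal (z.fst l ^ 2) * ‖𝓕 V z‖ₑ ^ 2) := by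
  rw [sobolev, ← lintegral_const_mul' _ _ (by simp)]
  refine lintegral_congr fun z => ?_
  rw [enorm_fourier_lineDeriv, inner_spaceDir]
  ring

theorem measurable_enorm_fourier_sq (V : 𝓢(SpaceTime d, ℂ)) :
    Measurable fun z => ‖𝓕 V z‖ₑ ^ 2 := ((𝓕 V).continuous.enorm.measurable.pow_const 2)

/-- One factor `1 + |ξ'|²` is expanded as `1 + ∑ ξ_l²`. As the factors `ξ_l` correspond to
derivatives, this reduces integer orders to order zero. -/
theorem sobolev_succ (m : ℕ) (V : 𝓢(SpaceTime d, ℂ)) :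
    sobolev (m + 1) V = sobolev m V + ∑ l, ∫⁻ z, ENNReal.ofReal (1 + ‖z.fst‖ ^ 2) ^ m *
      (ENNReal.ofReal (z.fst l ^ 2) * ‖𝓕 V z‖ₑ ^ 2) := by
  have hm := measurable_one_add_norm_fst_sq (d := d)
  have hV := measurable_enorm_fourier_sq V
  have hl : ∀ l : Fin d, Measurable fun z : SpaceTime d => ENNReal.ofReal (z.fst l ^ 2) := fun l =>
    ((EuclideanSpace.proj (𝕜 := ℝ) l).continuous.measurable.comp
      measurable_fst' |>.pow_const 2).ennreal_ofReal
  rw [sobolev, sobolev, ← lintegral_finsetSum _ fun l _ => ?_, ← lintegral_add_left]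
  · refine lintegral_congr fun z => ?_
    have h1 : ENNReal.ofReal (1 + ‖z.fst‖ ^ 2) = 1 + ∑ l, ENNReal.ofReal (z.fst l ^ 2) := by
      rw [EuclideanSpace.norm_sq_eq, ENNReal.ofReal_add (by positivity) (by positivity),
        ENNReal.ofReal_one, ENNReal.ofReal_sum_of_nonneg (fun _ _ => by positivity)]
      simp
    rw [← Finset.mul_sum, ← Finset.sum_mul, ← mul_add, pow_succ, mul_assoc]
    congr 1
    rw [h1, add_mul, one_mul]
  · exact (hm.pow_const m).mul hV
  · exact (hm.pow_const m).mul ((hl l).mul hV)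

theorem one_le_two_pi_sq : (1 : ℝ≥0∞) ≤ ENNReal.ofReal ((2 * Real.pi) ^ 2) := by
  rw [ENNReal.one_le_ofReal]
  exact one_le_pow₀ (by linarith [Real.pi_gt_three])

theorem sobolev_succ_le (m : ℕ) (V : 𝓢(SpaceTime d, ℂ)) :
    sobolev (m + 1) V ≤ sobolev m V + ∑ l : Fin d, sobolev m (∂_{spaceDir l} V) := by
  rw [sobolev_succ]
  gcongr with l
  rw [sobolev_lineDeriv]
  exact le_mul_of_one_le_left zero_le one_le_two_pi_sq

theorem sobolev_lineDeriv_le (m : ℕ) (V : 𝓢(SpaceTime d, ℂ)) (l : Fin d) :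
    sobolev m (∂_{spaceDir l} V) ≤ ENNReal.ofReal ((2 * Real.pi) ^ 2) * sobolev (m + 1) V := by
  rw [sobolev_lineDeriv, sobolev_succ]
  gcongr
  refine le_add_of_nonneg_of_le zero_le ?_
  exact Finset.single_le_sum (f := fun l => ∫⁻ z : SpaceTime d,
    ENNReal.ofReal (1 + ‖z.fst‖ ^ 2) ^ m * (ENNReal.ofReal (z.fst l ^ 2) * ‖𝓕 V z‖ₑ ^ 2))
    (fun _ _ => zero_le) (Finset.mem_univ l)

theorem sobolev_zero (m : ℕ) : sobolev m (0 : 𝓢(SpaceTime d, ℂ)) = 0 := by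
  have : 𝓕 (0 : 𝓢(SpaceTime d, ℂ)) = 0 := map_zero (FourierTransform.fourierCLM ℂ 𝓢(SpaceTime d, ℂ))
  simp [sobolev, this]

theorem sobolev_add_le (m : ℕ) (V W : 𝓢(SpaceTime d, ℂ)) :
    sobolev m (V + W) ≤ 2 * sobolev m V + 2 * sobolev m W := by
  have hm := measurable_one_add_norm_fst_sq (d := d)
  have hV := measurable_enorm_fourier_sq V
  unfold sobolev
  rw [← lintegral_const_mul' _ _ (by simp), ← lintegral_const_mul' _ _ (by simp),
    ← lintegral_add_left]
  · refine lintegral_mono fun z => ?_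
    dsimp only
    rw [FourierTransform.fourier_add, add_apply]
    calc _ ≤ ENNReal.ofReal (1 + ‖z.fst‖ ^ 2) ^ m * (2 * ‖𝓕 V z‖ₑ ^ 2 + 2 * ‖𝓕 W z‖ₑ ^ 2) := by
          gcongr; exact enorm_add_sq_le _ _
      _ = _ := by ring
  · exact ((hm.pow_const m).mul hV).const_mul 2

theorem sobolev_sum_le (m : ℕ) {ι : Type*} (s : Finset ι) (V : ι → 𝓢(SpaceTime d, ℂ)) :
    sobolev m (∑ i ∈ s, V i) ≤ 2 ^ s.card * ∑ i ∈ s, sobolev m (V i) := by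
  classical
  induction s using Finset.induction_on with
  | empty => simp [sobolev_zero]
  | insert a s ha ih =>
    rw [Finset.sum_insert ha, Finset.sum_insert ha, Finset.card_insert_of_notMem ha, mul_add]
    refine (sobolev_add_le m _ _).trans (add_le_add ?_ ?_)
    · gcongr
      exact le_self_pow₀ one_le_two (by omega)
    · rw [pow_succ', mul_assoc]
      gcongr

/-- The coefficients `b` admissible for the change of variables `α` over the set `M`. -/
structure IsCoefficient (M : Set (Eucl d)) (b : Eucl d → ℂ) : Prop where
  contDiff : ContDiff ℝ ∞ b
  compact : HasCompactSupport b
  tsupport_subset : tsupport b ⊆ M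

theorem BoundedComp.of_measurePreserving {X Y : Type*} [MeasurableSpace X] [MeasurableSpace Y]
    {ν : Measure Y} {μ : Measure X} {ρ : Y → X} (h : MeasurePreserving ρ ν μ) :
    BoundedComp (fun _ => 1) ρ ν μ where
  measurable_weight := measurable_const
  measurable_map := h.measurable
  bounded := ⟨1, fun _ => by simp⟩
  map_le := ⟨1, by
    have : {y : Y | (1 : ℂ) ≠ 0} = univ := by simp
    rw [this, Measure.restrict_univ, h.map_eq]
    simp⟩

theorem BoundedComp.lift {a : Eucl d → ℂ} {α : Eucl d → Eucl d} (h : BoundedComp a α volume volume) :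
    BoundedComp (fun z : SpaceTime d => a z.fst) (lift α) volume volume := by
  have h1 := BoundedComp.of_measurePreserving (WithLp.volume_preserving_ofLp (Eucl d) ℝ)
  have h2 := BoundedComp.of_measurePreserving (WithLp.volume_preserving_toLp (Eucl d) ℝ)
  have h3 := (h1.comp (h.prod (volume : Measure ℝ))).comp h2
  simp only [one_mul, mul_one] at h3
  exact h3

theorem IsCoefficient.boundedComp {M : Set (Eucl d)} {α : Eucl d → Eucl d}
    (hM : BoundedComp (M.indicator 1) α volume volume) {b : Eucl d → ℂ} (hb : IsCoefficient M b) :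
    BoundedComp b α volume volume := by
  obtain ⟨B, hB⟩ := hb.compact.exists_bound_of_continuous hb.contDiff.continuous
  refine hM.mono_weight hb.contDiff.continuous.measurable ⟨B.toNNReal, fun y => ?_⟩ fun y hy => ?_
  · rw [← ofReal_norm]
    exact ENNReal.ofReal_le_ofReal (hB y)
  · by_contra hne
    have : y ∈ M := hb.tsupport_subset (subset_tsupport _ hne)
    simp [this] at hy

variable {M : Set (Eucl d)} {α : Eucl d → Eucl d}

/-- Induction on the order, for all admissible coefficients at once since the chain rule changes
them. Order zero is the Plancherel theorem together with the `L₂` bound for compositions, available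
because all coefficients are supported in `M`. -/
theorem sobolev_schwartzComp_le (hα : IsCompactPerturbation α)
    (hM : BoundedComp (M.indicator 1) α volume volume) (m : ℕ) :
    ∀ b : Eucl d → ℂ, IsCoefficient M b →
      ∃ C : ℝ≥0, ∀ W, sobolev m (schwartzComp hα b W) ≤ C * sobolev m W := by
  induction m with
  | zero =>
    intro b hb
    obtain ⟨C, hC⟩ := (hb.boundedComp hM).lift.lintegral_le
    refine ⟨C, fun W => ?_⟩
    simp only [sobolev, pow_zero, one_mul]
    rw [lintegral_enorm_schwartz_fourier_sq, lintegral_enorm_schwartz_fourier_sq]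
    simp_rw [schwartzComp_apply hα hb.contDiff hb.compact]
    exact hC W W.continuous.aestronglyMeasurable
  | succ m ih =>
    intro b hb
    have hbd : ∀ i : Fin d,
        IsCoefficient M (fun x => fderiv ℝ b x (EuclideanSpace.single i 1)) := fun i =>
      { contDiff := (hb.contDiff.fderiv_right (m := ∞) (by simp)).clm_apply contDiff_const
        compact := hb.compact.fderiv_apply ℝ _
        tsupport_subset := (tsupport_fderiv_apply_subset ℝ _).trans hb.tsupport_subset }
    have hbm : ∀ i l : Fin d, IsCoefficient M
        (fun x => b x * (fderiv ℝ α x (EuclideanSpace.single i 1) l : ℂ)) := fun i l =>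
      { contDiff := hb.contDiff.mul (Complex.ofRealCLM.contDiff.comp
          ((EuclideanSpace.proj (𝕜 := ℝ) l).contDiff.comp
            ((hα.contDiff.fderiv_right (m := ∞) (by simp)).clm_apply contDiff_const)))
        compact := hb.compact.mul_right
        tsupport_subset := (tsupport_mul_subset_left (f := b)).trans hb.tsupport_subset }
    obtain ⟨C₀, hC₀⟩ := ih b hb
    choose C₁ hC₁ using fun i => ih _ (hbd i)
    choose C₂ hC₂ using fun i l => ih _ (hbm i l)
    set c : ℝ≥0 := ((2 * Real.pi) ^ 2).toNNReal
    refine ⟨C₀ + ∑ i, (2 * C₁ i + 2 * (2 ^ d * ∑ l, C₂ i l * c)), fun W => ?_⟩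
    refine (sobolev_succ_le m _).trans ?_
    push_cast
    rw [add_mul, Finset.sum_mul]
    refine add_le_add ((hC₀ W).trans ?_) (Finset.sum_le_sum fun i _ => ?_)
    · gcongr
      exact sobolev_le_succ m W
    · rw [lineDeriv_spaceDir_schwartzComp hα hb.contDiff hb.compact, add_mul, mul_assoc, mul_assoc,
        mul_assoc, Finset.sum_mul]
      refine (sobolev_add_le m _ _).trans ?_
      gcongr
      · exact (hC₁ i W).trans (mul_le_mul_right (sobolev_le_succ m W) _)
      · refine (sobolev_sum_le m _ _).trans ?_
        rw [Finset.card_univ, Fintype.card_fin]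
        gcongr with l
        rw [mul_assoc]
        exact (hC₂ i l _).trans (mul_le_mul_right (sobolev_lineDeriv_le m W l) _)

/-- The energy `∫ |ξ_{d+1}|^{2m} |V̂|²`. -/
def timeEnergy (m : ℕ) (V : 𝓢(SpaceTime d, ℂ)) : ℝ≥0∞ :=
  ∫⁻ z, ENNReal.ofReal (z.snd ^ 2) ^ m * ‖𝓕 V z‖ₑ ^ 2

theorem timeEnergy_lineDeriv (m : ℕ) (V : 𝓢(SpaceTime d, ℂ)) :
    timeEnergy m (∂_{timeDir d} V) = ENNReal.ofReal ((2 * Real.pi) ^ 2) * timeEnergy (m + 1) V := by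
  rw [timeEnergy, timeEnergy, ← lintegral_const_mul' _ _ (by simp)]
  refine lintegral_congr fun z => ?_
  rw [enorm_fourier_lineDeriv, inner_timeDir]
  ring

/-- The composition commutes with the time derivative, so the `L₂` constant works for every `m`;
each derivative contributes the same factor `(2π)²` to both sides, and it is cancelled. -/
theorem timeEnergy_schwartzComp_le (hα : IsCompactPerturbation α)
    (hM : BoundedComp (M.indicator 1) α volume volume) {b : Eucl d → ℂ} (hb : IsCoefficient M b) :
    ∃ C : ℝ≥0, ∀ (m : ℕ) W, timeEnergy m (schwartzComp hα b W) ≤ C * timeEnergy m W := by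
  obtain ⟨C, hC⟩ := sobolev_schwartzComp_le hα hM 0 b hb
  refine ⟨C, fun m => ?_⟩
  induction m with
  | zero =>
    intro W
    simpa [sobolev, timeEnergy] using hC W
  | succ m ih =>
    intro W
    have h1 := ih (∂_{timeDir d} W)
    rw [← lineDeriv_timeDir_schwartzComp hα hb.contDiff hb.compact, timeEnergy_lineDeriv,
      timeEnergy_lineDeriv, mul_left_comm] at h1
    refine (ENNReal.mul_le_mul_iff_right (a := ENNReal.ofReal ((2 * Real.pi) ^ 2)) ?_ ?_).1 h1
    · exact (zero_lt_one.trans_le one_le_two_pi_sq).ne'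
    · simp

/-- The anisotropic radius `(1 + |ξ'|² + |ξ_{d+1}|)^{1/2}`. -/
def anisoRadius (z : SpaceTime d) : ℝ := (1 + ‖z.fst‖ ^ 2 + |z.snd|) ^ (1 / 2 : ℝ)

theorem anisoRadius_sq (z : SpaceTime d) : anisoRadius z ^ 2 = 1 + ‖z.fst‖ ^ 2 + |z.snd| := by
  rw [anisoRadius, ← Real.sqrt_eq_rpow, Real.sq_sqrt (by positivity)]

theorem one_le_anisoRadius (z : SpaceTime d) : 1 ≤ anisoRadius z :=
  Real.one_le_rpow (by nlinarith [sq_nonneg ‖z.fst‖, abs_nonneg z.snd]) (by norm_num)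

theorem continuous_anisoRadius : Continuous (anisoRadius (d := d)) := by
  have h1 : Continuous fun z : SpaceTime d => z.fst := (fstCLM d).continuous
  have h2 : Continuous fun z : SpaceTime d => z.snd := (sndCLM d).continuous
  unfold anisoRadius
  exact ((continuous_const.add (h1.norm.pow 2)).add h2.abs).rpow_const fun z => Or.inr (by norm_num)

theorem anisoIndex_eq_radial (s : ℝ) (φ : ℝ → ℝ) (z : SpaceTime d) :
    anisoIndex d s φ z = radial s φ (anisoRadius z) := by
  rw [anisoIndex, radial, anisoRadius, ← Real.rpow_mul (by positivity)]
  congr 2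
  ring

/-- The squared weight `(1 + |ξ'|² + |ξ_(d+1)|)^(2n)` is comparable to `(1 + |ξ'|²)^(2n) +
|ξ_(d+1)|^(2n)`, that is, to `2n` spatial derivatives and `n` time derivatives. The order is even so
that the number of time derivatives is an integer. -/
theorem energy_anisoRadius_schwartzComp_le (hα : IsCompactPerturbation α)
    (hM : BoundedComp (M.indicator 1) α volume volume) {b : Eucl d → ℂ} (hb : IsCoefficient M b)
    (n : ℕ) : ∃ C : ℝ≥0, ∀ W : 𝓢(SpaceTime d, ℂ),
      energy volume (fun z => anisoRadius z ^ ((2 * n : ℕ) : ℝ))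
        (𝓕 (schwartzComp hα b W) : 𝓢(SpaceTime d, ℂ)) ≤
      C * energy volume (fun z => anisoRadius z ^ ((2 * n : ℕ) : ℝ)) (𝓕 W : 𝓢(SpaceTime d, ℂ)) := by
  obtain ⟨C₁, hC₁⟩ := sobolev_schwartzComp_le hα hM (2 * n) b hb
  obtain ⟨C₂, hC₂⟩ := timeEnergy_schwartzComp_le hα hM hb
  have hwt : ∀ z : SpaceTime d, ENNReal.ofReal (anisoRadius z ^ ((2 * n : ℕ) : ℝ)) ^ 2 =
      ENNReal.ofReal (1 + ‖z.fst‖ ^ 2 + |z.snd|) ^ (2 * n) := by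
    intro z
    have h0 := (zero_lt_one.trans_le (one_le_anisoRadius z)).le
    rw [Real.rpow_natCast, ENNReal.ofReal_pow h0, ← pow_mul, mul_comm, pow_mul,
      ← ENNReal.ofReal_pow h0, anisoRadius_sq]
  have hupper : ∀ V : 𝓢(SpaceTime d, ℂ),
      energy volume (fun z => anisoRadius z ^ ((2 * n : ℕ) : ℝ)) (𝓕 V : 𝓢(SpaceTime d, ℂ)) ≤
        2 ^ (2 * n) * (sobolev (2 * n) V + timeEnergy n V) := by
    intro V
    have hmeas : Measurable fun z : SpaceTime d =>
        ENNReal.ofReal (1 + ‖z.fst‖ ^ 2) ^ (2 * n) * ‖𝓕 V z‖ₑ ^ 2 :=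
      (measurable_one_add_norm_fst_sq.pow_const _).mul (measurable_enorm_fourier_sq V)
    rw [sobolev, timeEnergy, energy, ← lintegral_add_left hmeas,
      ← lintegral_const_mul' _ _ (by finiteness)]
    refine lintegral_mono fun z => ?_
    dsimp only
    rw [hwt, ← add_mul, ← mul_assoc]
    gcongr
    rw [ENNReal.ofReal_add (by positivity) (by positivity)]
    have h1 : ENNReal.ofReal (z.snd ^ 2) ^ n = ENNReal.ofReal |z.snd| ^ (2 * n) := by
      rw [pow_mul, ← ENNReal.ofReal_pow (abs_nonneg _), sq_abs]
    rw [h1]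
    rcases le_total (ENNReal.ofReal (1 + ‖z.fst‖ ^ 2)) (ENNReal.ofReal |z.snd|) with h | h
    · calc _ ≤ (ENNReal.ofReal |z.snd| + ENNReal.ofReal |z.snd|) ^ (2 * n) := by gcongr
        _ = 2 ^ (2 * n) * ENNReal.ofReal |z.snd| ^ (2 * n) := by rw [← two_mul, mul_pow]
        _ ≤ _ := by gcongr; exact le_add_self
    · calc _ ≤ (ENNReal.ofReal (1 + ‖z.fst‖ ^ 2) + ENNReal.ofReal (1 + ‖z.fst‖ ^ 2)) ^ (2 * n) := by
            gcongr
        _ = 2 ^ (2 * n) * ENNReal.ofReal (1 + ‖z.fst‖ ^ 2) ^ (2 * n) := by rw [← two_mul, mul_pow]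
        _ ≤ _ := by gcongr; exact le_self_add
  have hlower₁ : ∀ V : 𝓢(SpaceTime d, ℂ), sobolev (2 * n) V ≤
      energy volume (fun z => anisoRadius z ^ ((2 * n : ℕ) : ℝ)) (𝓕 V : 𝓢(SpaceTime d, ℂ)) := by
    intro V
    refine lintegral_mono fun z => ?_
    dsimp only
    rw [hwt]
    refine mul_le_mul_left (pow_le_pow_left' (ENNReal.ofReal_le_ofReal ?_) _) _
    linarith [abs_nonneg z.snd]
  have hlower₂ : ∀ V : 𝓢(SpaceTime d, ℂ), timeEnergy n V ≤
      energy volume (fun z => anisoRadius z ^ ((2 * n : ℕ) : ℝ)) (𝓕 V : 𝓢(SpaceTime d, ℂ)) := by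
    intro V
    refine lintegral_mono fun z => ?_
    dsimp only
    rw [hwt, pow_mul, ← ENNReal.ofReal_pow (p := 1 + ‖z.fst‖ ^ 2 + |z.snd|) (by positivity) 2]
    refine mul_le_mul_left (pow_le_pow_left' (ENNReal.ofReal_le_ofReal ?_) _) _
    rw [← sq_abs z.snd]
    exact pow_le_pow_left₀ (abs_nonneg _) (by nlinarith [sq_nonneg ‖z.fst‖]) 2
  refine ⟨2 ^ (2 * n) * (C₁ + C₂), fun W => (hupper _).trans ?_⟩
  have hC : ((2 ^ (2 * n) * (C₁ + C₂) : ℝ≥0) : ℝ≥0∞) = 2 ^ (2 * n) * (C₁ + C₂) := by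
    push_cast
    rfl
  rw [hC, mul_assoc, add_mul]
  refine mul_le_mul_right (add_le_add ?_ ?_) _
  · exact (hC₁ W).trans (mul_le_mul_right (hlower₁ W) _)
  · exact (hC₂ n W).trans (mul_le_mul_right (hlower₂ W) _)

/-- Spatial changes of variables with smooth coefficients, conjugated with the Fourier transform. -/
def fourierConj (T : L2 (SpaceTime d) →ₗ[ℂ] L2 (SpaceTime d)) :
    L2 (SpaceTime d) →ₗ[ℂ] L2 (SpaceTime d) :=
  (Lp.fourierTransformₗᵢ (SpaceTime d) ℂ).toLinearEquiv.toLinearMap ∘ₗ T ∘ₗ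
    (Lp.fourierTransformₗᵢ (SpaceTime d) ℂ).symm.toLinearEquiv.toLinearMap

theorem fourierConj_apply (T : L2 (SpaceTime d) →ₗ[ℂ] L2 (SpaceTime d)) (f : L2 (SpaceTime d)) :
    fourierConj T f = 𝓕 (T (𝓕⁻ f)) := rfl

/-- The spaces `H^{s,s/2;φ}` are invariant under spatial changes of variables. -/
theorem energy_aniso_comp_le (hα : IsCompactPerturbation α)
    (hM : BoundedComp (M.indicator 1) α volume volume) {b : Eucl d → ℂ} (hb : IsCoefficient M b)
    {s : ℝ} (hs : 0 < s) {φ : ℝ → ℝ} (hφ : ClassM φ) :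
    ∃ C : ℝ≥0, ∀ f : L2 (SpaceTime d), energy volume (anisoIndex d s φ)
      (𝓕 ((hb.boundedComp hM).lift.op (𝓕⁻ f) : L2 (SpaceTime d)) : L2 (SpaceTime d)) ≤
        C * energy volume (anisoIndex d s φ) f := by
  -- The order `s` has to lie strictly between the endpoint orders `0` and `2n` of the
  -- interpolation.
  obtain ⟨n, hn⟩ := exists_nat_gt (s / 2)
  have hn' : s < ((2 * n : ℕ) : ℝ) := by push_cast; linarith
  set K := fourierConj (hb.boundedComp hM).lift.op with hK
  obtain ⟨C₀, hC₀⟩ := (hb.boundedComp hM).lift.lintegral_le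
  have h0 : ∀ f, ∫⁻ x, ‖K f x‖ₑ ^ 2 ≤ C₀ * ∫⁻ x, ‖f x‖ₑ ^ 2 := by
    intro f
    rw [hK, fourierConj_apply, lintegral_enorm_fourier_sq, ← lintegral_enorm_fourierInv_sq f,
      lintegral_sq_congr ((hb.boundedComp hM).lift.coeFn_op _)]
    exact hC₀ _ (Lp.aestronglyMeasurable _)
  obtain ⟨C₁, hC₁⟩ := energy_anisoRadius_schwartzComp_le hα hM hb n
  have hS : ∀ g : 𝓢(SpaceTime d, ℂ),
      energy volume (fun z => anisoRadius z ^ ((2 * n : ℕ) : ℝ)) (K (g.toLp 2 volume)) ≤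
        C₁ * energy volume (fun z => anisoRadius z ^ ((2 * n : ℕ) : ℝ)) g := by
    intro g
    have h1 : K (g.toLp 2 volume) = (𝓕 (schwartzComp hα b (𝓕⁻ g))).toLp 2 volume := by
      rw [hK, fourierConj_apply, ← SchwartzMap.toLp_fourier_eq, SchwartzMap.toLp_fourierInv_eq]
      congr 1
      apply Lp.ext
      refine ((hb.boundedComp hM).lift.coeFn_op _).trans
        (((hb.boundedComp hM).lift.ae_eq (SchwartzMap.coeFn_toLp _ 2 volume)).trans ?_)
      refine EventuallyEq.trans ?_ (SchwartzMap.coeFn_toLp _ 2 volume).symm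
      exact Eventually.of_forall fun z => (schwartzComp_apply hα hb.contDiff hb.compact _ z).symm
    have h2 := hC₁ (𝓕⁻ g)
    rw [FourierTransform.fourier_fourierInv_eq] at h2
    rw [h1, energy_congr _ (SchwartzMap.coeFn_toLp _ 2 volume)]
    exact h2
  have hcont : Continuous fun z : SpaceTime d => anisoRadius z ^ ((2 * n : ℕ) : ℝ) :=
    continuous_anisoRadius.rpow_const fun z => Or.inr (by positivity)
  have hN := energy_le_of_schwartz hcont
    (fun z => Real.one_le_rpow (one_le_anisoRadius z) (by positivity)) K h0 hS
  obtain ⟨C, hC⟩ := energy_radial_le (C := C₀ + (2 * C₁ + 1)) continuous_anisoRadius.measurable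
    one_le_anisoRadius hs hn' hφ K
    (fun f => (h0 f).trans (mul_le_mul_left (by simp) _))
    (fun f => (hN f).trans (mul_le_mul_left (by exact_mod_cast le_add_self) _))
  refine ⟨C, fun f => ?_⟩
  have := hC f
  simp only [← anisoIndex_eq_radial] at this
  exact this

end Sobolev

end

end CauchyData

namespace CauchyData

noncomputable section

/-! ### Averaging in the second variable of a product -/

section Average

variable {Y Z : Type*} [MeasurableSpace Y] [MeasurableSpace Z] {ν : Measure Y} {κ : Measure Z}

theorem lintegral_mul_sq_le {f g : Z → ℝ≥0∞} (hf : AEMeasurable f κ) (hg : AEMeasurable g κ) :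
    (∫⁻ t, f t * g t ∂κ) ^ 2 ≤ (∫⁻ t, f t ^ 2 ∂κ) * ∫⁻ t, g t ^ 2 ∂κ := by
  have h := ENNReal.lintegral_mul_le_Lp_mul_Lq κ (Real.HolderConjugate.two_two) hf hg
  simp only [ENNReal.rpow_two] at h
  have hsq : ∀ a : ℝ≥0∞, (a ^ (1 / 2 : ℝ)) ^ 2 = a := fun a => by
    rw [← ENNReal.rpow_natCast, ← ENNReal.rpow_mul]; norm_num
  calc (∫⁻ t, f t * g t ∂κ) ^ 2 ≤ _ := pow_le_pow_left' h 2
    _ = _ := by rw [mul_pow, hsq, hsq]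

theorem enorm_integral_mul_sq_le {f q : Z → ℂ} (hf : AEStronglyMeasurable f κ)
    (hq : AEStronglyMeasurable q κ) :
    ‖∫ t, f t * q t ∂κ‖ₑ ^ 2 ≤ (∫⁻ t, ‖f t‖ₑ ^ 2 ∂κ) * ∫⁻ t, ‖q t‖ₑ ^ 2 ∂κ := by
  refine le_trans (pow_le_pow_left' (enorm_integral_le_lintegral_enorm _) 2) ?_
  simp only [enorm_mul]
  exact lintegral_mul_sq_le hf.enorm hq.enorm

variable [SFinite κ]

theorem lintegral_prod_sq {g : Y × Z → ℂ} (hg : AEStronglyMeasurable g (ν.prod κ)) :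
    ∫⁻ y, ∫⁻ t, ‖g (y, t)‖ₑ ^ 2 ∂κ ∂ν = ∫⁻ p, ‖g p‖ₑ ^ 2 ∂(ν.prod κ) :=
  (lintegral_prod _ (hg.enorm.pow_const 2)).symm

theorem ae_memLp_section {g : Y × Z → ℂ} (hg : MemLp g 2 (ν.prod κ)) :
    ∀ᵐ y ∂ν, MemLp (fun t => g (y, t)) 2 κ := by
  have h1 := lintegral_sq_lt_top hg
  rw [← lintegral_prod_sq hg.1] at h1
  have hm : AEMeasurable (fun y => ∫⁻ t, ‖g (y, t)‖ₑ ^ 2 ∂κ) ν :=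
    (hg.1.enorm.pow_const 2).lintegral_prod_right'
  filter_upwards [hg.1.prodMk_left, ae_lt_top' hm h1.ne] with y h2 h3
  exact (memLp_two_iff h2).2 h3

theorem ae_integrable_section_mul {g : Y × Z → ℂ} (hg : MemLp g 2 (ν.prod κ)) {q : Z → ℂ}
    (hq : MemLp q 2 κ) : ∀ᵐ y ∂ν, Integrable (fun t => g (y, t) * q t) κ := by
  filter_upwards [ae_memLp_section hg] with y hy
  exact hy.integrable_mul hq

theorem lintegral_average_le {g : Y × Z → ℂ} (hg : AEStronglyMeasurable g (ν.prod κ)) {q : Z → ℂ}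
    (hq : AEStronglyMeasurable q κ) :
    ∫⁻ y, ‖∫ t, g (y, t) * q t ∂κ‖ₑ ^ 2 ∂ν ≤
      (∫⁻ p, ‖g p‖ₑ ^ 2 ∂(ν.prod κ)) * ∫⁻ t, ‖q t‖ₑ ^ 2 ∂κ := by
  rw [← lintegral_prod_sq hg,
    ← lintegral_mul_const'' _ ((hg.enorm.pow_const 2).lintegral_prod_right')]
  refine lintegral_mono_ae ?_
  filter_upwards [hg.prodMk_left] with y hy
  exact enorm_integral_mul_sq_le hy hq

theorem memLp_average {g : Y × Z → ℂ} (hg : MemLp g 2 (ν.prod κ)) {q : Z → ℂ}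
    (hq : MemLp q 2 κ) : MemLp (fun y => ∫ t, g (y, t) * q t ∂κ) 2 ν := by
  have hm : AEStronglyMeasurable (fun p : Y × Z => g p * q p.2) (ν.prod κ) :=
    hg.1.mul hq.1.comp_snd
  rw [memLp_two_iff hm.integral_prod_right']
  exact (lintegral_average_le hg.1 hq.1).trans_lt
    (ENNReal.mul_lt_top (lintegral_sq_lt_top hg) (lintegral_sq_lt_top hq))

/-- The averaging operator `g ↦ ∫ g(·, t) q(t) dt` on `L₂`. -/
def average {q : Z → ℂ} (hq : MemLp q 2 κ) : Lp ℂ 2 (ν.prod κ) →ₗ[ℂ] Lp ℂ 2 ν where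
  toFun g := (memLp_average (Lp.memLp g) hq).toLp _
  map_add' f g := by
    rw [← MemLp.toLp_add]
    refine MemLp.toLp_congr _ _ ?_
    filter_upwards [Measure.ae_ae_of_ae_prod (Lp.coeFn_add f g),
      ae_integrable_section_mul (Lp.memLp f) hq, ae_integrable_section_mul (Lp.memLp g) hq]
      with y hy hf hg
    rw [Pi.add_apply, ← integral_add hf hg]
    refine integral_congr_ae (hy.mono fun t ht => ?_)
    simp only [ht, Pi.add_apply, add_mul]
  map_smul' c f := by
    rw [RingHom.id_apply, ← MemLp.toLp_const_smul]
    refine MemLp.toLp_congr _ _ ?_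
    filter_upwards [Measure.ae_ae_of_ae_prod (Lp.coeFn_smul c f)] with y hy
    rw [Pi.smul_apply, smul_eq_mul, ← integral_const_mul]
    refine integral_congr_ae (hy.mono fun t ht => ?_)
    simp only [ht, Pi.smul_apply, smul_eq_mul, mul_assoc]

theorem coeFn_average {q : Z → ℂ} (hq : MemLp q 2 κ) (g : Lp ℂ 2 (ν.prod κ)) :
    average hq g =ᵐ[ν] fun y => ∫ t, g (y, t) * q t ∂κ :=
  (memLp_average (Lp.memLp g) hq).coeFn_toLp

theorem coeFn_average_congr {q : Z → ℂ} (hq : MemLp q 2 κ) {g : Lp ℂ 2 (ν.prod κ)}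
    {g' : Y × Z → ℂ} (h : g =ᵐ[ν.prod κ] g') :
    average hq g =ᵐ[ν] fun y => ∫ t, g' (y, t) * q t ∂κ := by
  filter_upwards [coeFn_average hq g, Measure.ae_ae_of_ae_prod h] with y h1 h2
  rw [h1]
  exact integral_congr_ae (h2.mono fun t ht => by simp only [ht])

variable [SFinite ν]

/-- Averaging commutes with weighted compositions in the first variable. -/
theorem average_prod_op {X : Type*} [MeasurableSpace X] {μ : Measure X} [SFinite μ] {a : Y → ℂ}
    {ρ : Y → X} (h : BoundedComp a ρ ν μ) {q : Z → ℂ} (hq : MemLp q 2 κ)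
    (g : Lp ℂ 2 (μ.prod κ)) : average hq ((h.prod κ).op g) = h.op (average hq g) := by
  apply Lp.ext
  filter_upwards [coeFn_average_congr hq ((h.prod κ).coeFn_op g), h.coeFn_op (average hq g),
    h.ae_eq (coeFn_average hq g)] with y h1 h2 h3
  rw [h1, h2, h3, ← integral_const_mul]
  simp only [Prod.map_apply, id_eq, mul_assoc]

end Average

theorem BoundedComp.continuous_op {X Y : Type*} [MeasurableSpace X] [MeasurableSpace Y]
    {a : Y → ℂ} {ρ : Y → X} {ν : Measure Y} {μ : Measure X} (h : BoundedComp a ρ ν μ) :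
    Continuous h.op := by
  obtain ⟨C, hC⟩ := h.lintegral_le
  refine AddMonoidHomClass.continuous_of_bound h.op (NNReal.sqrt C) fun f => ?_
  have h1 : ‖h.op f‖ₑ ^ 2 ≤ ((NNReal.sqrt C : ℝ≥0) * ‖f‖ₑ) ^ 2 := by
    rw [mul_pow, Lp.enorm_def, Lp.enorm_def, eLpNorm_two_sq, eLpNorm_two_sq,
      lintegral_sq_congr (h.coeFn_op f)]
    have h2 : ((NNReal.sqrt C : ℝ≥0) : ℝ≥0∞) ^ 2 = C := by
      rw [← ENNReal.coe_pow, NNReal.sq_sqrt]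
    rw [h2]
    exact hC f (Lp.aestronglyMeasurable f)
  have h2 : ‖h.op f‖ₑ ≤ (NNReal.sqrt C : ℝ≥0) * ‖f‖ₑ :=
    (ENNReal.pow_right_strictMono two_ne_zero).le_iff_le.1 h1
  rw [enorm_eq_nnnorm, enorm_eq_nnnorm, ← ENNReal.coe_mul, ENNReal.coe_le_coe] at h2
  exact NNReal.coe_le_coe.2 h2

end

end CauchyData

namespace CauchyData

noncomputable section

/-! ### Averages in time and the Fourier transform -/

section TimeAverage

theorem integral_fourierInv_mul {E : Type} [NormedAddCommGroup E] [InnerProductSpace ℝ E]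
    [FiniteDimensional ℝ E] [MeasurableSpace E] [BorelSpace E] (f : L2 E) (ψ : 𝓢(E, ℂ)) :
    ∫ x, (𝓕⁻ f : L2 E) x * ψ x = ∫ x, f x * (𝓕⁻ ψ : 𝓢(E, ℂ)) x := by
  have h := congrArg (fun w : 𝓢'(E, ℂ) => w ψ) (Lp.fourierInv_toTemperedDistribution_eq f)
  simp only [TemperedDistribution.fourierInv_apply, Lp.toTemperedDistribution_apply,
    smul_eq_mul] at h
  simp only [mul_comm _ (ψ _), mul_comm _ ((𝓕⁻ ψ : 𝓢(E, ℂ)) _)]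
  exact h.symm

variable {d : ℕ}

/-- Restriction of functions on space-time to a set of times (or to a smaller measure). -/
theorem boundedComp_toLp {κ : Measure ℝ} [SFinite κ] (hκ : κ ≤ volume) :
    BoundedComp (fun _ => 1) (WithLp.toLp 2 : Eucl d × ℝ → SpaceTime d)
      ((volume : Measure (Eucl d)).prod κ) volume where
  measurable_weight := measurable_const
  measurable_map := (WithLp.volume_preserving_toLp (Eucl d) ℝ).measurable
  bounded := ⟨1, fun _ => by simp⟩
  map_le := ⟨1, by
    have : {y : Eucl d × ℝ | (1 : ℂ) ≠ 0} = univ := by simp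
    rw [this, Measure.restrict_univ, ENNReal.coe_one, one_smul,
      ← (WithLp.volume_preserving_toLp (Eucl d) ℝ).map_eq]
    exact Measure.map_mono (Measure.prod_mono le_rfl hκ)
      (WithLp.volume_preserving_toLp (Eucl d) ℝ).measurable⟩

theorem coeFn_toLp_op {κ : Measure ℝ} [SFinite κ] (hκ : κ ≤ volume) (f : L2 (SpaceTime d)) :
    (boundedComp_toLp hκ).op f =ᵐ[(volume : Measure (Eucl d)).prod κ]
      fun p => f (WithLp.toLp 2 p) := by
  filter_upwards [(boundedComp_toLp hκ).coeFn_op f] with p hp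
  rw [hp, one_mul]

theorem memLp_tensor {u : Eucl d → ℂ} {q : ℝ → ℂ} (hu : MemLp u 2 volume) (hq : MemLp q 2 volume) :
    MemLp (fun p : Eucl d × ℝ => u p.1 * q p.2) 2 (volume.prod volume) := by
  have hm : AEStronglyMeasurable (fun p : Eucl d × ℝ => u p.1 * q p.2) (volume.prod volume) :=
    hu.1.comp_fst.mul hq.1.comp_snd
  rw [memLp_two_iff hm]
  simp only [enorm_mul, mul_pow]
  rw [lintegral_prod_mul (hu.1.enorm.pow_const 2) (hq.1.enorm.pow_const 2)]
  exact ENNReal.mul_lt_top (lintegral_sq_lt_top hu) (lintegral_sq_lt_top hq)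

theorem integral_average_mul {u : Eucl d → ℂ} {q : ℝ → ℂ} (hu : MemLp u 2 volume)
    (hq : MemLp q 2 volume) (f : L2 (SpaceTime d)) :
    ∫ x, (∫ t, f (WithLp.toLp 2 (x, t)) * q t) * u x = ∫ z, f z * (u z.fst * q z.snd) := by
  have hmp := WithLp.volume_preserving_toLp (Eucl d) ℝ
  have hf : MemLp (fun p : Eucl d × ℝ => f (WithLp.toLp 2 p)) 2 (volume.prod volume) :=
    (Lp.memLp f).comp_measurePreserving hmp
  have hint : Integrable (fun p : Eucl d × ℝ => f (WithLp.toLp 2 p) * (u p.1 * q p.2))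
      (volume.prod volume) := hf.integrable_mul (memLp_tensor hu hq)
  calc _ = ∫ x, ∫ t, f (WithLp.toLp 2 (x, t)) * (u x * q t) := by
        refine integral_congr_ae (Eventually.of_forall fun x => ?_)
        dsimp only
        rw [← integral_mul_const]
        refine integral_congr_ae (Eventually.of_forall fun t => ?_)
        dsimp only
        ring
    _ = ∫ p : Eucl d × ℝ, f (WithLp.toLp 2 p) * (u p.1 * q p.2) := (integral_prod _ hint).symm
    _ = _ := hmp.integral_comp (MeasurableEquiv.toLp 2 (Eucl d × ℝ)).measurableEmbedding
        (fun z : SpaceTime d => f z * (u z.fst * q z.snd))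

theorem hasCompactSupport_tensor {u : Eucl d → ℂ} {q : ℝ → ℂ} (hu : HasCompactSupport u)
    (hq : HasCompactSupport q) : HasCompactSupport fun z : SpaceTime d => u z.fst * q z.snd := by
  refine HasCompactSupport.of_support_subset_isCompact (K := WithLp.toLp 2 '' (tsupport u ×ˢ tsupport q))
    ((hu.isCompact.prod hq.isCompact).image (WithLp.prod_continuous_toLp 2 _ _)) fun z hz => ?_
  exact ⟨(z.fst, z.snd), ⟨subset_tsupport _ (left_ne_zero_of_mul hz),
    subset_tsupport _ (right_ne_zero_of_mul hz)⟩, rfl⟩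

theorem contDiff_tensor {u : Eucl d → ℂ} {q : ℝ → ℂ} (hu : ContDiff ℝ ∞ u) (hq : ContDiff ℝ ∞ q) :
    ContDiff ℝ ∞ fun z : SpaceTime d => u z.fst * q z.snd :=
  (hu.comp (fstCLM d).contDiff).mul (hq.comp (sndCLM d).contDiff)

theorem fourierInv_tensor (u : Eucl d → ℂ) (q : ℝ → ℂ) (z : SpaceTime d) :
    𝓕⁻ (fun z : SpaceTime d => u z.fst * q z.snd) z = 𝓕⁻ u z.fst * 𝓕⁻ q z.snd := by
  have hmp := WithLp.volume_preserving_toLp (Eucl d) ℝ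
  simp only [Real.fourierInv_eq']
  rw [← hmp.integral_comp (MeasurableEquiv.toLp 2 (Eucl d × ℝ)).measurableEmbedding]
  rw [← integral_prod_mul]
  refine integral_congr_ae (Eventually.of_forall fun p => ?_)
  simp only [WithLp.prod_inner_apply, smul_eq_mul]
  push_cast
  rw [mul_add, add_mul, Complex.exp_add]
  exact mul_mul_mul_comm _ _ _ _

/-- A time average of an inverse Fourier transform is an inverse Fourier transform. -/
theorem average_fourierInv {κ : Measure ℝ} [SFinite κ] (hκ : κ ≤ volume) (q : 𝓢(ℝ, ℂ))
    (hq : HasCompactSupport q) (hqκ : ∀ F : ℝ → ℂ, ∫ t, F t * q t ∂κ = ∫ t, F t * q t)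
    (hqm : MemLp q 2 κ) (f : L2 (SpaceTime d)) :
    average hqm ((boundedComp_toLp hκ).op (𝓕⁻ f)) =
      𝓕⁻ (average ((𝓕⁻ q : 𝓢(ℝ, ℂ)).memLp 2 volume) ((boundedComp_toLp le_rfl).op f)) := by
  apply Lp.ext
  refine ae_eq_of_schwartz_univ (locallyIntegrable_of_memLp_two (Lp.memLp _))
    (locallyIntegrable_of_memLp_two (Lp.memLp _)) fun ψ hψ => ?_
  rw [integral_fourierInv_mul]
  -- Tested against `ψ`, both sides are pairings with tensor products by Fubini's theorem, and the
  -- inverse Fourier transform of `ψ ⊗ q` is the tensor product of the inverse transforms.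
  set Ψ : 𝓢(SpaceTime d, ℂ) := (hasCompactSupport_tensor hψ hq).toSchwartzMap
    (contDiff_tensor (ψ.smooth _) (q.smooth _)) with hΨ
  have hΨa : ∀ z, Ψ z = ψ z.fst * q z.snd := fun z => rfl
  have hΨF : ∀ z, (𝓕⁻ Ψ : 𝓢(SpaceTime d, ℂ)) z =
      (𝓕⁻ ψ : 𝓢(Eucl d, ℂ)) z.fst * (𝓕⁻ q : 𝓢(ℝ, ℂ)) z.snd := fun z => by
    rw [SchwartzMap.fourierInv_coe, SchwartzMap.fourierInv_coe, SchwartzMap.fourierInv_coe,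
      ← fourierInv_tensor]
    rfl
  have h1 := coeFn_average_congr hqm (coeFn_toLp_op hκ (𝓕⁻ f))
  have h2 := coeFn_average_congr ((𝓕⁻ q : 𝓢(ℝ, ℂ)).memLp 2 volume) (coeFn_toLp_op le_rfl f)
  have e1 : ∫ x, average hqm ((boundedComp_toLp hκ).op (𝓕⁻ f)) x * ψ x =
      ∫ x, (∫ t, (𝓕⁻ f : L2 (SpaceTime d)) (WithLp.toLp 2 (x, t)) * q t) * ψ x := by
    refine integral_congr_ae (h1.mono fun x hx => ?_)
    dsimp only at hx ⊢
    rw [hx, hqκ fun t => (𝓕⁻ f : L2 (SpaceTime d)) (WithLp.toLp 2 (x, t))]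
  have e2 : ∫ x, average ((𝓕⁻ q : 𝓢(ℝ, ℂ)).memLp 2 volume) ((boundedComp_toLp le_rfl).op f) x *
        (𝓕⁻ ψ : 𝓢(Eucl d, ℂ)) x =
      ∫ x, (∫ t, f (WithLp.toLp 2 (x, t)) * (𝓕⁻ q : 𝓢(ℝ, ℂ)) t) * (𝓕⁻ ψ : 𝓢(Eucl d, ℂ)) x := by
    refine integral_congr_ae (h2.mono fun x hx => ?_)
    dsimp only at hx ⊢
    rw [hx]
  rw [e1, e2, integral_average_mul (ψ.memLp 2 volume) (q.memLp 2 volume),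
    integral_average_mul ((𝓕⁻ ψ : 𝓢(Eucl d, ℂ)).memLp 2 volume)
      ((𝓕⁻ q : 𝓢(ℝ, ℂ)).memLp 2 volume)]
  simp only [← hΨa, ← hΨF]
  exact integral_fourierInv_mul f Ψ

end TimeAverage

end

end CauchyData

namespace CauchyData

noncomputable section

/-! ### Comparison of the anisotropic and isotropic weights -/

section Weights

variable {d : ℕ}

/-- The weight `1 + |x|²`. -/
def bracketSq (x : Eucl d) : ℝ := 1 + ‖x‖ ^ 2

theorem one_le_bracketSq (x : Eucl d) : 1 ≤ bracketSq x := by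
  unfold bracketSq; nlinarith [sq_nonneg ‖x‖]

theorem bracketSq_pos (x : Eucl d) : 0 < bracketSq x := zero_lt_one.trans_le (one_le_bracketSq x)

theorem continuous_bracketSq : Continuous (bracketSq (d := d)) := by
  unfold bracketSq; fun_prop

theorem one_le_sqrt_bracketSq (x : Eucl d) : 1 ≤ bracketSq x ^ (1 / 2 : ℝ) :=
  Real.one_le_rpow (one_le_bracketSq x) (by norm_num)

theorem isoIndex_eq_radial (s : ℝ) (φ : ℝ → ℝ) (x : Eucl d) :
    isoIndex d s φ x = radial s φ (bracketSq x ^ (1 / 2 : ℝ)) := by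
  rw [isoIndex, radial, ← Real.rpow_mul (bracketSq_pos x).le]
  unfold bracketSq
  congr 2
  ring

theorem isoIndex_pos {s : ℝ} {φ : ℝ → ℝ} (hφ : ClassM φ) (x : Eucl d) : 0 < isoIndex d s φ x := by
  rw [isoIndex_eq_radial]; exact radial_pos hφ (one_le_sqrt_bracketSq x)

theorem anisoIndex_pos {s : ℝ} {φ : ℝ → ℝ} (hφ : ClassM φ) (z : SpaceTime d) :
    0 < anisoIndex d s φ z := by
  rw [anisoIndex_eq_radial]; exact radial_pos hφ (one_le_anisoRadius z)

theorem measurable_anisoIndex (s : ℝ) {φ : ℝ → ℝ} (hφ : ClassM φ) :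
    Measurable (anisoIndex d s φ) := by
  have : anisoIndex d s φ = fun z => radial s φ (anisoRadius z) :=
    funext (anisoIndex_eq_radial s φ)
  rw [this]
  exact measurable_radial_comp hφ continuous_anisoRadius.measurable one_le_anisoRadius

theorem exists_le_isoIndex {s : ℝ} (hs : 0 < s) {φ : ℝ → ℝ} (hφ : ClassM φ) :
    ∃ c, 0 < c ∧ ∀ x : Eucl d, c ≤ isoIndex d s φ x := by
  obtain ⟨c, hc, h⟩ := exists_le_radial hs hφ
  exact ⟨c, hc, fun x => by rw [isoIndex_eq_radial]; exact h _ (one_le_sqrt_bracketSq x)⟩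

theorem exists_le_anisoIndex {s : ℝ} (hs : 0 < s) {φ : ℝ → ℝ} (hφ : ClassM φ) :
    ∃ c, 0 < c ∧ ∀ z : SpaceTime d, c ≤ anisoIndex d s φ z := by
  obtain ⟨c, hc, h⟩ := exists_le_radial hs hφ
  exact ⟨c, hc, fun z => by rw [anisoIndex_eq_radial]; exact h _ (one_le_anisoRadius z)⟩

/-- With `λ = bracketSq x` the isotropic radius is `λ^(1/2)`, so a loss of `2k + 1` orders costs
exactly `λ^(2k+1)` in the squared weight. The slowly varying factor is unaffected. -/
theorem isoIndex_sq_mul (s : ℝ) (φ : ℝ → ℝ) (k : ℕ) (x : Eucl d) :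
    isoIndex d (s - 2 * k - 1) φ x ^ 2 * bracketSq x ^ (2 * k + 1) =
      radial s φ (bracketSq x ^ (1 / 2 : ℝ)) ^ 2 := by
  have h0 := bracketSq_pos x
  rw [isoIndex_eq_radial, radial, radial, mul_pow, mul_pow, ← Real.rpow_mul h0.le,
    ← Real.rpow_mul h0.le, ← Real.rpow_natCast (bracketSq x) (2 * k + 1),
    ← Real.rpow_natCast (_ ^ _) 2, ← Real.rpow_natCast (_ ^ _) 2, ← Real.rpow_mul h0.le,
    ← Real.rpow_mul h0.le, mul_right_comm, ← Real.rpow_add h0]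
  congr 2
  push_cast
  ring

theorem anisoRadius_div (x : Eucl d) (η : ℝ) :
    anisoRadius (WithLp.toLp 2 (x, η) : SpaceTime d) / bracketSq x ^ (1 / 2 : ℝ) =
      (1 + |η / bracketSq x|) ^ (1 / 2 : ℝ) := by
  have h0 := bracketSq_pos x
  have h1 : anisoRadius (WithLp.toLp 2 (x, η) : SpaceTime d) =
      (bracketSq x + |η|) ^ (1 / 2 : ℝ) := rfl
  rw [h1, ← Real.div_rpow (by positivity) h0.le, add_div, div_self h0.ne', abs_div, abs_of_pos h0]

theorem sqrt_bracketSq_le (x : Eucl d) (η : ℝ) :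
    bracketSq x ^ (1 / 2 : ℝ) ≤ anisoRadius (WithLp.toLp 2 (x, η) : SpaceTime d) :=
  Real.rpow_le_rpow (bracketSq_pos x).le (le_add_of_nonneg_right (abs_nonneg η)) (by norm_num)

/-- Comparison of the anisotropic and isotropic weights. -/
theorem anisoIndex_compare {s : ℝ} {φ : ℝ → ℝ} (hφ : ClassM φ) (k : ℕ) {ε : ℝ} (hε : 0 < ε) :
    ∃ C, 0 < C ∧ ∀ (x : Eucl d) (η : ℝ),
      anisoIndex d s φ (WithLp.toLp 2 (x, η)) ^ 2 ≤
        C * (1 + |η / bracketSq x|) ^ (s + ε) *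
          (isoIndex d (s - 2 * k - 1) φ x ^ 2 * bracketSq x ^ (2 * k + 1)) ∧
      isoIndex d (s - 2 * k - 1) φ x ^ 2 * bracketSq x ^ (2 * k + 1) ≤
        C * (1 + |η / bracketSq x|) ^ (-(s - ε)) *
          anisoIndex d s φ (WithLp.toLp 2 (x, η)) ^ 2 := by
  obtain ⟨C, hC0, hC⟩ := radial_potter (s := s) hφ hε
  refine ⟨C ^ 2, by positivity, fun x η => ?_⟩
  -- The Potter bounds compare the radii `λ^(1/2) ≤ (λ + |η|)^(1/2)`. Their ratio is `(1 +
  -- |η/λ|)^(1/2)`, and squaring the estimate removes the exponent `1/2`.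
  obtain ⟨h1, h2⟩ := hC _ _ (one_le_sqrt_bracketSq x) (sqrt_bracketSq_le x η)
  have hA := one_le_anisoRadius (WithLp.toLp 2 (x, η) : SpaceTime d)
  have hB := one_le_sqrt_bracketSq x
  have hpos : 0 ≤ 1 + |η / bracketSq x| := by positivity
  rw [isoIndex_sq_mul, anisoIndex_eq_radial]
  constructor
  · rw [anisoRadius_div] at h1
    refine (pow_le_pow_left₀ (radial_pos hφ hA).le h1 2).trans (le_of_eq ?_)
    rw [mul_pow, mul_pow, ← Real.rpow_mul hpos, ← Real.rpow_natCast (_ ^ _) 2, ← Real.rpow_mul hpos]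
    congr 3
    push_cast
    ring
  · rw [← inv_div (anisoRadius _) (bracketSq x ^ _), anisoRadius_div, Real.inv_rpow (by positivity), ← Real.rpow_neg (by positivity)]
      at h2
    refine (pow_le_pow_left₀ (radial_pos hφ hB).le h2 2).trans (le_of_eq ?_)
    rw [mul_pow, mul_pow, ← Real.rpow_mul hpos, ← Real.rpow_natCast (_ ^ _) 2, ← Real.rpow_mul hpos]
    congr 3
    push_cast
    ring

theorem lintegral_comp_div {a : ℝ} (ha : 0 < a) {g : ℝ → ℝ≥0∞} (hg : Measurable g) :
    ∫⁻ t, g (t / a) = ENNReal.ofReal a * ∫⁻ t, g t := by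
  have h := Real.map_volume_mul_left (a := a⁻¹) (by positivity)
  rw [inv_inv, abs_of_pos ha] at h
  rw [← smul_eq_mul, ← lintegral_smul_measure, ← h, lintegral_map hg (by fun_prop)]
  simp only [div_eq_inv_mul]

/-- The dual weight bound behind the trace estimate. -/
theorem lintegral_moment_div_anisoIndex_le {s : ℝ} {φ : ℝ → ℝ} (hφ : ClassM φ) {k : ℕ}
    (hs : 2 * k + 1 < s) : ∃ C : ℝ≥0, ∀ x : Eucl d,
      ENNReal.ofReal (isoIndex d (s - 2 * k - 1) φ x) ^ 2 *
        ∫⁻ η, ENNReal.ofReal (|2 * Real.pi * η| ^ k /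
          anisoIndex d s φ (WithLp.toLp 2 (x, η))) ^ 2 ≤ C := by
  -- Half of the excess of `s` over `2k + 1` is given to the Potter bound; the other half leaves a
  -- decay exponent `r = s - ε - 2k > 1`, hence an integrable function of `η/λ`.
  set ε : ℝ := (s - (2 * k + 1)) / 2 with hεdef
  have hε : 0 < ε := by rw [hεdef]; linarith
  obtain ⟨C, hC0, hC⟩ := anisoIndex_compare (d := d) (s := s) hφ k hε
  set r : ℝ := s - ε - 2 * k with hr
  have hr1 : 1 < r := by rw [hr, hεdef]; linarith
  have hfin : ∫⁻ t : ℝ, ENNReal.ofReal ((1 + ‖t‖) ^ (-r)) < ⊤ :=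
    finite_integral_one_add_norm (by simpa using hr1)
  set I := ∫⁻ t : ℝ, ENNReal.ofReal ((1 + ‖t‖) ^ (-r)) with hI
  refine ⟨(ENNReal.ofReal (C * (2 * Real.pi) ^ (2 * k)) * I).toNNReal, fun x => ?_⟩
  rw [ENNReal.coe_toNNReal (ENNReal.mul_lt_top ENNReal.ofReal_lt_top hfin).ne]
  have h0 := bracketSq_pos x
  have hiso := isoIndex_pos (s := s - 2 * k - 1) hφ x
  have hpt : ∀ η : ℝ, ENNReal.ofReal (isoIndex d (s - 2 * k - 1) φ x) ^ 2 *
      ENNReal.ofReal (|2 * Real.pi * η| ^ k / anisoIndex d s φ (WithLp.toLp 2 (x, η))) ^ 2 ≤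
      ENNReal.ofReal (C * (2 * Real.pi) ^ (2 * k) / bracketSq x) *
        ENNReal.ofReal ((1 + ‖η / bracketSq x‖) ^ (-r)) := by
    intro η
    have hA := anisoIndex_pos (s := s) hφ (WithLp.toLp 2 (x, η) : SpaceTime d)
    rw [← ENNReal.ofReal_pow hiso.le, ← ENNReal.ofReal_pow (by positivity),
      ← ENNReal.ofReal_mul (by positivity), ← ENNReal.ofReal_mul (by positivity)]
    refine ENNReal.ofReal_le_ofReal ?_
    have h2 := (hC x η).2
    rw [div_pow, ← mul_div_assoc, div_le_iff₀ (by positivity)]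
    set A := anisoIndex d s φ (WithLp.toLp 2 (x, η)) ^ 2 with hAdef
    set u := |η / bracketSq x| with hu
    have hu0 : 0 ≤ u := abs_nonneg _
    have hη : |2 * Real.pi * η| = 2 * Real.pi * (u * bracketSq x) := by
      rw [abs_mul, abs_of_pos (by positivity : (0 : ℝ) < 2 * Real.pi), hu, abs_div, abs_of_pos h0,
        div_mul_cancel₀ _ h0.ne']
    have hsplit : u ^ (2 * k) * (1 + u) ^ (-(s - ε)) ≤ (1 + u) ^ (-r) := by
      have h3 : u ^ (2 * k) ≤ (1 + u) ^ ((2 * k : ℕ) : ℝ) := by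
        rw [Real.rpow_natCast]
        exact pow_le_pow_left₀ hu0 (by linarith) _
      calc u ^ (2 * k) * (1 + u) ^ (-(s - ε))
          ≤ (1 + u) ^ ((2 * k : ℕ) : ℝ) * (1 + u) ^ (-(s - ε)) := by gcongr
        _ = (1 + u) ^ (-r) := by
          rw [← Real.rpow_add (by linarith)]
          congr 1
          rw [hr]
          push_cast
          ring
    have hb : bracketSq x ^ (2 * k) = bracketSq x ^ (2 * k + 1) / bracketSq x := by
      rw [pow_succ, mul_div_assoc, div_self h0.ne', mul_one]
    rw [hη, Real.norm_eq_abs, ← hu]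
    calc isoIndex d (s - 2 * k - 1) φ x ^ 2 * ((2 * Real.pi * (u * bracketSq x)) ^ k) ^ 2
        = (2 * Real.pi) ^ (2 * k) * u ^ (2 * k) *
          (isoIndex d (s - 2 * k - 1) φ x ^ 2 * bracketSq x ^ (2 * k)) := by ring
      _ = (2 * Real.pi) ^ (2 * k) * u ^ (2 * k) *
          (isoIndex d (s - 2 * k - 1) φ x ^ 2 * bracketSq x ^ (2 * k + 1)) / bracketSq x := by
        rw [hb]; ring
      _ ≤ (2 * Real.pi) ^ (2 * k) * u ^ (2 * k) * (C * (1 + u) ^ (-(s - ε)) * A) / bracketSq x := by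
        gcongr
      _ = C * (2 * Real.pi) ^ (2 * k) / bracketSq x * (u ^ (2 * k) * (1 + u) ^ (-(s - ε))) * A := by
        ring
      _ ≤ _ := by gcongr
  rw [← lintegral_const_mul' _ _ (by finiteness)]
  refine (lintegral_mono hpt).trans (le_of_eq ?_)
  -- The factor `1/λ` remaining in the pointwise bound is cancelled by the Jacobian of `η = λt`,
  -- which makes the constant independent of `x`.
  rw [lintegral_const_mul' _ _ (by finiteness),
    lintegral_comp_div h0 (g := fun t => ENNReal.ofReal ((1 + ‖t‖) ^ (-r))) (by fun_prop), ← hI,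
    ← mul_assoc, ← ENNReal.ofReal_mul (by positivity), div_mul_cancel₀ _ h0.ne']

/-- The weight bound behind the right inverse of the trace. -/
theorem lintegral_anisoIndex_mul_le {s : ℝ} {φ : ℝ → ℝ} (hφ : ClassM φ) (k : ℕ) (B : 𝓢(ℝ, ℂ)) :
    ∃ C : ℝ≥0, ∀ x : Eucl d,
      ∫⁻ η, ENNReal.ofReal (anisoIndex d s φ (WithLp.toLp 2 (x, η))) ^ 2 *
        (ENNReal.ofReal ((bracketSq x ^ (k + 1))⁻¹) ^ 2 * ‖B (η / bracketSq x)‖ₑ ^ 2) ≤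
      C * ENNReal.ofReal (isoIndex d (s - 2 * k - 1) φ x) ^ 2 := by
  obtain ⟨C, hC0, hC⟩ := anisoIndex_compare (d := d) (s := s) hφ k one_pos
  have hm : Measurable fun t : ℝ => ENNReal.ofReal ((1 + |t|) ^ (s + 1)) * ‖B t‖ₑ ^ 2 :=
    (by fun_prop : Measurable fun t : ℝ => ENNReal.ofReal ((1 + |t|) ^ (s + 1))).mul
      (B.continuous.measurable.enorm.pow_const 2)
  have hfin : ∫⁻ t, ENNReal.ofReal ((1 + |t|) ^ (s + 1)) * ‖B t‖ₑ ^ 2 < ⊤ := by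
    -- Decay of `B` of order `n` contributes `-2n` to the exponent of the integrand; `2n > s + 3`
    -- brings it below `-2`, which is integrable on the line.
    obtain ⟨n, hn⟩ := exists_nat_gt ((s + 3) / 2)
    set D : ℝ := 2 ^ n * ((Finset.Iic (n, 0)).sup fun m => SchwartzMap.seminorm ℝ m.1 m.2) B
    have hD : ∀ t : ℝ, (1 + |t|) ^ n * ‖B t‖ ≤ D := fun t => by
      have := SchwartzMap.one_add_le_sup_seminorm_apply (𝕜 := ℝ) (m := (n, 0)) (k := n) (n := 0)
        le_rfl le_rfl B t
      simpa using this
    have hfin := ENNReal.mul_lt_top (ENNReal.ofReal_lt_top (r := D ^ 2))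
      (finite_integral_one_add_norm (E := ℝ) (μ := volume) (r := 2) (by norm_num))
    rw [← lintegral_const_mul' _ _ (by finiteness)] at hfin
    refine (lintegral_mono fun t => ?_).trans_lt hfin
    rw [← ofReal_norm, ← ENNReal.ofReal_pow (norm_nonneg _), ← ENNReal.ofReal_mul (by positivity),
      ← ENNReal.ofReal_mul (by positivity), Real.norm_eq_abs]
    refine ENNReal.ofReal_le_ofReal ?_
    have h1 : 1 ≤ 1 + |t| := by linarith [abs_nonneg t]
    have h2 : (1 + |t|) ^ (s + 1) ≤ (1 + |t|) ^ (-2 : ℝ) * ((1 + |t|) ^ n) ^ 2 := by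
      rw [← pow_mul, ← Real.rpow_natCast, ← Real.rpow_add (by linarith)]
      refine Real.rpow_le_rpow_of_exponent_le h1 ?_
      push_cast
      linarith
    calc (1 + |t|) ^ (s + 1) * ‖B t‖ ^ 2
        ≤ (1 + |t|) ^ (-2 : ℝ) * ((1 + |t|) ^ n) ^ 2 * ‖B t‖ ^ 2 := by gcongr
      _ = (1 + |t|) ^ (-2 : ℝ) * ((1 + |t|) ^ n * ‖B t‖) ^ 2 := by ring
      _ ≤ (1 + |t|) ^ (-2 : ℝ) * D ^ 2 := by gcongr; exact hD t
      _ = _ := mul_comm _ _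
  set I := ∫⁻ t, ENNReal.ofReal ((1 + |t|) ^ (s + 1)) * ‖B t‖ₑ ^ 2 with hI
  refine ⟨(ENNReal.ofReal C * I).toNNReal, fun x => ?_⟩
  rw [ENNReal.coe_toNNReal (ENNReal.mul_lt_top ENNReal.ofReal_lt_top hfin).ne]
  have h0 := bracketSq_pos x
  have hiso := isoIndex_pos (s := s - 2 * k - 1) hφ x
  have hpt : ∀ η : ℝ, ENNReal.ofReal (anisoIndex d s φ (WithLp.toLp 2 (x, η))) ^ 2 *
        (ENNReal.ofReal ((bracketSq x ^ (k + 1))⁻¹) ^ 2 * ‖B (η / bracketSq x)‖ₑ ^ 2) ≤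
      ENNReal.ofReal (C * isoIndex d (s - 2 * k - 1) φ x ^ 2 / bracketSq x) *
        (ENNReal.ofReal ((1 + |η / bracketSq x|) ^ (s + 1)) * ‖B (η / bracketSq x)‖ₑ ^ 2) := by
    intro η
    have hA := anisoIndex_pos (s := s) hφ (WithLp.toLp 2 (x, η) : SpaceTime d)
    rw [← mul_assoc, ← mul_assoc]
    refine mul_le_mul_left ?_ _
    rw [← ENNReal.ofReal_pow hA.le, ← ENNReal.ofReal_pow (by positivity),
      ← ENNReal.ofReal_mul (by positivity), ← ENNReal.ofReal_mul (by positivity)]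
    refine ENNReal.ofReal_le_ofReal ?_
    refine (mul_le_mul_of_nonneg_right (hC x η).1 (by positivity)).trans (le_of_eq ?_)
    have hb : bracketSq x ^ (2 * k + 1) * ((bracketSq x ^ (k + 1))⁻¹) ^ 2 = (bracketSq x)⁻¹ := by
      field_simp
      ring
    calc _ = C * (1 + |η / bracketSq x|) ^ (s + 1) * isoIndex d (s - 2 * k - 1) φ x ^ 2 *
          (bracketSq x ^ (2 * k + 1) * ((bracketSq x ^ (k + 1))⁻¹) ^ 2) := by ring
      _ = _ := by rw [hb]; ring
  refine (lintegral_mono hpt).trans (le_of_eq ?_)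
  rw [lintegral_const_mul' _ _ (by finiteness), lintegral_comp_div h0 hm, ← hI,
    ← mul_assoc, ← ENNReal.ofReal_mul (by positivity), div_mul_cancel₀ _ h0.ne',
    ENNReal.ofReal_mul hC0.le, ENNReal.ofReal_pow hiso.le]
  ring

end Weights

end

end CauchyData

namespace CauchyData

noncomputable section

/-! ### Traces in terms of moments of the Fourier transform -/

section Moments

variable {d : ℕ}

theorem lintegral_spaceTime {g : SpaceTime d → ℝ≥0∞} (hg : AEMeasurable g volume) :
    ∫⁻ z, g z = ∫⁻ x, ∫⁻ η, g (WithLp.toLp 2 (x, η)) := by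
  have hmp := WithLp.volume_preserving_toLp (Eucl d) ℝ
  rw [← hmp.lintegral_comp_emb (MeasurableEquiv.toLp 2 (Eucl d × ℝ)).measurableEmbedding]
  exact lintegral_prod _ (hg.comp_quasiMeasurePreserving hmp.quasiMeasurePreserving)

theorem aestronglyMeasurable_comp_toLp {f : SpaceTime d → ℂ} (hf : AEStronglyMeasurable f volume) :
    AEStronglyMeasurable (fun p : Eucl d × ℝ => f (WithLp.toLp 2 p)) (volume.prod volume) :=
  hf.comp_measurePreserving (WithLp.volume_preserving_toLp (Eucl d) ℝ)

theorem energy_spaceTime {μ : SpaceTime d → ℝ} (hμ : Measurable μ) {f : SpaceTime d → ℂ}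
    (hf : AEStronglyMeasurable f volume) : energy volume μ f =
      ∫⁻ x, ∫⁻ η, ENNReal.ofReal (μ (WithLp.toLp 2 (x, η))) ^ 2 *
        ‖f (WithLp.toLp 2 (x, η))‖ₑ ^ 2 :=
  lintegral_spaceTime (g := fun z => ENNReal.ofReal (μ z) ^ 2 * ‖f z‖ₑ ^ 2)
    ((hμ.ennreal_ofReal.pow_const 2).aemeasurable.mul (hf.enorm.pow_const 2))

/-- The moment `∫ (2πiη)^k f(x, η) dη`. -/
def moment (k : ℕ) (f : SpaceTime d → ℂ) (x : Eucl d) : ℂ :=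
  ∫ η : ℝ, f (WithLp.toLp 2 (x, η)) * (2 * Real.pi * Complex.I * η) ^ k

/-- The absolute moment `∫ |2πη|^k |f(x, η)| dη`. -/
def absMoment (k : ℕ) (f : SpaceTime d → ℂ) (x : Eucl d) : ℝ≥0∞ :=
  ∫⁻ η : ℝ, ENNReal.ofReal (|2 * Real.pi * η| ^ k) * ‖f (WithLp.toLp 2 (x, η))‖ₑ

theorem enorm_two_pi_I_mul_pow (η : ℝ) (k : ℕ) :
    ‖(2 * Real.pi * Complex.I * η : ℂ) ^ k‖ₑ = ENNReal.ofReal (|2 * Real.pi * η| ^ k) := by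
  rw [← ofReal_norm, norm_pow]
  simp [abs_mul]

theorem enorm_moment_le (k : ℕ) (f : SpaceTime d → ℂ) (x : Eucl d) :
    ‖moment k f x‖ₑ ≤ absMoment k f x := by
  refine (enorm_integral_le_lintegral_enorm _).trans (le_of_eq ?_)
  refine lintegral_congr fun η => ?_
  rw [enorm_mul, enorm_two_pi_I_mul_pow, mul_comm]

theorem aestronglyMeasurable_moment (k : ℕ) {f : SpaceTime d → ℂ}
    (hf : AEStronglyMeasurable f volume) : AEStronglyMeasurable (moment k f) volume := by
  have : AEStronglyMeasurable (fun p : Eucl d × ℝ =>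
      f (WithLp.toLp 2 p) * (2 * Real.pi * Complex.I * p.2 : ℂ) ^ k) (volume.prod volume) :=
    (aestronglyMeasurable_comp_toLp hf).mul (by fun_prop)
  exact this.integral_prod_right'

/-- Cauchy–Schwarz in `η` with the factors `|2πη|^k / μ` and `μ|f|`. The bound is stated for
absolute moments because these later serve as dominating functions. -/
theorem lintegral_absMoment_le {s : ℝ} {φ : ℝ → ℝ} (hφ : ClassM φ) {k : ℕ} (hs : 2 * k + 1 < s) :
    ∃ C : ℝ≥0, ∀ f : SpaceTime d → ℂ, AEStronglyMeasurable f volume →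
      ∫⁻ x, ENNReal.ofReal (isoIndex d (s - 2 * k - 1) φ x) ^ 2 * absMoment k f x ^ 2 ≤
        C * energy volume (anisoIndex d s φ) f := by
  obtain ⟨C, hC⟩ := lintegral_moment_div_anisoIndex_le (d := d) hφ hs
  refine ⟨C, fun f hf => ?_⟩
  have hA := measurable_anisoIndex (d := d) s hφ
  rw [energy_spaceTime hA hf, ← lintegral_const_mul' _ _ (by finiteness)]
  refine lintegral_mono_ae ?_
  filter_upwards [(aestronglyMeasurable_comp_toLp hf).prodMk_left] with x hx
  have hAx : Measurable fun η : ℝ => anisoIndex d s φ (WithLp.toLp 2 (x, η)) :=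
    hA.comp ((WithLp.prod_continuous_toLp 2 _ _).comp (by fun_prop)).measurable
  have h1 : absMoment k f x = ∫⁻ η, ENNReal.ofReal (|2 * Real.pi * η| ^ k /
      anisoIndex d s φ (WithLp.toLp 2 (x, η))) * (ENNReal.ofReal (anisoIndex d s φ
        (WithLp.toLp 2 (x, η))) * ‖f (WithLp.toLp 2 (x, η))‖ₑ) := by
    refine lintegral_congr fun η => ?_
    have h0 := anisoIndex_pos (s := s) hφ (WithLp.toLp 2 (x, η) : SpaceTime d)
    rw [← mul_assoc, ← ENNReal.ofReal_mul (by positivity), div_mul_cancel₀ _ h0.ne']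
  have h2 := lintegral_mul_sq_le (κ := volume)
    (f := fun η : ℝ => ENNReal.ofReal (|2 * Real.pi * η| ^ k /
      anisoIndex d s φ (WithLp.toLp 2 (x, η))))
    (g := fun η => ENNReal.ofReal (anisoIndex d s φ (WithLp.toLp 2 (x, η))) *
      ‖f (WithLp.toLp 2 (x, η))‖ₑ)
    ((Measurable.div (by fun_prop) hAx).ennreal_ofReal.aemeasurable)
    (hAx.ennreal_ofReal.aemeasurable.mul hx.enorm)
  rw [← h1] at h2
  simp only [mul_pow] at h2
  refine (mul_le_mul_right h2 _).trans ?_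
  rw [← mul_assoc]
  exact mul_le_mul_left (hC x) _

/-- The `k`-th moment in time of `f` represents the Fourier transform of the `k`-th trace of
`𝓕⁻ f`. -/
theorem exists_moment {s : ℝ} {φ : ℝ → ℝ} (hφ : ClassM φ) {k : ℕ} (hs : 2 * k + 1 < s) :
    ∃ C : ℝ≥0, ∀ f : L2 (SpaceTime d), energy volume (anisoIndex d s φ) f < ⊤ →
      ∃ p : L2 (Eucl d), p =ᵐ[volume] moment k f ∧
        energy volume (isoIndex d (s - 2 * k - 1) φ) p ≤ C * energy volume (anisoIndex d s φ) f ∧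
        ∀ (Q : ℕ → ℝ → ℂ) (hQm : ∀ n, MemLp (Q n) 2 volume),
          (∀ n η, ‖Q n η‖ ≤ |2 * Real.pi * η| ^ k) →
          (∀ η, Tendsto (fun n => Q n η) atTop (𝓝 ((2 * Real.pi * Complex.I * η) ^ k))) →
          Tendsto (fun n => average (hQm n) ((boundedComp_toLp le_rfl).op f)) atTop (𝓝 p) := by
  obtain ⟨C, hC⟩ := lintegral_absMoment_le (d := d) hφ hs
  obtain ⟨c, hc0, hc⟩ := exists_le_isoIndex (d := d) (s := s - 2 * k - 1) (by linarith) hφ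
  refine ⟨C, fun f hf => ?_⟩
  have hfm := Lp.aestronglyMeasurable f
  have hCf := hC f hfm
  have hm := aestronglyMeasurable_moment k hfm
  have hle : energy volume (isoIndex d (s - 2 * k - 1) φ) (moment k f) ≤
      C * energy volume (anisoIndex d s φ) f :=
    (lintegral_mono fun x => mul_le_mul_right (pow_le_pow_left' (enorm_moment_le k f x) 2) _).trans
      hCf
  have hfin : C * energy volume (anisoIndex d s φ) f < ⊤ := ENNReal.mul_lt_top (by simp) hf
  have hmem : MemLp (moment k f) 2 volume := memLp_of_energy_lt_top hm hc0 hc (hle.trans_lt hfin)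
  refine ⟨hmem.toLp _, hmem.coeFn_toLp, ?_, fun Q hQm hQ hlim => ?_⟩
  · rwa [energy_congr _ hmem.coeFn_toLp]
  -- Square integrability of the absolute moment makes it finite for almost every `x`, and dominates
  -- the convergence in `x`.
  have hN : ∫⁻ x, absMoment k f x ^ 2 < ⊤ := by
    have h1 : ENNReal.ofReal c ^ 2 * ∫⁻ x, absMoment k f x ^ 2 ≤
        C * energy volume (anisoIndex d s φ) f := by
      rw [← lintegral_const_mul' _ _ (by finiteness)]
      refine (lintegral_mono fun x => ?_).trans hCf
      exact mul_le_mul_left (pow_le_pow_left' (ENNReal.ofReal_le_ofReal (hc x)) 2) _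
    exact ENNReal.lt_top_of_mul_ne_top_right (h1.trans_lt hfin).ne (by positivity)
  have hNm : AEMeasurable (absMoment k (f : SpaceTime d → ℂ)) volume := by
    have : AEMeasurable (fun p : Eucl d × ℝ => ENNReal.ofReal (|2 * Real.pi * p.2| ^ k) *
        ‖f (WithLp.toLp 2 p)‖ₑ) (volume.prod volume) :=
      (by fun_prop : Measurable fun p : Eucl d × ℝ =>
        ENNReal.ofReal (|2 * Real.pi * p.2| ^ k)).aemeasurable.mul
        (aestronglyMeasurable_comp_toLp hfm).enorm
    exact this.lintegral_prod_right'
  rw [Lp.tendsto_Lp_iff_tendsto_eLpNorm']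
  refine tendsto_eLpNorm_of_lintegral ?_
  have hav := fun n => coeFn_average_congr (hQm n) (coeFn_toLp_op le_rfl f)
  have hbd : ∀ n x, ‖(∫ t, f (WithLp.toLp 2 (x, t)) * Q n t) - moment k f x‖ₑ ^ 2 ≤
      4 * absMoment k f x ^ 2 := by
    intro n x
    have h1 : ‖∫ t, f (WithLp.toLp 2 (x, t)) * Q n t‖ₑ ≤ absMoment k f x := by
      refine (enorm_integral_le_lintegral_enorm _).trans (lintegral_mono fun η => ?_)
      rw [enorm_mul, mul_comm, ← ofReal_norm (Q n η)]
      exact mul_le_mul_left (ENNReal.ofReal_le_ofReal (hQ n η)) _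
    calc _ ≤ (absMoment k f x + absMoment k f x) ^ 2 :=
          pow_le_pow_left' (enorm_sub_le.trans (add_le_add h1 (enorm_moment_le k f x))) 2
      _ = _ := by ring
  -- Dominated convergence is used twice: in `η` for fixed `x`, with majorant `|2πη|^k |f|`, and
  -- then in `x`, with majorant `4 · absMoment²`.
  have key : Tendsto (fun n => ∫⁻ x,
      ‖(∫ t, f (WithLp.toLp 2 (x, t)) * Q n t) - moment k f x‖ₑ ^ 2) atTop (𝓝 (∫⁻ x : Eucl d, 0)) := by
    refine tendsto_lintegral_of_dominated_convergence' (fun x => 4 * absMoment k f x ^ 2)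
      (fun n => ?_) (fun n => Eventually.of_forall (hbd n)) ?_ ?_
    · have h1 : AEStronglyMeasurable (fun x => ∫ t, f (WithLp.toLp 2 (x, t)) * Q n t) volume :=
        ((Lp.aestronglyMeasurable _).congr (hav n))
      exact (h1.sub hm).enorm.pow_const 2
    · rw [lintegral_const_mul' _ _ (by finiteness)]
      exact (ENNReal.mul_lt_top (by simp) hN).ne
    · filter_upwards [(aestronglyMeasurable_comp_toLp hfm).prodMk_left,
        ae_lt_top' (hNm.pow_const 2) hN.ne] with x hx hx2
      have hx3 : absMoment k f x < ⊤ := by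
        by_contra hcon
        rw [not_lt_top_iff] at hcon
        simp [hcon] at hx2
      have h1 : Tendsto (fun n => ∫ t, f (WithLp.toLp 2 (x, t)) * Q n t) atTop
          (𝓝 (moment k f x)) := by
        refine tendsto_integral_of_dominated_convergence
          (fun η => |2 * Real.pi * η| ^ k * ‖f (WithLp.toLp 2 (x, η))‖)
          (fun n => hx.mul (hQm n).1) ?_ (fun n => Eventually.of_forall fun η => ?_)
          (Eventually.of_forall fun η => (hlim η).const_mul _)
        · refine ⟨AEStronglyMeasurable.mul (by fun_prop) hx.norm, ?_⟩
          rw [HasFiniteIntegral]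
          refine lt_of_le_of_lt (le_of_eq (lintegral_congr fun η => ?_)) hx3
          rw [enorm_mul, enorm_norm, Real.enorm_of_nonneg (by positivity)]
        · rw [norm_mul, mul_comm]
          exact mul_le_mul_of_nonneg_right (hQ n η) (norm_nonneg _)
      have h2 := (h1.sub_const (moment k f x)).enorm
      rw [sub_self, enorm_zero] at h2
      simpa [Function.comp_def] using ((ENNReal.continuous_pow 2).tendsto _).comp h2
  rw [lintegral_zero] at key
  refine key.congr fun n => lintegral_congr_ae ?_
  filter_upwards [hav n, hmem.coeFn_toLp] with x h1 h2
  rw [h1, h2]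

end Moments

end

end CauchyData

namespace CauchyData

noncomputable section

/-! ### Test kernels concentrating at the initial time -/

section Kernels

variable {τ : ℝ}

/-- Bumps in `(0, τ)` which concentrate at `0`. -/
def initialBump (hτ : 0 < τ) (n : ℕ) : ContDiffBump (τ / (n + 2)) where
  rIn := τ / (n + 2) / 3
  rOut := τ / (n + 2) / 2
  rIn_pos := by positivity
  rIn_lt_rOut := by
    have : 0 < τ / (n + 2) := by positivity
    linarith

/-- Normalized bumps in `(0, τ)` which concentrate at `0`. -/
def initialDensity (hτ : 0 < τ) (n : ℕ) (t : ℝ) : ℝ := (initialBump hτ n).normed volume t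

variable (hτ : 0 < τ)

theorem contDiff_initialDensity (n : ℕ) : ContDiff ℝ ∞ (initialDensity hτ n) :=
  (initialBump hτ n).contDiff_normed

theorem initialDensity_nonneg (n : ℕ) (t : ℝ) : 0 ≤ initialDensity hτ n t :=
  (initialBump hτ n).nonneg_normed t

theorem integral_initialDensity (n : ℕ) : ∫ t, initialDensity hτ n t = 1 :=
  (initialBump hτ n).integral_normed

theorem tsupport_initialDensity_subset (n : ℕ) :
    tsupport (initialDensity hτ n) ⊆ Icc (τ / (n + 2) / 2) (3 * (τ / (n + 2)) / 2) := by
  have h : tsupport (initialDensity hτ n) = Metric.closedBall (τ / (n + 2)) (τ / (n + 2) / 2) :=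
    (initialBump hτ n).tsupport_normed_eq
  rw [h, Real.closedBall_eq_Icc]
  exact Icc_subset_Icc (by linarith) (by linarith)

theorem tsupport_initialDensity_subset_Ioo (n : ℕ) :
    tsupport (initialDensity hτ n) ⊆ Ioo 0 τ := by
  refine (tsupport_initialDensity_subset hτ n).trans fun t ht => ?_
  have h1 : 0 < τ / (n + 2) := by positivity
  -- The shift by `2` keeps the centre at most `τ/2`, so the right end of the support is at most
  -- `3τ/4 < τ`.
  have h2 : τ / (n + 2) ≤ τ / 2 := div_le_div_of_nonneg_left hτ.le (by norm_num) (by linarith [n.cast_nonneg (α := ℝ)])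
  exact ⟨by linarith [ht.1], by linarith [ht.2]⟩

theorem hasCompactSupport_initialDensity (n : ℕ) : HasCompactSupport (initialDensity hτ n) :=
  (initialBump hτ n).hasCompactSupport_normed

theorem integrable_initialDensity (n : ℕ) : Integrable (initialDensity hτ n) :=
  (contDiff_initialDensity hτ n).continuous.integrable_of_hasCompactSupport
    (hasCompactSupport_initialDensity hτ n)

/-- The densities approximate the point mass at `0` from inside the interval, so continuity on `[0,
τ]` suffices and values elsewhere are irrelevant. -/
theorem tendsto_integral_mul_initialDensity {w : ℝ → ℂ} (hw : ContinuousOn w (Icc 0 τ)) :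
    Tendsto (fun n => ∫ t, w t * initialDensity hτ n t) atTop (𝓝 (w 0)) := by
  rw [Metric.tendsto_atTop]
  intro ε hε
  have h0 : (0 : ℝ) ∈ Icc 0 τ := ⟨le_rfl, hτ.le⟩
  obtain ⟨δ, hδ, hδw⟩ := Metric.continuousWithinAt_iff.1 (hw 0 h0) (ε / 2) (half_pos hε)
  have hlim : Tendsto (fun n : ℕ => 3 * (τ / (n + 2)) / 2) atTop (𝓝 0) := by
    have h1 : Tendsto (fun n : ℕ => (n : ℝ) + 2) atTop atTop :=
      tendsto_atTop_add_const_right _ _ tendsto_natCast_atTop_atTop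
    simpa using ((h1.const_div_atTop τ).const_mul 3).div_const 2
  obtain ⟨N, hN⟩ := eventually_atTop.1 (hlim.eventually (gt_mem_nhds hδ))
  refine ⟨N, fun n hn => ?_⟩
  set h := initialDensity hτ n with hh
  have hsupp : ∀ t, t ∉ Ioo 0 τ → h t = 0 := fun t ht => by
    by_contra hne
    exact ht (tsupport_initialDensity_subset_Ioo hτ n (subset_tsupport _ hne))
  have hint : Integrable fun t => w t * h t := by
    rw [← integrableOn_iff_integrable_of_support_subset (s := Icc 0 τ)]
    · exact ContinuousOn.integrableOn_Icc (hw.mul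
        (Complex.continuous_ofReal.comp (contDiff_initialDensity hτ n).continuous).continuousOn)
    · intro t ht
      by_contra hcon
      exact ht (by dsimp only; rw [hsupp t fun h' => hcon (Ioo_subset_Icc_self h')]; simp)
  have hint0 : Integrable fun t => w 0 * (h t : ℂ) :=
    (integrable_initialDensity hτ n).ofReal.const_mul _
  have e : (∫ t, w t * h t) - w 0 = ∫ t, (w t * h t - w 0 * h t) := by
    rw [integral_sub hint hint0, integral_const_mul, integral_complex_ofReal, hh,
      integral_initialDensity]
    simp
  rw [dist_eq_norm, e]
  calc ‖∫ t, (w t * h t - w 0 * h t)‖ ≤ ∫ t, ε / 2 * h t := by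
        refine norm_integral_le_of_norm_le ((integrable_initialDensity hτ n).const_mul _)
          (Eventually.of_forall fun t => ?_)
        by_cases ht : t ∈ tsupport h
        · have h1 := tsupport_initialDensity_subset hτ n ht
          have h2 := tsupport_initialDensity_subset_Ioo hτ n ht
          have h3 := hδw (Ioo_subset_Icc_self h2) (by
            rw [Real.dist_eq, sub_zero, abs_of_pos h2.1]
            exact h1.2.trans_lt (hN n hn))
          rw [← sub_mul, norm_mul, Complex.norm_real, Real.norm_of_nonneg
            (initialDensity_nonneg hτ n t), ← dist_eq_norm]
          exact mul_le_mul_of_nonneg_right h3.le (initialDensity_nonneg hτ n t)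
        · rw [image_eq_zero_of_notMem_tsupport ht]
          simp
    _ = ε / 2 := by rw [integral_const_mul, hh, integral_initialDensity, mul_one]
    _ < ε := by linarith

theorem tsupport_iteratedDeriv_subset {F : Type*} [NormedAddCommGroup F] [NormedSpace ℝ F]
    {f : ℝ → F} (k : ℕ) : tsupport (iteratedDeriv k f) ⊆ tsupport f := by
  induction k with
  | zero => rw [iteratedDeriv_zero]
  | succ k ih =>
    rw [iteratedDeriv_succ]
    exact tsupport_deriv_subset.trans ih

/-- The kernels `(-1)^k ∂^k hₙ`, where `hₙ` are densities concentrating at `0`. -/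
def initialKernel (k n : ℕ) (t : ℝ) : ℂ :=
  (-1) ^ k * iteratedDeriv k (fun t => (initialDensity hτ n t : ℂ)) t

theorem contDiff_ofReal_initialDensity (n : ℕ) :
    ContDiff ℝ ∞ fun t => (initialDensity hτ n t : ℂ) :=
  Complex.ofRealCLM.contDiff.comp (contDiff_initialDensity hτ n)

theorem tsupport_ofReal_initialDensity (n : ℕ) :
    tsupport (fun t => (initialDensity hτ n t : ℂ)) = tsupport (initialDensity hτ n) := by
  unfold tsupport
  congr 1
  ext t
  simp

theorem tsupport_initialKernel_subset (k n : ℕ) : tsupport (initialKernel hτ k n) ⊆ Ioo 0 τ := by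
  refine Subset.trans ?_ (tsupport_initialDensity_subset_Ioo hτ n)
  rw [← tsupport_ofReal_initialDensity]
  refine (closure_mono (Function.support_mul_subset_right _ _)).trans ?_
  exact tsupport_iteratedDeriv_subset k

theorem hasCompactSupport_initialKernel (k n : ℕ) : HasCompactSupport (initialKernel hτ k n) :=
  HasCompactSupport.of_support_subset_isCompact (isCompact_Icc (a := 0) (b := τ))
    ((subset_tsupport _).trans ((tsupport_initialKernel_subset hτ k n).trans Ioo_subset_Icc_self))

theorem contDiff_initialKernel (k n : ℕ) : ContDiff ℝ ∞ (initialKernel hτ k n) := by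
  refine contDiff_const.mul ?_
  rw [iteratedDeriv_eq_iterate]
  exact (contDiff_ofReal_initialDensity hτ n).iterate_deriv k

/-- The kernel as a Schwartz function. -/
def initialSchwartz (k n : ℕ) : 𝓢(ℝ, ℂ) :=
  (hasCompactSupport_initialKernel hτ k n).toSchwartzMap (contDiff_initialKernel hτ k n)

theorem initialSchwartz_apply (k n : ℕ) (t : ℝ) :
    initialSchwartz hτ k n t = initialKernel hτ k n t := rfl

/-- The sign `(-1)^k` in the kernel compensates the sign that the inverse transform gives to a
`k`-th derivative. The remaining factor is the inverse transform of a probability density: it is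
bounded by `1` and tends to `1`, which gives the domination and the limit needed for moments. -/
theorem fourierInv_initialSchwartz (k n : ℕ) (η : ℝ) :
    (𝓕⁻ (initialSchwartz hτ k n) : 𝓢(ℝ, ℂ)) η =
      (2 * Real.pi * Complex.I * η) ^ k *
        ∫ t : ℝ, Complex.exp (2 * Real.pi * (t * η) * Complex.I) * initialDensity hτ n t := by
  have hc : HasCompactSupport fun t => (initialDensity hτ n t : ℂ) := by
    rw [HasCompactSupport, tsupport_ofReal_initialDensity]
    exact hasCompactSupport_initialDensity hτ n
  have hF := Real.fourier_iteratedDeriv (N := ⊤) (n := k) (contDiff_ofReal_initialDensity hτ n)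
    (fun m _ => Continuous.integrable_of_hasCompactSupport
      ((contDiff_ofReal_initialDensity hτ n).continuous_iteratedDeriv m (by exact_mod_cast le_top))
      (hc.mono' ((subset_tsupport _).trans (tsupport_iteratedDeriv_subset m)))) (by exact_mod_cast le_top)
  have h1 : (initialSchwartz hτ k n : ℝ → ℂ) =
      ((-1) ^ k : ℂ) • iteratedDeriv k fun t => (initialDensity hτ n t : ℂ) := rfl
  rw [SchwartzMap.fourierInv_coe, h1, Real.fourierInv_eq_fourier_neg, Real.fourier_eq]
  simp only [Pi.smul_apply]
  simp_rw [smul_comm _ ((-1) ^ k : ℂ)]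
  rw [integral_smul, ← Real.fourier_eq, hF]
  simp only [smul_eq_mul]
  rw [← mul_assoc, ← mul_pow, Real.fourier_eq']
  congr 1
  · push_cast; ring
  · refine integral_congr_ae (Eventually.of_forall fun t => ?_)
    simp only [smul_eq_mul]
    congr 2
    simp
    ring

theorem norm_fourierInv_initialSchwartz_le (k n : ℕ) (η : ℝ) :
    ‖(𝓕⁻ (initialSchwartz hτ k n) : 𝓢(ℝ, ℂ)) η‖ ≤ |2 * Real.pi * η| ^ k := by
  rw [fourierInv_initialSchwartz, norm_mul, norm_pow]
  have h1 : ‖(2 * Real.pi * Complex.I * η : ℂ)‖ = |2 * Real.pi * η| := by simp [abs_mul]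
  rw [h1]
  refine mul_le_of_le_one_right (by positivity) ?_
  rw [← integral_initialDensity hτ n]
  refine norm_integral_le_of_norm_le (integrable_initialDensity hτ n)
    (Eventually.of_forall fun t => ?_)
  rw [norm_mul, Complex.norm_real, Real.norm_of_nonneg (initialDensity_nonneg hτ n t)]
  have : Complex.exp (2 * Real.pi * (t * η) * Complex.I) =
      Complex.exp (((2 * Real.pi * (t * η) : ℝ) : ℂ) * Complex.I) := by push_cast; rfl
  rw [this, Complex.norm_exp_ofReal_mul_I, one_mul]

theorem tendsto_fourierInv_initialSchwartz (k : ℕ) (η : ℝ) :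
    Tendsto (fun n => (𝓕⁻ (initialSchwartz hτ k n) : 𝓢(ℝ, ℂ)) η) atTop
      (𝓝 ((2 * Real.pi * Complex.I * η) ^ k)) := by
  simp only [fourierInv_initialSchwartz]
  have h := tendsto_integral_mul_initialDensity hτ
    (w := fun t : ℝ => Complex.exp (2 * Real.pi * (t * η) * Complex.I)) (by fun_prop)
  simpa using h.const_mul ((2 * Real.pi * Complex.I * η : ℂ) ^ k)

theorem integral_mul_initialSchwartz (k n : ℕ) (F : ℝ → ℂ) :
    ∫ t in Ioo 0 τ, F t * initialSchwartz hτ k n t = ∫ t, F t * initialSchwartz hτ k n t := by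
  refine setIntegral_eq_integral_of_forall_compl_eq_zero fun t ht => ?_
  rw [initialSchwartz_apply]
  rw [image_eq_zero_of_notMem_tsupport fun h => ht (tsupport_initialKernel_subset hτ k n h),
    mul_zero]

end Kernels

end

end CauchyData

namespace CauchyData

noncomputable section

/-! ### Traces of smooth functions of time -/

section SmoothTrace

variable {τ : ℝ}

/-- Repeated integration by parts; all boundary terms vanish as `h` is supported in the open
interval. Since `w` is smooth only up to the endpoints, its derivatives are taken within `[0, τ]`.
-/
theorem integral_mul_iteratedDeriv (hτ : 0 < τ) {h : ℝ → ℂ} (hh : ContDiff ℝ ∞ h)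
    (hsupp : tsupport h ⊆ Ioo 0 τ) (k : ℕ) : ∀ w : ℝ → ℂ, ContDiffOn ℝ ∞ w (Icc 0 τ) →
      ∫ t in 0..τ, w t * iteratedDeriv k h t =
        (-1) ^ k * ∫ t in 0..τ, iteratedDerivWithin k w (Icc 0 τ) t * h t := by
  have hu := uniqueDiffOn_Icc hτ
  have huIcc : uIcc 0 τ = Icc 0 τ := uIcc_of_le hτ.le
  induction k with
  | zero => intro w _; simp
  | succ k ih =>
    intro w hw
    have hw' : ContDiffOn ℝ ∞ (derivWithin w (Icc 0 τ)) (Icc 0 τ) := hw.derivWithin hu (by simp)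
    have hk : ContDiff ℝ ∞ (iteratedDeriv k h) := by
      rw [iteratedDeriv_eq_iterate]
      exact hh.iterate_deriv k
    have hend : ∀ t, t ∉ Ioo 0 τ → iteratedDeriv k h t = 0 := fun t ht =>
      image_eq_zero_of_notMem_tsupport fun h' => ht (hsupp (tsupport_iteratedDeriv_subset k h'))
    rw [iteratedDerivWithin_succ', pow_succ', mul_assoc, ← ih _ hw', neg_one_mul,
      iteratedDeriv_succ]
    rw [intervalIntegral.integral_mul_deriv_eq_deriv_mul_of_hasDerivAt
      (u' := derivWithin w (Icc 0 τ)) (v := iteratedDeriv k h)]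
    · rw [hend 0 (by simp), hend τ (by simp)]
      simp
    · rw [huIcc]; exact hw.continuousOn
    · exact hk.continuous.continuousOn
    · intro t ht
      rw [min_eq_left hτ.le, max_eq_right hτ.le] at ht
      exact ((hw.differentiableOn (by simp) t (Ioo_subset_Icc_self ht)).hasDerivWithinAt).hasDerivAt
        (Icc_mem_nhds ht.1 ht.2)
    · intro t _
      exact (hk.differentiable (by simp) t).hasDerivAt
    · exact ContinuousOn.intervalIntegrable (by rw [huIcc]; exact hw'.continuousOn)
    · exact (hk.continuous_deriv (by simp)).intervalIntegrable _ _

/-- Consistency of the kernels with classical traces: the two signs `(-1)^k` cancel, and the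
densities evaluate the one-sided derivative at `0`. -/
theorem tendsto_integral_mul_initialSchwartz (hτ : 0 < τ) {w : ℝ → ℂ} (hw : ContDiffOn ℝ ∞ w (Icc 0 τ)) (k : ℕ) :
    Tendsto (fun n => ∫ t in Ioo 0 τ, w t * initialSchwartz hτ k n t) atTop
      (𝓝 (iteratedDerivWithin k w (Icc 0 τ) 0)) := by
  have hc : ContinuousOn (iteratedDerivWithin k w (Icc 0 τ)) (Icc 0 τ) :=
    hw.continuousOn_iteratedDerivWithin (by exact_mod_cast le_top) (uniqueDiffOn_Icc hτ)
  refine (tendsto_integral_mul_initialDensity hτ hc).congr fun n => ?_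
  have h1 := integral_mul_iteratedDeriv hτ (contDiff_ofReal_initialDensity hτ n)
    (by rw [tsupport_ofReal_initialDensity]; exact tsupport_initialDensity_subset_Ioo hτ n) k w hw
  rw [intervalIntegral.integral_of_le hτ.le, intervalIntegral.integral_of_le hτ.le,
    integral_Ioc_eq_integral_Ioo, integral_Ioc_eq_integral_Ioo] at h1
  have h2 : ∫ t in Ioo 0 τ, w t * initialSchwartz hτ k n t =
      (-1) ^ k * ∫ t in Ioo 0 τ, w t * iteratedDeriv k (fun t => (initialDensity hτ n t : ℂ)) t := by
    rw [← integral_const_mul]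
    refine integral_congr_ae (Eventually.of_forall fun t => ?_)
    simp only [initialSchwartz_apply, initialKernel]
    ring
  rw [h2, h1, ← mul_assoc, ← mul_pow, neg_one_mul, neg_neg, one_pow, one_mul]
  refine (setIntegral_eq_integral_of_forall_compl_eq_zero fun t ht => ?_).symm
  rw [image_eq_zero_of_notMem_tsupport fun h => ht (tsupport_initialDensity_subset_Ioo hτ n h)]
  simp

end SmoothTrace

/-! ### Functions with prescribed moments -/

theorem iteratedDeriv_ofReal_pow (k l : ℕ) :
    iteratedDeriv l (fun t : ℝ => (t : ℂ) ^ k) =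
      fun t : ℝ => (k.descFactorial l : ℂ) * (t : ℂ) ^ (k - l) := by
  induction l with
  | zero => ext t; simp
  | succ l ih =>
    rw [iteratedDeriv_succ, ih]
    ext t
    have h1 : HasDerivAt (fun t : ℝ => (t : ℂ) ^ (k - l))
        (((k - l : ℕ) : ℂ) * (t : ℂ) ^ (k - l - 1)) t := (hasDerivAt_pow (k - l) (t : ℂ)).comp_ofReal
    rw [(h1.const_mul _).deriv, Nat.descFactorial_succ, ← mul_assoc, Nat.sub_sub]
    push_cast
    ring

theorem iteratedDeriv_monomial_zero (k l : ℕ) :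
    iteratedDeriv l (fun t : ℝ => (t : ℂ) ^ k / (k.factorial : ℂ)) 0 = if l = k then 1 else 0 := by
  have h1 : (fun t : ℝ => (t : ℂ) ^ k / (k.factorial : ℂ)) =
      fun t : ℝ => ((k.factorial : ℂ)⁻¹) * (t : ℂ) ^ k := by ext t; rw [div_eq_inv_mul]
  rw [h1, iteratedDeriv_const_mul_field, iteratedDeriv_ofReal_pow]
  rcases lt_trichotomy l k with h | h | h
  · simp [h.ne, Nat.sub_ne_zero_of_lt h]
  · subst h
    simp [Nat.descFactorial_self, Nat.factorial_ne_zero]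
  · simp [h.ne', Nat.descFactorial_eq_zero_iff_lt.2 h]

/-- The moments of a Fourier transform are the derivatives of the original function at `0`.
Therefore `B k` is the transform of a function that coincides with `t^k / k!` near `0`. -/
theorem exists_schwartz_moments : ∃ B : ℕ → 𝓢(ℝ, ℂ), ∀ k l : ℕ,
    ∫ η : ℝ, (2 * Real.pi * Complex.I * η) ^ l * B k η = if l = k then 1 else 0 := by
  set β : ContDiffBump (0 : ℝ) := ⟨1, 2, one_pos, one_lt_two⟩
  have hβ : ContDiff ℝ ∞ fun t => (β t : ℂ) := Complex.ofRealCLM.contDiff.comp β.contDiff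
  have hb : ∀ k : ℕ, ContDiff ℝ ∞ fun t : ℝ => (β t : ℂ) * ((t : ℂ) ^ k / (k.factorial : ℂ)) :=
    fun k => hβ.mul ((Complex.ofRealCLM.contDiff.pow k).div_const _)
  have hc : ∀ k : ℕ,
      HasCompactSupport fun t : ℝ => (β t : ℂ) * ((t : ℂ) ^ k / (k.factorial : ℂ)) := fun k =>
    HasCompactSupport.mul_right (β.hasCompactSupport.comp_left (g := fun x : ℝ => (x : ℂ)) (by simp))
  set b : ℕ → 𝓢(ℝ, ℂ) := fun k => (hc k).toSchwartzMap (hb k) with hbdef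
  refine ⟨fun k => 𝓕 (b k), fun k l => ?_⟩
  have hcl : HasCompactSupport (iteratedDeriv l (b k)) :=
    (hc k).mono' ((subset_tsupport _).trans (tsupport_iteratedDeriv_subset l))
  have hbl : ContDiff ℝ ∞ (iteratedDeriv l (b k)) := by
    rw [iteratedDeriv_eq_iterate]; exact (hb k).iterate_deriv l
  set w : 𝓢(ℝ, ℂ) := hcl.toSchwartzMap hbl
  have hwF : ∀ η : ℝ, (𝓕 w : 𝓢(ℝ, ℂ)) η =
      (2 * Real.pi * Complex.I * η) ^ l * (𝓕 (b k) : 𝓢(ℝ, ℂ)) η := by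
    intro η
    have hF := Real.fourier_iteratedDeriv (N := ⊤) (n := l) (hb k)
      (fun m _ => Continuous.integrable_of_hasCompactSupport
        ((hb k).continuous_iteratedDeriv m (by exact_mod_cast le_top))
        ((hc k).mono' ((subset_tsupport _).trans (tsupport_iteratedDeriv_subset m))))
      (by exact_mod_cast le_top)
    exact congrFun hF η
  have h1 : ∫ η, (𝓕 w : 𝓢(ℝ, ℂ)) η = w 0 := by
    have h2 : (𝓕⁻ (𝓕 w : 𝓢(ℝ, ℂ)) : 𝓢(ℝ, ℂ)) 0 = w 0 := by
      rw [FourierTransform.fourierInv_fourier_eq]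
    rw [← h2, SchwartzMap.fourierInv_coe, Real.fourierInv_eq]
    simp
  simp only [← hwF, h1]
  have h3 : (fun t : ℝ => (β t : ℂ) * ((t : ℂ) ^ k / (k.factorial : ℂ))) =ᶠ[𝓝 0]
      fun t : ℝ => (t : ℂ) ^ k / (k.factorial : ℂ) := by
    filter_upwards [β.eventuallyEq_one] with t ht
    simp [ht]
  rw [← iteratedDeriv_monomial_zero k l, ← h3.iteratedDeriv_eq l]
  rfl

end

end CauchyData

namespace CauchyData

noncomputable section

/-! ### The right inverse of the trace, on the Fourier side -/

section Extension

variable {d : ℕ}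

/-- The kernel `λ^(-k-1) B(η / λ)` with `λ = 1 + |ξ|²`. -/
def scaleKernel (k : ℕ) (B : 𝓢(ℝ, ℂ)) (z : SpaceTime d) : ℂ :=
  ((bracketSq z.fst ^ (k + 1))⁻¹ : ℝ) * B (z.snd / bracketSq z.fst)

theorem scaleKernel_toLp (k : ℕ) (B : 𝓢(ℝ, ℂ)) (x : Eucl d) (η : ℝ) :
    scaleKernel k B (WithLp.toLp 2 (x, η)) =
      ((bracketSq x ^ (k + 1))⁻¹ : ℝ) * B (η / bracketSq x) := rfl

theorem continuous_scaleKernel (k : ℕ) (B : 𝓢(ℝ, ℂ)) :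
    Continuous (scaleKernel (d := d) k B) := by
  have h1 : Continuous fun z : SpaceTime d => bracketSq z.fst :=
    continuous_bracketSq.comp (fstCLM d).continuous
  have h2 : Continuous fun z : SpaceTime d => z.snd := (sndCLM d).continuous
  refine (Complex.continuous_ofReal.comp ((h1.pow _).inv₀ fun z => ?_)).mul
    (B.continuous.comp (h2.div h1 fun z => (bracketSq_pos _).ne'))
  exact pow_ne_zero _ (bracketSq_pos _).ne'

theorem enorm_scaleKernel_sq (k : ℕ) (B : 𝓢(ℝ, ℂ)) (x : Eucl d) (η : ℝ) :
    ‖scaleKernel k B (WithLp.toLp 2 (x, η))‖ₑ ^ 2 =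
      ENNReal.ofReal ((bracketSq x ^ (k + 1))⁻¹) ^ 2 * ‖B (η / bracketSq x)‖ₑ ^ 2 := by
  have h0 := bracketSq_pos x
  have h1 : ‖(((bracketSq x ^ (k + 1))⁻¹ : ℝ) : ℂ)‖ₑ = ENNReal.ofReal ((bracketSq x ^ (k + 1))⁻¹) := by
    rw [← ofReal_norm, Complex.norm_real, Real.norm_of_nonneg (by positivity)]
  rw [scaleKernel_toLp, enorm_mul, mul_pow, h1]

theorem quasiMeasurePreserving_fst :
    Measure.QuasiMeasurePreserving (fun z : SpaceTime d => z.fst) volume volume :=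
  Measure.quasiMeasurePreserving_fst.comp
    (WithLp.volume_preserving_ofLp (Eucl d) ℝ).quasiMeasurePreserving

theorem energy_scaleKernel_mul {μ : SpaceTime d → ℝ} (hμ : Measurable μ) (k : ℕ) (B : 𝓢(ℝ, ℂ))
    {v : Eucl d → ℂ} (hv : AEStronglyMeasurable v volume) :
    energy volume μ (fun z => scaleKernel k B z * v z.fst) =
      ∫⁻ x, (∫⁻ η, ENNReal.ofReal (μ (WithLp.toLp 2 (x, η))) ^ 2 *
        (ENNReal.ofReal ((bracketSq x ^ (k + 1))⁻¹) ^ 2 * ‖B (η / bracketSq x)‖ₑ ^ 2)) *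
          ‖v x‖ₑ ^ 2 := by
  rw [energy_spaceTime hμ (f := fun z => scaleKernel k B z * v z.fst)
    ((continuous_scaleKernel k B).aestronglyMeasurable.mul
      (hv.comp_quasiMeasurePreserving quasiMeasurePreserving_fst))]
  refine lintegral_congr fun x => ?_
  rw [← lintegral_mul_const' _ _ (by finiteness)]
  refine lintegral_congr fun η => ?_
  rw [mul_assoc, ← enorm_scaleKernel_sq, enorm_mul, mul_pow]
  rfl

/-- For fixed `ξ` the kernel has squared norm `λ^(-2k-1) ‖B‖²` in `η`, and `λ ≥ 1`. So the extension
acts on all of `L₂`, without reference to `s` and `φ`. -/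
theorem memLp_scaleKernel_mul (k : ℕ) (B : 𝓢(ℝ, ℂ)) {v : Eucl d → ℂ} (hv : MemLp v 2 volume) :
    MemLp (fun z : SpaceTime d => scaleKernel k B z * v z.fst) 2 volume := by
  have hm : AEStronglyMeasurable (fun z : SpaceTime d => scaleKernel k B z * v z.fst) volume :=
    (continuous_scaleKernel k B).aestronglyMeasurable.mul
      (hv.1.comp_quasiMeasurePreserving quasiMeasurePreserving_fst)
  refine memLp_of_energy_lt_top hm one_pos (μ := fun _ => 1) (fun _ => le_rfl) ?_
  rw [energy_scaleKernel_mul measurable_const k B hv.1]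
  have hB := lintegral_sq_lt_top (B.memLp 2 volume)
  refine lt_of_le_of_lt (lintegral_mono fun x => ?_)
    (b := ∫⁻ x, (∫⁻ t, ‖B t‖ₑ ^ 2) * ‖v x‖ₑ ^ 2) ?_
  · refine mul_le_mul_left ?_ _
    simp only [ENNReal.ofReal_one, one_pow, one_mul]
    have h0 := bracketSq_pos x
    rw [lintegral_const_mul' _ _ (by finiteness), lintegral_comp_div h0
      (g := fun t => ‖B t‖ₑ ^ 2) (B.continuous.measurable.enorm.pow_const 2), ← mul_assoc]
    refine mul_le_of_le_one_left zero_le ?_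
    rw [← ENNReal.ofReal_pow (by positivity), ← ENNReal.ofReal_mul (by positivity),
      ENNReal.ofReal_le_one]
    have h1 := one_le_bracketSq x
    have h2 : bracketSq x ≤ (bracketSq x ^ (k + 1)) ^ 2 := by
      rw [← pow_mul]
      exact le_self_pow₀ h1 (by omega)
    rw [inv_pow, inv_mul_le_iff₀ (by positivity), mul_one]
    exact h2
  · rw [lintegral_const_mul' _ _ hB.ne]
    exact ENNReal.mul_lt_top hB (lintegral_sq_lt_top hv)

/-- The operator `v ↦ λ^(-k-1) B(η / λ) v(ξ)` on `L₂`. -/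
def scaleOp (k : ℕ) (B : 𝓢(ℝ, ℂ)) : L2 (Eucl d) →ₗ[ℂ] L2 (SpaceTime d) where
  toFun v := (memLp_scaleKernel_mul k B (Lp.memLp v)).toLp _
  map_add' v w := by
    rw [← MemLp.toLp_add]
    refine MemLp.toLp_congr _ _ ?_
    filter_upwards [quasiMeasurePreserving_fst.ae_eq_comp (Lp.coeFn_add v w)] with z hz
    simp only [Function.comp_apply, Pi.add_apply] at hz ⊢
    rw [hz, mul_add]
  map_smul' c v := by
    rw [RingHom.id_apply, ← MemLp.toLp_const_smul]
    refine MemLp.toLp_congr _ _ ?_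
    filter_upwards [quasiMeasurePreserving_fst.ae_eq_comp (Lp.coeFn_smul c v)] with z hz
    simp only [Function.comp_apply, Pi.smul_apply, smul_eq_mul] at hz ⊢
    rw [hz, mul_left_comm]

theorem coeFn_scaleOp (k : ℕ) (B : 𝓢(ℝ, ℂ)) (v : L2 (Eucl d)) :
    scaleOp k B v =ᵐ[volume] fun z => scaleKernel k B z * v z.fst :=
  (memLp_scaleKernel_mul k B (Lp.memLp v)).coeFn_toLp

theorem energy_scaleOp_le {s : ℝ} {φ : ℝ → ℝ} (hφ : ClassM φ) (k : ℕ) (B : 𝓢(ℝ, ℂ)) :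
    ∃ C : ℝ≥0, ∀ v : L2 (Eucl d), energy volume (anisoIndex d s φ) (scaleOp k B v) ≤
      C * energy volume (isoIndex d (s - 2 * k - 1) φ) v := by
  obtain ⟨C, hC⟩ := lintegral_anisoIndex_mul_le (d := d) (s := s) hφ k B
  refine ⟨C, fun v => ?_⟩
  rw [energy_congr _ (coeFn_scaleOp k B v), energy_scaleKernel_mul (measurable_anisoIndex s hφ) k B
    (Lp.aestronglyMeasurable v), energy, ← lintegral_const_mul' _ _ (by finiteness)]
  refine lintegral_mono fun x => ?_
  dsimp only
  rw [← mul_assoc]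
  exact mul_le_mul_left (hC x) _

theorem moment_congr (l : ℕ) {f g : SpaceTime d → ℂ} (h : f =ᵐ[volume] g) :
    moment l f =ᵐ[volume] moment l g := by
  have h1 : (fun p : Eucl d × ℝ => f (WithLp.toLp 2 p)) =ᵐ[volume.prod volume]
      fun p => g (WithLp.toLp 2 p) :=
    (WithLp.volume_preserving_toLp (Eucl d) ℝ).quasiMeasurePreserving.ae_eq_comp h
  filter_upwards [Measure.ae_ae_of_ae_prod h1] with x hx
  exact integral_congr_ae (hx.mono fun η hη => by dsimp only at hη ⊢; rw [hη])

/-- The substitution `η = λt` yields the factor `λ^(l-k)` times the `l`-th moment of `B`. The factor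
is `1` for `l = k`, and otherwise the moment vanishes. -/
theorem moment_scaleOp {k l : ℕ} {B : 𝓢(ℝ, ℂ)}
    (hB : ∫ η : ℝ, (2 * Real.pi * Complex.I * η) ^ l * B η = if l = k then 1 else 0)
    (v : L2 (Eucl d)) : moment l (scaleOp k B v) =ᵐ[volume] if l = k then v else 0 := by
  filter_upwards [moment_congr l (coeFn_scaleOp k B v)] with x hx
  rw [hx]
  have h0 := bracketSq_pos x
  have hne : (bracketSq x : ℂ) ≠ 0 := by exact_mod_cast h0.ne'
  have h1 : moment l (fun z : SpaceTime d => scaleKernel k B z * v z.fst) x =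
      v x * ((bracketSq x : ℂ) ^ (k + 1))⁻¹ * (bracketSq x : ℂ) ^ l *
        ∫ η : ℝ, (fun t : ℝ => (2 * Real.pi * Complex.I * t) ^ l * B t) (η / bracketSq x) := by
    rw [← integral_const_mul]
    refine integral_congr_ae (Eventually.of_forall fun η => ?_)
    change scaleKernel k B (WithLp.toLp 2 (x, η)) * v x * (2 * Real.pi * Complex.I * η : ℂ) ^ l = _
    rw [scaleKernel_toLp]
    push_cast
    have h2 : (2 * Real.pi * Complex.I * η : ℂ) ^ l =
        (bracketSq x : ℂ) ^ l * (2 * Real.pi * Complex.I * (η / bracketSq x)) ^ l := by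
      rw [← mul_pow]
      congr 1
      field_simp
    rw [h2]
    ring
  rw [h1, Measure.integral_comp_div (fun t : ℝ => (2 * Real.pi * Complex.I * t : ℂ) ^ l * B t), hB]
  split_ifs with h
  · subst h
    rw [abs_of_pos h0, Complex.real_smul, mul_one, pow_succ]
    field_simp
  · simp

end Extension

end

end CauchyData

namespace CauchyData

noncomputable section

/-! ### Local charts and the surface measure -/

section Charts

variable {d : ℕ} {Γ : Set (Eucl (d + 1))} {θ : Eucl d → Eucl (d + 1)}

/-- The inverse of a chart, extended by zero. -/
def chartInv (θ : Eucl d → Eucl (d + 1)) : Eucl (d + 1) → Eucl d := Function.extend θ id 0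

namespace IsChart

theorem chartInv_apply (h : IsChart Γ θ) (x : Eucl d) : chartInv θ (θ x) = x :=
  h.embedding.injective.extend_apply _ _ x

/-- A chart has a smooth local left inverse. -/
theorem exists_smooth_leftInverse (h : IsChart Γ θ) (x : Eucl d) :
    ∃ P : Eucl (d + 1) → Eucl d, ContDiffAt ℝ ∞ P (θ x) ∧ ∀ᶠ z in 𝓝 x, P (θ z) = z := by
  obtain ⟨Q₀, hQ₀⟩ := (fderiv ℝ θ x).toLinearMap.exists_leftInverse_of_injective
    (LinearMap.ker_eq_bot.2 (h.immersion x))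
  set Q : Eucl (d + 1) →L[ℝ] Eucl d := LinearMap.toContinuousLinearMap Q₀
  have hQ : Q.comp (fderiv ℝ θ x) = ContinuousLinearMap.id ℝ (Eucl d) := by
    ext1 v
    exact LinearMap.congr_fun hQ₀ v
  -- Composition with a left inverse `Q` of the injective derivative gives a self-map of `ℝ^d` with
  -- identity derivative at `x`. The inverse function theorem applies to it.
  have hc : ContDiffAt ℝ ∞ (fun z => Q (θ z)) x := Q.contDiff.contDiffAt.comp x h.contDiff.contDiffAt
  have hd : HasFDerivAt (fun z => Q (θ z))
      ((ContinuousLinearEquiv.refl ℝ (Eucl d) : Eucl d ≃L[ℝ] Eucl d) : Eucl d →L[ℝ] Eucl d) x := by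
    have h1 := Q.hasFDerivAt.comp x (h.contDiff.differentiable (by simp) x).hasFDerivAt
    rw [hQ] at h1
    exact h1
  have hn : (∞ : WithTop ℕ∞) ≠ 0 := by simp
  refine ⟨fun y => hc.localInverse hd hn (Q y), ?_, ?_⟩
  · exact (hc.to_localInverse hd hn).comp (θ x) Q.contDiff.contDiffAt
  · exact (hc.hasStrictFDerivAt' hd hn).eventually_left_inverse

theorem nhdsWithin_eq (h : IsChart Γ θ) (x : Eucl d) : 𝓝[Γ] (θ x) = map θ (𝓝 x) := by
  rw [h.embedding.map_nhds_eq]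
  obtain ⟨U, hU, hr⟩ := h.open_range
  rw [hr]
  refine (nhdsWithin_inter_of_mem (mem_nhdsWithin_of_mem_nhds (hU.mem_nhds ?_))).symm
  have : θ x ∈ U ∩ Γ := hr ▸ mem_range_self x
  exact this.1

/-- Transition maps between charts are smooth. -/
theorem contDiffAt_transition (h : IsChart Γ θ) {θ' : Eucl d → Eucl (d + 1)} (h' : IsChart Γ θ')
    {x : Eucl d} (hx : θ x ∈ range θ') :
    ContDiffAt ℝ ∞ (fun z => chartInv θ' (θ z)) x ∧ ∀ᶠ z in 𝓝 x, θ z ∈ range θ' := by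
  obtain ⟨x', hx'⟩ := hx
  obtain ⟨P, hP, hPl⟩ := h'.exists_smooth_leftInverse x'
  have ht : Tendsto θ (𝓝 x) (𝓝[Γ] (θ x)) :=
    tendsto_nhdsWithin_iff.2 ⟨h.contDiff.continuous.tendsto x,
      Eventually.of_forall fun z => h.subset (mem_range_self z)⟩
  rw [← hx', h'.nhdsWithin_eq] at ht
  -- The range of `θ'` is open in `Γ`, so all points of `Γ` near `θ x` come from parameters near
  -- `x'`, where the set-theoretic inverse agrees with the smooth map `P`.
  have h1 : ∀ᶠ y in map θ' (𝓝 x'), y ∈ range θ' ∧ chartInv θ' y = P y := by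
    rw [eventually_map]
    filter_upwards [hPl] with z hz
    exact ⟨mem_range_self z, by rw [h'.chartInv_apply, hz]⟩
  have h2 := ht.eventually h1
  refine ⟨?_, h2.mono fun z hz => hz.1⟩
  rw [hx'] at hP
  exact (hP.comp x h.contDiff.contDiffAt).congr_of_eventuallyEq (h2.mono fun z hz => hz.2)

end IsChart

theorem euclideanHausdorffMeasure_image_le {X Y : Type*} [MetricSpace X] [MeasurableSpace X]
    [BorelSpace X] [MetricSpace Y] [MeasurableSpace Y] [BorelSpace Y] {K : ℝ≥0} {f : X → Y}
    {s : Set X} (h : LipschitzOnWith K f s) (d : ℕ) :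
    (Measure.euclideanHausdorffMeasure d : Measure Y) (f '' s) ≤
      (K ^ d : ℝ≥0) * (Measure.euclideanHausdorffMeasure d : Measure X) s := by
  have h1 := h.hausdorffMeasure_image_le (d := d) (by positivity)
  rw [Measure.euclideanHausdorffMeasure_def, Measure.euclideanHausdorffMeasure_def,
    Measure.smul_apply, Measure.smul_apply, ENNReal.smul_def, ENNReal.smul_def, smul_eq_mul,
    smul_eq_mul, mul_left_comm]
  refine mul_le_mul_right ?_ _
  rw [ENNReal.rpow_natCast] at h1
  exact_mod_cast h1

namespace IsChart

theorem measurableEmbedding (h : IsChart Γ θ) (hΓ : IsClosed Γ) : MeasurableEmbedding θ := by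
  refine h.embedding.measurableEmbedding ?_
  obtain ⟨U, hU, hr⟩ := h.open_range
  rw [hr]
  exact hU.measurableSet.inter hΓ.measurableSet

theorem measurable_chartInv (h : IsChart Γ θ) (hΓ : IsClosed Γ) : Measurable (chartInv θ) :=
  (h.measurableEmbedding hΓ).measurable_extend measurable_id measurable_const

/-- Charts do not decrease the surface measure by more than a factor, on compact sets. -/
theorem exists_map_le (h : IsChart Γ θ) {K : Set (Eucl d)} (hK : IsCompact K) :
    ∃ C : ℝ≥0, (volume.restrict K).map θ ≤ (C : ℝ≥0∞) • surfaceMeasure Γ := by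
  have hm : Measurable θ := h.contDiff.continuous.measurable
  refine hK.induction_on (p := fun K => ∃ C : ℝ≥0,
    (volume.restrict K).map θ ≤ (C : ℝ≥0∞) • surfaceMeasure Γ) ⟨0, by simp⟩ ?_ ?_ ?_
  · rintro s t hst ⟨C, hC⟩
    exact ⟨C, (Measure.map_mono (Measure.restrict_mono hst le_rfl) hm).trans hC⟩
  · rintro s t ⟨C, hC⟩ ⟨C', hC'⟩
    refine ⟨C + C', (Measure.map_mono (Measure.restrict_union_le s t) hm).trans ?_⟩
    rw [Measure.map_add _ _ hm, ENNReal.coe_add, add_smul]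
    exact add_le_add hC hC'
  · intro x _
    -- Compactness has reduced the claim to a neighbourhood of `x`. There `P` is Lipschitz and
    -- carries images under `θ` back, so the volume of a set is at most `C^d` times the Hausdorff
    -- measure of its image.
    obtain ⟨P, hP, hPl⟩ := h.exists_smooth_leftInverse x
    obtain ⟨C, V, hV, hL⟩ := (hP.of_le (by simp : (1 : WithTop ℕ∞) ≤ ((⊤ : ℕ∞) : WithTop ℕ∞))).exists_lipschitzOnWith
    have hW : {z | P (θ z) = z} ∩ θ ⁻¹' V ∈ 𝓝 x :=
      inter_mem hPl (h.contDiff.continuous.continuousAt hV)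
    refine ⟨_, mem_nhdsWithin_of_mem_nhds hW, C ^ d, Measure.le_iff.2 fun s hs => ?_⟩
    rw [Measure.map_apply hm hs, Measure.restrict_apply (hm hs), Measure.smul_apply, smul_eq_mul,
      surfaceMeasure, Measure.restrict_apply hs, ← EuclideanSpace.euclideanHausdorffMeasure_eq_volume]
    have hL' : LipschitzOnWith C P (V ∩ (s ∩ Γ)) := hL.mono inter_subset_left
    refine (measure_mono ?_).trans ((euclideanHausdorffMeasure_image_le hL' d).trans
      (mul_le_mul_right (measure_mono inter_subset_right) _))
    rintro z ⟨hz1, hz2, hz3⟩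
    exact ⟨θ z, ⟨hz3, hz1, h.subset (mem_range_self z)⟩, hz2⟩

/-- Charts do not increase the surface measure by more than a factor, on compact sets. -/
theorem exists_map_chartInv_le (h : IsChart Γ θ) (hΓ : IsClosed Γ) {K : Set (Eucl d)}
    (hK : IsCompact K) : ∃ C : ℝ≥0,
      ((surfaceMeasure Γ).restrict (θ '' K)).map (chartInv θ) ≤ (C : ℝ≥0∞) • volume := by
  have hm : Measurable (chartInv θ) := h.measurable_chartInv hΓ
  refine hK.induction_on (p := fun K => ∃ C : ℝ≥0,
    ((surfaceMeasure Γ).restrict (θ '' K)).map (chartInv θ) ≤ (C : ℝ≥0∞) • volume)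
    ⟨0, by simp⟩ ?_ ?_ ?_
  · rintro s t hst ⟨C, hC⟩
    exact ⟨C, (Measure.map_mono (Measure.restrict_mono (image_mono hst) le_rfl) hm).trans hC⟩
  · rintro s t ⟨C, hC⟩ ⟨C', hC'⟩
    rw [image_union]
    refine ⟨C + C', (Measure.map_mono (Measure.restrict_union_le _ _) hm).trans ?_⟩
    rw [Measure.map_add _ _ hm, ENNReal.coe_add, add_smul]
    exact add_le_add hC hC'
  · intro x _
    -- For the opposite inequality the Lipschitz map is the chart itself.
    obtain ⟨C, V, hV, hL⟩ := (h.contDiff.contDiffAt.of_le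
      (by simp : (1 : WithTop ℕ∞) ≤ ((⊤ : ℕ∞) : WithTop ℕ∞))).exists_lipschitzOnWith (x := x)
    refine ⟨V, mem_nhdsWithin_of_mem_nhds hV, C ^ d, Measure.le_iff.2 fun s hs => ?_⟩
    rw [Measure.map_apply hm hs, Measure.restrict_apply (hm hs), Measure.smul_apply, smul_eq_mul,
      surfaceMeasure, Measure.restrict_apply' hΓ.measurableSet,
      ← EuclideanSpace.euclideanHausdorffMeasure_eq_volume]
    have hL' : LipschitzOnWith C θ (V ∩ s) := hL.mono inter_subset_left
    refine (measure_mono ?_).trans ((euclideanHausdorffMeasure_image_le hL' d).trans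
      (mul_le_mul_right (measure_mono inter_subset_right) _))
    rintro _ ⟨⟨hz1, z, hz2, rfl⟩, -⟩
    rw [mem_preimage, h.chartInv_apply] at hz1
    exact ⟨z, ⟨hz2, hz1⟩, rfl⟩

theorem surfaceMeasure_image_lt_top (h : IsChart Γ θ) (hΓ : IsClosed Γ) {K : Set (Eucl d)}
    (hK : IsCompact K) : surfaceMeasure Γ (θ '' K) < ⊤ := by
  obtain ⟨C, hC⟩ := h.exists_map_chartInv_le hΓ hK
  have hm := h.measurable_chartInv hΓ
  calc surfaceMeasure Γ (θ '' K)
      ≤ (((surfaceMeasure Γ).restrict (θ '' K)).map (chartInv θ)) K := by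
        rw [Measure.map_apply hm hK.measurableSet, Measure.restrict_apply (hm hK.measurableSet)]
        refine measure_mono ?_
        rintro _ ⟨z, hz, rfl⟩
        exact ⟨by rwa [mem_preimage, h.chartInv_apply], z, hz, rfl⟩
    _ ≤ C * volume K := hC K
    _ < ⊤ := ENNReal.mul_lt_top (by simp) hK.measure_lt_top

/-- Pulling functions back by a chart is bounded on `L₂`. -/
theorem boundedComp_pull (h : IsChart Γ θ) {a : Eucl d → ℂ} (ha : Continuous a)
    (hc : HasCompactSupport a) : BoundedComp a θ volume (surfaceMeasure Γ) where
  measurable_weight := ha.measurable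
  measurable_map := h.contDiff.continuous.measurable
  bounded := by
    obtain ⟨B, hB⟩ := hc.exists_bound_of_continuous ha
    refine ⟨B.toNNReal, fun y => ?_⟩
    rw [← ofReal_norm]
    exact ENNReal.ofReal_le_ofReal (hB y)
  map_le := by
    obtain ⟨C, hC⟩ := h.exists_map_le hc
    exact ⟨C, (Measure.map_mono (Measure.restrict_mono (subset_tsupport a) le_rfl)
      h.contDiff.continuous.measurable).trans hC⟩

/-- Pushing functions forward by a chart is bounded on `L₂`. -/
theorem boundedComp_push (h : IsChart Γ θ) (hΓ : IsClosed Γ) {a : Eucl d → ℂ} (ha : Continuous a)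
    (hc : HasCompactSupport a) :
    BoundedComp (Function.extend θ a 0) (chartInv θ) (surfaceMeasure Γ) volume where
  measurable_weight := (h.measurableEmbedding hΓ).measurable_extend ha.measurable measurable_const
  measurable_map := h.measurable_chartInv hΓ
  bounded := by
    obtain ⟨B, hB⟩ := hc.exists_bound_of_continuous ha
    refine ⟨B.toNNReal, fun y => ?_⟩
    by_cases hy : ∃ x, θ x = y
    · obtain ⟨x, rfl⟩ := hy
      rw [h.embedding.injective.extend_apply, ← ofReal_norm]
      exact ENNReal.ofReal_le_ofReal (hB x)
    · rw [Function.extend_apply' _ _ _ hy]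
      simp
  map_le := by
    obtain ⟨C, hC⟩ := h.exists_map_chartInv_le hΓ hc
    refine ⟨C, (Measure.map_mono (Measure.restrict_mono ?_ le_rfl)
      (h.measurable_chartInv hΓ)).trans hC⟩
    intro y (hy : Function.extend θ a 0 y ≠ 0)
    by_cases hy' : ∃ x, θ x = y
    · obtain ⟨x, rfl⟩ := hy'
      rw [h.embedding.injective.extend_apply] at hy
      exact ⟨x, subset_tsupport _ hy, rfl⟩
    · rw [Function.extend_apply' _ _ _ hy'] at hy
      exact absurd rfl hy

end IsChart

end Charts

end

end CauchyData

namespace CauchyData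

noncomputable section

/-! ### Cutoff functions and transitions between charts -/

section Transition

theorem exists_smooth_cutoff {E : Type*} [NormedAddCommGroup E] [NormedSpace ℝ E]
    [FiniteDimensional ℝ E] {K U : Set E} (hK : IsCompact K) (hU : IsOpen U) (hKU : K ⊆ U) :
    ∃ κ : E → ℝ, ContDiff ℝ ∞ κ ∧ HasCompactSupport κ ∧ tsupport κ ⊆ U ∧ ∀ x ∈ K, κ x = 1 := by
  obtain ⟨L, hL, hKL, hLU⟩ := exists_compact_between hK hU hKU
  obtain ⟨f, hf0, hf1, -⟩ := exists_contMDiffMap_zero_one_of_isClosed (n := ⊤) (modelWithCornersSelf ℝ E)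
    (isOpen_interior (s := L)).isClosed_compl hK.isClosed
    (disjoint_left.2 fun x hx hx' => hx (hKL hx'))
  have hs : tsupport f ⊆ L := by
    refine closure_minimal (fun x hx => ?_) hL.isClosed
    by_contra hcon
    exact hx (hf0 fun h => hcon (interior_subset h))
  exact ⟨f, f.contMDiff.contDiff, hL.of_isClosed_subset isClosed_closure hs, hs.trans hLU,
    fun x hx => hf1 hx⟩

theorem exists_complex_cutoff {E : Type*} [NormedAddCommGroup E] [NormedSpace ℝ E]
    [FiniteDimensional ℝ E] {K : Set E} (hK : IsCompact K) :
    ∃ κ : E → ℂ, ContDiff ℝ ∞ κ ∧ HasCompactSupport κ ∧ ∀ x ∈ K, κ x = 1 := by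
  obtain ⟨κ, h1, h2, -, h3⟩ := exists_smooth_cutoff hK isOpen_univ (subset_univ K)
  exact ⟨fun x => κ x, Complex.ofRealCLM.contDiff.comp h1,
    h2.comp_left (g := fun x : ℝ => (x : ℂ)) (by simp), fun x hx => by simp [h3 x hx]⟩

/-- The map may be changed where the weight vanishes. This allows a transition map defined only on
an overlap to be replaced by a globally smooth one. -/
theorem BoundedComp.congr_map {X Y : Type*} [MeasurableSpace X] [MeasurableSpace Y] {a : Y → ℂ}
    {ρ ρ' : Y → X} {ν : Measure Y} {μ : Measure X} (h : BoundedComp a ρ ν μ)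
    (hρ' : Measurable ρ') (heq : ∀ y, a y ≠ 0 → ρ y = ρ' y) : BoundedComp a ρ' ν μ where
  measurable_weight := h.measurable_weight
  measurable_map := hρ'
  bounded := h.bounded
  map_le := by
    obtain ⟨C, hC⟩ := h.map_le
    refine ⟨C, le_trans (le_of_eq (Measure.map_congr ?_)) hC⟩
    rw [EventuallyEq, ae_restrict_iff' h.measurableSet_ne]
    exact Eventually.of_forall fun y (hy : a y ≠ 0) => (heq y hy).symm

variable {d : ℕ} {Γ : Set (Eucl (d + 1))} {θ θ' : Eucl d → Eucl (d + 1)}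

theorem IsChart.isClosed_preimage_image (h : IsChart Γ θ) (h' : IsChart Γ θ') {K : Set (Eucl d)}
    (hK : IsCompact K) : IsClosed (θ ⁻¹' (θ' '' K)) :=
  (hK.image h'.contDiff.continuous).isClosed.preimage h.contDiff.continuous

theorem IsChart.extend_ne_zero (h' : IsChart Γ θ') {e : Eucl d → ℂ} {y : Eucl (d + 1)}
    (hy : Function.extend θ' e 0 y ≠ 0) : y ∈ θ' '' tsupport e := by
  by_cases hy' : ∃ x, θ' x = y
  · obtain ⟨x, rfl⟩ := hy'
    rw [h'.embedding.injective.extend_apply] at hy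
    exact ⟨x, subset_tsupport _ hy, rfl⟩
  · rw [Function.extend_apply' _ _ _ hy'] at hy
    exact absurd rfl hy

/-- A compactly supported smooth function pushed forward by one chart is smooth in another one. -/
theorem IsChart.contDiff_push (h : IsChart Γ θ) (h' : IsChart Γ θ') {e : Eucl d → ℂ}
    (he : ContDiff ℝ ∞ e) (hc : HasCompactSupport e) {F : Eucl d × ℝ → ℂ} (hF : ContDiff ℝ ∞ F) :
    ContDiff ℝ ∞ fun p : Eucl d × ℝ =>
      Function.extend θ' e 0 (θ p.1) * F (chartInv θ' (θ p.1), p.2) := by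
  rw [contDiff_iff_contDiffAt]
  intro p
  by_cases hp : θ p.1 ∈ range θ'
  · obtain ⟨h1, h2⟩ := h.contDiffAt_transition h' hp
    have h3 : ContDiffAt ℝ ∞ (fun p : Eucl d × ℝ => chartInv θ' (θ p.1)) p :=
      h1.comp p contDiff_fst.contDiffAt
    have h4 : ContDiffAt ℝ ∞ (fun p : Eucl d × ℝ =>
        e (chartInv θ' (θ p.1)) * F (chartInv θ' (θ p.1), p.2)) p :=
      (he.contDiffAt.comp p h3).mul (hF.contDiffAt.comp p (h3.prodMk contDiff_snd.contDiffAt))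
    refine h4.congr_of_eventuallyEq ?_
    filter_upwards [continuous_fst.continuousAt.eventually h2] with q hq
    obtain ⟨z, hz⟩ := hq
    rw [← hz, h'.embedding.injective.extend_apply, h'.chartInv_apply]
  -- Off the overlap the pushed function vanishes in a whole neighbourhood, because the image of the
  -- compact support of `e` is closed.
  · have hcl := h.isClosed_preimage_image h' hc
    have hp' : p.1 ∈ (θ ⁻¹' (θ' '' tsupport e))ᶜ := fun ⟨z, _, hz⟩ => hp ⟨z, hz⟩
    refine (contDiffAt_const (c := 0)).congr_of_eventuallyEq ?_
    filter_upwards [continuous_fst.continuousAt.eventually (hcl.isOpen_compl.mem_nhds hp')]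
      with q hq
    have : Function.extend θ' e 0 (θ q.1) = 0 := by
      by_contra hne
      exact hq (h'.extend_ne_zero hne)
    rw [this, zero_mul]

/-- The composition of a push-forward by one chart and a pull-back by another one is a change of
variables by a compact perturbation of the identity. -/
theorem IsChart.exists_transition (h : IsChart Γ θ) (h' : IsChart Γ θ') (hΓ : IsClosed Γ)
    {a e : Eucl d → ℂ} (ha : ContDiff ℝ ∞ a) (hac : HasCompactSupport a) (he : ContDiff ℝ ∞ e)
    (hec : HasCompactSupport e) :
    ∃ (M : Set (Eucl d)) (α : Eucl d → Eucl d), IsCompactPerturbation α ∧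
      BoundedComp (M.indicator 1) α volume volume ∧
      IsCoefficient M (fun x => a x * Function.extend θ' e 0 (θ x)) ∧
      ∀ x, a x * Function.extend θ' e 0 (θ x) ≠ 0 → chartInv θ' (θ x) = α x := by
  -- The set `M` carries the product of the two coefficients; it is compact and lies in the open
  -- overlap `Ω`.
  set M := tsupport a ∩ θ ⁻¹' (θ' '' tsupport e) with hM
  have hMc : IsCompact M := hac.inter_right (h.isClosed_preimage_image h' hec)
  set Ω := θ ⁻¹' range θ' with hΩ
  have hΩo : IsOpen Ω := isOpen_iff_mem_nhds.2 fun x hx => (h.contDiffAt_transition h' hx).2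
  have hMΩ : M ⊆ Ω := fun x hx => image_subset_range _ _ hx.2
  obtain ⟨κ, hκ, hκc, hκΩ, hκ1⟩ := exists_smooth_cutoff hMc hΩo hMΩ
  -- The cutoff `κ` blends the transition map into the identity. The result agrees with the
  -- transition map on `M`, and nothing else about it matters: away from `M` it need not be
  -- injective.
  set α : Eucl d → Eucl d := fun x => x + κ x • (chartInv θ' (θ x) - x) with hα
  have hαM : ∀ x ∈ M, chartInv θ' (θ x) = α x := fun x hx => by simp [hα, hκ1 x hx]
  have hαs : ContDiff ℝ ∞ α := by
    rw [contDiff_iff_contDiffAt]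
    intro x
    by_cases hx : x ∈ tsupport κ
    · have h1 := (h.contDiffAt_transition h' (hκΩ hx)).1
      exact contDiffAt_id.add (hκ.contDiffAt.smul (h1.sub contDiffAt_id))
    · refine contDiffAt_id.congr_of_eventuallyEq ?_
      filter_upwards [(isClosed_tsupport κ).isOpen_compl.mem_nhds hx] with z hz
      simp [hα, image_eq_zero_of_notMem_tsupport hz]
  have hMne : ∀ x, a x * Function.extend θ' e 0 (θ x) ≠ 0 → x ∈ M := fun x hx =>
    ⟨subset_tsupport _ (left_ne_zero_of_mul hx), h'.extend_ne_zero (right_ne_zero_of_mul hx)⟩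
  refine ⟨M, α, ⟨hαs, ?_⟩, ?_, ⟨?_, ?_, ?_⟩, fun x hx => hαM x (hMne x hx)⟩
  · refine HasCompactSupport.of_support_subset_isCompact hκc fun x hx => ?_
    by_contra hcon
    refine hx ?_
    simp [hα, image_eq_zero_of_notMem_tsupport hcon]
  -- The measure bound over `M` is obtained through the surface, by composing the pull-back with the
  -- push-forward, with cutoffs equal to one at the points that `M` involves.
  · obtain ⟨u, hu, huc, hu1⟩ := exists_complex_cutoff hMc
    obtain ⟨w, hw, hwc, hw1⟩ := exists_complex_cutoff hec.isCompact
    have h1 : BoundedComp (M.indicator 1) θ volume (surfaceMeasure Γ) := by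
      refine (h.boundedComp_pull hu.continuous huc).mono_weight
        (measurable_one.indicator hMc.measurableSet) ⟨1, fun y => ?_⟩ fun y hy => ?_
      · by_cases hy : y ∈ M <;> simp [hy]
      · refine indicator_of_notMem (fun hyM => ?_) _
        rw [hu1 y hyM] at hy
        exact one_ne_zero hy
    have h2 := h1.comp (h'.boundedComp_push hΓ hw.continuous hwc)
    have h3 : (fun y => M.indicator (1 : Eucl d → ℂ) y * Function.extend θ' w 0 (θ y)) =
        M.indicator 1 := by
      ext y
      by_cases hy : y ∈ M
      · obtain ⟨z, hz, hz'⟩ := hy.2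
        rw [← hz', h'.embedding.injective.extend_apply, hw1 z hz, mul_one]
      · rw [indicator_of_notMem hy, zero_mul]
    rw [h3] at h2
    exact h2.congr_map hαs.continuous.measurable fun y hy =>
      hαM y (mem_of_indicator_ne_zero hy)
  · have h1 := h.contDiff_push h' he hec (F := fun _ => 1) contDiff_const
    simp only [mul_one] at h1
    exact ha.mul (h1.comp (contDiff_id.prodMk (contDiff_const (c := (0 : ℝ)))))
  · exact hac.mul_right
  · exact closure_minimal hMne hMc.isClosed

end Transition

end

end CauchyData

namespace CauchyData

noncomputable section

/-! ### Extension by reflections from a closed strip -/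

section Reflection

variable {E : Type*} [NormedAddCommGroup E] [NormedSpace ℝ E] {m : ℕ}

/-- The reflection about `t₀` with the scale `b`. -/
def refl (b t₀ t : ℝ) : ℝ := t₀ - b * (t - t₀)

theorem refl_self (b t₀ : ℝ) : refl b t₀ t₀ = t₀ := by simp [refl]

/-- A combination of reflections of `u` about the time `t₀`. -/
def reflSum (b c : Fin m → ℝ) (t₀ : ℝ) (u : E × ℝ → ℂ) (p : E × ℝ) : ℂ :=
  ∑ l, c l • u (p.1, refl (b l) t₀ p.2)

/-- The extension of `u` from the strip `0 ≤ t ≤ τ` by reflections. -/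
def reflExt (b c : Fin m → ℝ) (τ : ℝ) (u : E × ℝ → ℂ) (p : E × ℝ) : ℂ :=
  if p.2 < 0 then reflSum b c 0 u p else if p.2 ≤ τ then u p else reflSum b c τ u p

/-- The linear part of a reflection. -/
def reflCLM (b : ℝ) : E × ℝ →L[ℝ] E × ℝ :=
  (ContinuousLinearMap.id ℝ E).prodMap ((-b) • ContinuousLinearMap.id ℝ ℝ)

/-- The derivative of `reflSum`. -/
def reflSumDeriv (b c : Fin m → ℝ) (t₀ : ℝ) (u' : E × ℝ → E × ℝ →L[ℝ] ℂ) (p : E × ℝ) :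
    E × ℝ →L[ℝ] ℂ :=
  ∑ l, c l • (u' (p.1, refl (b l) t₀ p.2)).comp (reflCLM (b l))

/-- The derivative of `reflExt`. -/
def reflExtDeriv (b c : Fin m → ℝ) (τ : ℝ) (u' : E × ℝ → E × ℝ →L[ℝ] ℂ) (p : E × ℝ) :
    E × ℝ →L[ℝ] ℂ :=
  if p.2 < 0 then reflSumDeriv b c 0 u' p
    else if p.2 ≤ τ then u' p else reflSumDeriv b c τ u' p

variable {b c : Fin m → ℝ} {τ : ℝ} {u : E × ℝ → ℂ} {u' : E × ℝ → E × ℝ →L[ℝ] ℂ}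

theorem reflSum_of_eq (h0 : ∑ l, c l = 1) (t₀ : ℝ) {p : E × ℝ} (hp : p.2 = t₀) :
    reflSum b c t₀ u p = u p := by
  obtain ⟨x, t⟩ := p
  subst hp
  simp only [reflSum, refl_self, ← Finset.sum_smul, h0, one_smul]

theorem clm_apply_eq (L : E × ℝ →L[ℝ] ℂ) (v : E) (w : ℝ) :
    L (v, w) = L (v, 0) + (w : ℂ) * L (0, 1) := by
  have : ((v, w) : E × ℝ) = (v, 0) + w • ((0, 1) : E × ℝ) := by simp
  rw [this, map_add, map_smul, Complex.real_smul]

theorem reflCLM_apply (b : ℝ) (v : E) (w : ℝ) : reflCLM b (v, w) = (v, -b * w) := by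
  simp [reflCLM]

theorem reflSumDeriv_apply (t₀ : ℝ) (p : E × ℝ) (v : E) (w : ℝ) :
    reflSumDeriv b c t₀ u' p (v, w) = reflSum b c t₀ (fun q => u' q (v, 0)) p +
      (w : ℂ) * reflSum b (fun l => c l * -b l) t₀ (fun q => u' q (0, 1)) p := by
  simp only [reflSumDeriv, reflSum, sum_apply, smul_apply,
    ContinuousLinearMap.comp_apply, reflCLM_apply, Finset.mul_sum, ← Finset.sum_add_distrib]
  refine Finset.sum_congr rfl fun l _ => ?_
  rw [clm_apply_eq]
  simp only [Complex.real_smul]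
  push_cast
  ring

/-- The condition of order zero matches the spatial derivatives on the plane `t = t₀`. The condition
of order one matches the time derivative, since each reflection multiplies it by `-b l`. -/
theorem reflSumDeriv_of_eq (h0 : ∑ l, c l = 1) (h1 : ∑ l, c l * -b l = 1) (t₀ : ℝ) {p : E × ℝ}
    (hp : p.2 = t₀) : reflSumDeriv b c t₀ u' p = u' p := by
  refine ContinuousLinearMap.ext fun ⟨v, w⟩ => ?_
  rw [reflSumDeriv_apply, reflSum_of_eq h0 t₀ hp, reflSum_of_eq h1 t₀ hp, ← clm_apply_eq]

theorem reflExtDeriv_apply (p : E × ℝ) (v : E) (w : ℝ) :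
    reflExtDeriv b c τ u' p (v, w) = reflExt b c τ (fun q => u' q (v, 0)) p +
      (w : ℂ) * reflExt b (fun l => c l * -b l) τ (fun q => u' q (0, 1)) p := by
  simp only [reflExtDeriv, reflExt]
  split_ifs
  · exact reflSumDeriv_apply _ _ _ _
  · exact clm_apply_eq _ _ _
  · exact reflSumDeriv_apply _ _ _ _

theorem hasFDerivWithinAt_reflSum {t₀ : ℝ} {J : Set ℝ}
    (hJ : ∀ l, MapsTo (refl (b l) t₀) J (Icc 0 τ))
    (hu : ∀ p ∈ (univ : Set E) ×ˢ Icc 0 τ, HasFDerivWithinAt u (u' p) (univ ×ˢ Icc 0 τ) p)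
    {p : E × ℝ} (hp : p.2 ∈ J) :
    HasFDerivWithinAt (reflSum b c t₀ u) (reflSumDeriv b c t₀ u' p) (univ ×ˢ J) p := by
  have key : ∀ l, HasFDerivWithinAt (fun q : E × ℝ => u (q.1, refl (b l) t₀ q.2))
      ((u' (p.1, refl (b l) t₀ p.2)).comp (reflCLM (b l))) (univ ×ˢ J) p := by
    intro l
    have h1 : HasFDerivWithinAt (fun q : E × ℝ => (q.1, refl (b l) t₀ q.2)) (reflCLM (b l))
        (univ ×ˢ J) p := by
      have h2 : (fun q : E × ℝ => (q.1, refl (b l) t₀ q.2)) =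
          fun q => reflCLM (b l) q + (0, t₀ + b l * t₀) := by
        ext q
        · simp [reflCLM]
        · simp [reflCLM, refl]; ring
      rw [h2]
      exact (((reflCLM (b l) : E × ℝ →L[ℝ] E × ℝ).hasFDerivAt (x := p)).add_const _).hasFDerivWithinAt
    exact HasFDerivWithinAt.comp (t := univ ×ˢ Icc 0 τ) p
      (hu (p.1, refl (b l) t₀ p.2) ⟨mem_univ _, hJ l hp⟩) h1
      fun q hq => (⟨mem_univ _, hJ l hq.2⟩ : (q.1, refl (b l) t₀ q.2) ∈ univ ×ˢ Icc 0 τ)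
  exact HasFDerivWithinAt.fun_sum fun l _ => (key l).const_smul (c l)

/-- On three closed slabs the extension is differentiable from within, and the derivatives agree on
the common faces, so they combine to a full derivative. The bound `b l ≤ 1` keeps the reflections of
`[-τ, 0]` and `[τ, 2τ]` inside `[0, τ]`. -/
theorem hasFDerivAt_reflExt (hτ : 0 < τ) (hb : ∀ l, 0 < b l ∧ b l ≤ 1) (h0 : ∑ l, c l = 1)
    (h1 : ∑ l, c l * -b l = 1)
    (hu : ∀ p ∈ (univ : Set E) ×ˢ Icc 0 τ, HasFDerivWithinAt u (u' p) (univ ×ˢ Icc 0 τ) p)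
    {p : E × ℝ} (hp : p.2 ∈ Ioo (-τ) (2 * τ)) :
    HasFDerivAt (reflExt b c τ u) (reflExtDeriv b c τ u' p) p := by
  have hJ₁ : ∀ l, MapsTo (refl (b l) 0) (Icc (-τ) 0) (Icc 0 τ) := fun l t ht => by
    obtain ⟨hb0, hb1⟩ := hb l
    simp only [refl, mem_Icc] at ht ⊢
    constructor <;> nlinarith [ht.1, ht.2]
  have hJ₂ : ∀ l, MapsTo (refl (b l) τ) (Icc τ (2 * τ)) (Icc 0 τ) := fun l t ht => by
    obtain ⟨hb0, hb1⟩ := hb l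
    simp only [refl, mem_Icc] at ht ⊢
    constructor <;> nlinarith [ht.1, ht.2]
  have hcl : ∀ a b : ℝ, p.2 ∉ Icc a b → p ∉ closure ((univ : Set E) ×ˢ Icc a b) := fun a b h h' => by
    rw [(isClosed_univ.prod isClosed_Icc).closure_eq] at h'
    exact h h'.2
  have e₁ : ∀ q : E × ℝ, q.2 ∈ Icc (-τ) 0 → reflExt b c τ u q = reflSum b c 0 u q := fun q hq => by
    rcases hq.2.lt_or_eq with h | h
    · simp only [reflExt, if_pos h]
    · rw [reflSum_of_eq h0 0 h, reflExt, if_neg (by linarith), if_pos (by linarith)]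
  have e₂ : ∀ q : E × ℝ, q.2 ∈ Icc 0 τ → reflExt b c τ u q = u q := fun q hq => by
    rw [reflExt, if_neg (not_lt.2 hq.1), if_pos hq.2]
  have e₃ : ∀ q : E × ℝ, q.2 ∈ Icc τ (2 * τ) → reflExt b c τ u q = reflSum b c τ u q :=
    fun q hq => by
    rcases hq.1.lt_or_eq with h | h
    · rw [reflExt, if_neg (by linarith), if_neg (not_le.2 h)]
    · rw [reflSum_of_eq h0 τ h.symm, reflExt, if_neg (by linarith), if_pos (by linarith)]
  have g₁ : HasFDerivWithinAt (reflExt b c τ u) (reflExtDeriv b c τ u' p)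
      (univ ×ˢ Icc (-τ) 0) p := by
    by_cases h : p.2 ∈ Icc (-τ) 0
    · have hd : reflExtDeriv b c τ u' p = reflSumDeriv b c 0 u' p := by
        rcases h.2.lt_or_eq with h' | h'
        · simp only [reflExtDeriv, if_pos h']
        · rw [reflSumDeriv_of_eq h0 h1 0 h', reflExtDeriv, if_neg (by linarith),
            if_pos (by linarith)]
      rw [hd]
      exact (hasFDerivWithinAt_reflSum hJ₁ hu h).congr (fun q hq => e₁ q hq.2) (e₁ p h)
    · exact .of_notMem_closure (hcl _ _ h)
  have g₂ : HasFDerivWithinAt (reflExt b c τ u) (reflExtDeriv b c τ u' p)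
      (univ ×ˢ Icc 0 τ) p := by
    by_cases h : p.2 ∈ Icc 0 τ
    · have hd : reflExtDeriv b c τ u' p = u' p := by
        rw [reflExtDeriv, if_neg (not_lt.2 h.1), if_pos h.2]
      rw [hd]
      exact (hu p ⟨mem_univ _, h⟩).congr (fun q hq => e₂ q hq.2) (e₂ p h)
    · exact .of_notMem_closure (hcl _ _ h)
  have g₃ : HasFDerivWithinAt (reflExt b c τ u) (reflExtDeriv b c τ u' p)
      (univ ×ˢ Icc τ (2 * τ)) p := by
    by_cases h : p.2 ∈ Icc τ (2 * τ)
    · have hd : reflExtDeriv b c τ u' p = reflSumDeriv b c τ u' p := by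
        rcases h.1.lt_or_eq with h' | h'
        · rw [reflExtDeriv, if_neg (by linarith), if_neg (not_le.2 h')]
        · rw [reflSumDeriv_of_eq h0 h1 τ h'.symm, reflExtDeriv, if_neg (by linarith),
            if_pos (by linarith)]
      rw [hd]
      exact (hasFDerivWithinAt_reflSum hJ₂ hu h).congr (fun q hq => e₃ q hq.2) (e₃ p h)
    · exact .of_notMem_closure (hcl _ _ h)
  have g := (g₁.union g₂).union g₃
  rw [← prod_union, ← prod_union, Icc_union_Icc_eq_Icc (by linarith) hτ.le,
    Icc_union_Icc_eq_Icc (by linarith) (by linarith)] at g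
  refine g.hasFDerivAt (prod_mem_nhds univ_mem (Icc_mem_nhds hp.1 hp.2))

/-- Spatial derivatives of the extension are extensions with the same `c`; the time derivative is an
extension with `c l * -b l`, for which the moment conditions shift by one. Hence the induction runs
over all `c`. The condition of order `N + 1` is required because the base case derives continuity
from differentiability. -/
theorem contDiffOn_reflExt [FiniteDimensional ℝ E] (hτ : 0 < τ) (hb : ∀ l, 0 < b l ∧ b l ≤ 1)
    (N : ℕ) : ∀ (c : Fin m → ℝ), (∀ k ≤ N + 1, ∑ l, c l * (-b l) ^ k = 1) →
      ∀ u : E × ℝ → ℂ, ContDiffOn ℝ ∞ u (univ ×ˢ Icc 0 τ) →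
        ContDiffOn ℝ N (reflExt b c τ u) (univ ×ˢ Ioo (-τ) (2 * τ)) := by
  have hS : UniqueDiffOn ℝ ((univ : Set E) ×ˢ Icc 0 τ) :=
    uniqueDiffOn_univ.prod (uniqueDiffOn_Icc hτ)
  have hΩ : IsOpen ((univ : Set E) ×ˢ Ioo (-τ) (2 * τ)) := isOpen_univ.prod isOpen_Ioo
  have hder : ∀ (c : Fin m → ℝ), (∀ k ≤ 1, ∑ l, c l * (-b l) ^ k = 1) →
      ∀ u : E × ℝ → ℂ, ContDiffOn ℝ ∞ u (univ ×ˢ Icc 0 τ) →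
      ∀ p ∈ (univ : Set E) ×ˢ Ioo (-τ) (2 * τ), HasFDerivAt (reflExt b c τ u)
        (reflExtDeriv b c τ (fderivWithin ℝ u (univ ×ˢ Icc 0 τ)) p) p := by
    intro c hc u hu p hp
    refine hasFDerivAt_reflExt hτ hb (by simpa using hc 0 zero_le) (by simpa using hc 1 le_rfl)
      (fun q hq => (hu.differentiableOn (by simp) q hq).hasFDerivWithinAt) hp.2
  induction N with
  | zero =>
    intro c hc u hu
    refine contDiffOn_zero.2 fun p hp => ?_
    exact (hder c (fun k hk => hc k (by omega)) u hu p hp).continuousAt.continuousWithinAt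
  | succ N ih =>
    intro c hc u hu
    have hd := hder c (fun k hk => hc k (by omega)) u hu
    have hu' := hu.fderivWithin hS (m := ∞) (by simp)
    push_cast
    refine contDiffOn_succ_of_fderiv_apply
      (fun p hp => (hd p hp).differentiableAt.differentiableWithinAt) (by simp) fun ⟨v, w⟩ => ?_
    have h1 := ih c (fun k hk => hc k (by omega)) _ (hu'.clm_apply (contDiffOn_const (c := (v, 0))))
    have h2 := ih (fun l => c l * -b l) (fun k hk => by
      rw [← hc (k + 1) (by omega)]
      exact Finset.sum_congr rfl fun l _ => by ring) _
      (hu'.clm_apply (contDiffOn_const (c := (0, 1))))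
    refine (h1.add (contDiffOn_const (c := (w : ℂ)).mul h2)).congr fun p hp => ?_
    rw [fderivWithin_of_isOpen hΩ hp, (hd p hp).fderiv, reflExtDeriv_apply]

/-- The conditions form a Vandermonde system with the distinct nodes `-1/(l + 1)`. -/
theorem exists_reflection_coefficients (N : ℕ) : ∃ b c : Fin (N + 1) → ℝ,
    (∀ l, 0 < b l ∧ b l ≤ 1) ∧ ∀ k ≤ N, ∑ l, c l * (-b l) ^ k = 1 := by
  set b : Fin (N + 1) → ℝ := fun l => 1 / ((l : ℕ) + 1) with hb
  have hinj : Function.Injective fun l => -b l := by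
    intro l l' h
    simp only [hb, neg_inj, one_div, inv_inj, add_left_inj, Nat.cast_inj] at h
    exact Fin.ext h
  set V := (Matrix.vandermonde fun l => -b l).transpose with hV
  have hdet : IsUnit V.det := by
    rw [hV, Matrix.det_transpose, isUnit_iff_ne_zero]
    exact Matrix.det_vandermonde_ne_zero_iff.2 hinj
  refine ⟨b, V⁻¹.mulVec 1, fun l => ⟨by positivity, ?_⟩, fun k hk => ?_⟩
  · rw [hb]
    exact (div_le_one (by positivity)).2 (by linarith [(l : ℕ).cast_nonneg (α := ℝ)])
  · have h1 : V.mulVec (V⁻¹.mulVec 1) = 1 := by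
      rw [Matrix.mulVec_mulVec, Matrix.mul_nonsing_inv _ hdet, Matrix.one_mulVec]
    have h2 := congrFun h1 ⟨k, by omega⟩
    simp only [Matrix.mulVec, dotProduct, Pi.one_apply] at h2
    rw [← h2]
    refine Finset.sum_congr rfl fun l _ => ?_
    rw [mul_comm]
    rfl

/-- A function which is smooth up to the boundary on a strip, with compact support in space, has
compactly supported `C^N` extensions. -/
theorem exists_contDiff_extension [FiniteDimensional ℝ E] (hτ : 0 < τ) {u : E × ℝ → ℂ}
    (hu : ContDiffOn ℝ ∞ u (univ ×ˢ Icc 0 τ)) {K : Set E} (hK : IsCompact K)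
    (huK : ∀ p, p.1 ∉ K → u p = 0) (N : ℕ) :
    ∃ U : E × ℝ → ℂ, ContDiff ℝ N U ∧ HasCompactSupport U ∧
      EqOn U u (univ ×ˢ Icc 0 τ) := by
  obtain ⟨b, c, hb, hc⟩ := exists_reflection_coefficients (N + 1)
  have hext := contDiffOn_reflExt hτ hb N c hc u hu
  obtain ⟨ζ, hζ, hζc, hζs, hζ1⟩ := exists_smooth_cutoff (E := ℝ) (isCompact_Icc (a := 0) (b := τ))
    (isOpen_Ioo (a := -τ) (b := 2 * τ)) fun t ht => ⟨by linarith [ht.1], by linarith [ht.2]⟩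
  -- Only a cutoff in time is needed: the reflections leave `x` fixed, so the extension inherits the
  -- compact spatial support of `u`.
  refine ⟨fun p => (ζ p.2 : ℂ) * reflExt b c τ u p, ?_, ?_, fun p hp => ?_⟩
  · rw [contDiff_iff_contDiffAt]
    intro p
    by_cases hp : p.2 ∈ tsupport ζ
    · have h1 : ContDiffAt ℝ N (fun p : E × ℝ => (ζ p.2 : ℂ)) p :=
        ((Complex.ofRealCLM.contDiff.comp hζ).comp contDiff_snd).contDiffAt.of_le
          (by exact_mod_cast le_top)
      exact h1.mul (hext.contDiffAt ((isOpen_univ.prod isOpen_Ioo).mem_nhds ⟨mem_univ _, hζs hp⟩))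
    · refine (contDiffAt_const (c := 0)).congr_of_eventuallyEq ?_
      filter_upwards [continuous_snd.continuousAt.eventually
        ((isClosed_tsupport ζ).isOpen_compl.mem_nhds hp)] with q hq
      rw [image_eq_zero_of_notMem_tsupport hq]
      simp
  · refine HasCompactSupport.of_support_subset_isCompact (hK.prod hζc.isCompact) fun p hp => ?_
    refine ⟨?_, subset_tsupport _ fun h => left_ne_zero_of_mul hp (by simp [h])⟩
    by_contra hcon
    refine right_ne_zero_of_mul hp ?_
    have h0 : ∀ t, u (p.1, t) = 0 := fun t => huK _ hcon
    simp only [reflExt, reflSum, h0]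
    simp
  · simp only [hζ1 p.2 hp.2, Complex.ofReal_one, one_mul]
    rw [reflExt, if_neg (not_lt.2 hp.2.1), if_pos hp.2.2]

end Reflection

end

end CauchyData

namespace CauchyData

noncomputable section

/-! ### Smooth functions and the Fourier transform on `L₂` -/

section FourierSmooth

variable {E : Type} [NormedAddCommGroup E] [InnerProductSpace ℝ E] [FiniteDimensional ℝ E]
  [MeasurableSpace E] [BorelSpace E]

theorem integral_fourier_mul_schwartz {f : E → ℂ} (hf : Integrable f) (ψ : 𝓢(E, ℂ)) :
    ∫ x, 𝓕 f x * ψ x = ∫ x, f x * 𝓕 (ψ : E → ℂ) x := by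
  have h := VectorFourier.integral_fourierIntegral_smul_eq_flip (L := innerₗ E)
    Real.continuous_fourierChar (continuous_inner (𝕜 := ℝ)) hf (ψ.integrable (μ := volume))
  simpa using! h

theorem integral_fourierInv_mul_schwartz {f : E → ℂ} (hf : Integrable f) (ψ : 𝓢(E, ℂ)) :
    ∫ x, 𝓕⁻ f x * ψ x = ∫ x, f x * 𝓕⁻ (ψ : E → ℂ) x := by
  have h := integral_fourier_mul_schwartz hf
    (SchwartzMap.compCLMOfContinuousLinearEquiv ℂ (ContinuousLinearEquiv.neg ℝ (M := E)) ψ)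
  have e1 : ∫ x, 𝓕⁻ f x * ψ x = ∫ x, 𝓕 f x * ψ (-x) := by
    rw [← integral_neg_eq_self]
    simp only [Real.fourierInv_eq_fourier_neg, neg_neg]
  rw [e1, Real.fourierInv_eq_fourier_comp_neg]
  exact h

/-- The `L₂` transform and the integral transform of an integrable function have the same pairings
with Schwartz functions. -/
theorem fourierInv_ae_eq {f : L2 E} (hf : Integrable f) :
    (𝓕⁻ f : L2 E) =ᵐ[volume] 𝓕⁻ (f : E → ℂ) := by
  have hc : Continuous (𝓕⁻ (f : E → ℂ)) := by
    rw [Real.fourierInv_eq_fourier_comp_neg]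
    exact VectorFourier.fourierIntegral_continuous Real.continuous_fourierChar
      (continuous_inner (𝕜 := ℝ)) hf.comp_neg
  refine ae_eq_of_schwartz_univ (locallyIntegrable_of_memLp_two (Lp.memLp _))
    hc.locallyIntegrable fun ψ _ => ?_
  rw [integral_fourierInv_mul, integral_fourierInv_mul_schwartz hf, SchwartzMap.fourierInv_coe]

theorem fourier_ae_eq {f : L2 E} (hf : Integrable f) :
    (𝓕 f : L2 E) =ᵐ[volume] 𝓕 (f : E → ℂ) := by
  have hc : Continuous (𝓕 (f : E → ℂ)) :=
    VectorFourier.fourierIntegral_continuous Real.continuous_fourierChar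
      (continuous_inner (𝕜 := ℝ)) hf
  refine ae_eq_of_schwartz_univ (locallyIntegrable_of_memLp_two (Lp.memLp _))
    hc.locallyIntegrable fun ψ _ => ?_
  rw [integral_fourier_mul_schwartz hf, ← SchwartzMap.fourier_coe]
  have h := integral_fourierInv_mul (𝓕 f) (𝓕 ψ)
  rw [FourierTransform.fourierInv_fourier_eq, FourierTransform.fourierInv_fourier_eq] at h
  exact h.symm

theorem exists_norm_fourier_le {N : ℕ} {W : E → ℂ} (hW : ContDiff ℝ N W)
    (hWc : HasCompactSupport W) : ∃ C, 0 ≤ C ∧ ∀ ξ, ‖𝓕 W ξ‖ ≤ C * ((1 + ‖ξ‖) ^ N)⁻¹ := by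
  have hint : ∀ k n : ℕ, (k : ℕ∞) ≤ 0 → (n : ℕ∞) ≤ N →
      Integrable fun v => ‖v‖ ^ k * ‖iteratedFDeriv ℝ n W v‖ := fun k n _ hn => by
    refine Continuous.integrable_of_hasCompactSupport ?_ ?_
    · exact (continuous_norm.pow k).mul
        (hW.continuous_iteratedFDeriv (by exact_mod_cast hn)).norm
    · exact (hWc.iteratedFDeriv n).norm.mul_left
  have hb : ∀ n : ℕ, n ≤ N → ∃ C, 0 ≤ C ∧ ∀ ξ, ‖ξ‖ ^ n * ‖𝓕 W ξ‖ ≤ C := fun n hn => by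
    have h := Real.pow_mul_norm_iteratedFDeriv_fourier_le (K := 0) (N := N) (k := 0) (n := n)
      (f := W) hW hint le_rfl (by exact_mod_cast hn)
    simp only [norm_iteratedFDeriv_zero] at h
    exact ⟨_, mul_nonneg (by positivity) (Finset.sum_nonneg fun p _ => integral_nonneg fun v =>
      by positivity), h⟩
  obtain ⟨C₀, h0, hC₀⟩ := hb 0 (Nat.zero_le N)
  obtain ⟨C₁, h1, hC₁⟩ := hb N le_rfl
  refine ⟨2 ^ (N - 1) * (C₀ + C₁), by positivity, fun ξ => ?_⟩
  rw [← div_eq_mul_inv, le_div_iff₀ (by positivity)]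
  have h2 := add_pow_le zero_le_one (norm_nonneg ξ) N
  have h3 := hC₀ ξ
  have h4 := hC₁ ξ
  rw [pow_zero, one_mul] at h3
  calc ‖𝓕 W ξ‖ * (1 + ‖ξ‖) ^ N ≤ ‖𝓕 W ξ‖ * (2 ^ (N - 1) * (1 ^ N + ‖ξ‖ ^ N)) := by gcongr
    _ = 2 ^ (N - 1) * (‖𝓕 W ξ‖ + ‖ξ‖ ^ N * ‖𝓕 W ξ‖) := by rw [one_pow]; ring
    _ ≤ _ := by gcongr

/-- The cutting off of high frequencies. -/
def truncate (n : ℕ) (f : L2 E) : L2 E :=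
  ((Lp.memLp f).indicator (s := Metric.closedBall 0 n) Metric.isClosed_closedBall.measurableSet).toLp

theorem coeFn_truncate (n : ℕ) (f : L2 E) :
    truncate n f =ᵐ[volume] (Metric.closedBall 0 (n : ℝ)).indicator f :=
  MemLp.coeFn_toLp _

/-- An `L₂` function of bounded support has integrable moments of all orders, so its inverse
transform is smooth. -/
theorem exists_contDiff_fourierInv_truncate (n : ℕ) (f : L2 E) :
    ∃ W : E → ℂ, ContDiff ℝ ∞ W ∧ (𝓕⁻ (truncate n f) : L2 E) =ᵐ[volume] W := by
  have hint : ∀ k : ℕ, Integrable fun v => ‖v‖ ^ k * ‖truncate n f v‖ := fun k => by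
    have h1 : Integrable ((Metric.closedBall 0 (n : ℝ)).indicator fun v => ‖v‖ ^ k * ‖f v‖) := by
      rw [integrable_indicator_iff Metric.isClosed_closedBall.measurableSet]
      refine IntegrableOn.continuousOn_mul (by fun_prop) ?_ (isCompact_closedBall 0 (n : ℝ))
      exact ((locallyIntegrable_of_memLp_two (Lp.memLp f)).integrableOn_isCompact
        (isCompact_closedBall 0 (n : ℝ))).norm
    refine h1.congr ((coeFn_truncate n f).mono fun v hv => ?_)
    dsimp only
    rw [hv]
    by_cases h : v ∈ Metric.closedBall (0 : E) (n : ℝ)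
    · simp [h]
    · simp [h]
  have h0 : Integrable (truncate n f) := by
    rw [← integrable_norm_iff (Lp.aestronglyMeasurable _)]
    simpa using hint 0
  refine ⟨_, ?_, fourierInv_ae_eq h0⟩
  have h1 := Real.contDiff_fourier (N := ⊤) (f := (truncate n f : E → ℂ)) fun k _ => hint k
  have h2 : (𝓕⁻ (truncate n f : E → ℂ)) = fun w => 𝓕 (truncate n f : E → ℂ) (-w) :=
    funext fun w => Real.fourierInv_eq_fourier_neg _ _
  rw [h2]
  exact h1.comp contDiff_neg

theorem tendsto_energy_sub_truncate {μ : E → ℝ} (hμ : Measurable μ) {f : L2 E}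
    (hf : energy volume μ f < ⊤) :
    Tendsto (fun n => energy volume μ (f - truncate n f : L2 E)) atTop (𝓝 0) := by
  have h0 : (0 : ℝ≥0∞) = ∫⁻ _ : E, 0 := by simp
  have hc : ∀ n, energy volume μ (f - truncate n f : L2 E) =
      energy volume μ ((Metric.closedBall (0 : E) (n : ℝ))ᶜ.indicator f) := fun n => by
    refine energy_congr μ ?_
    filter_upwards [Lp.coeFn_sub f (truncate n f), coeFn_truncate n f] with v h1 h2
    rw [h1, Pi.sub_apply, h2, indicator_compl]
    rfl
  simp only [hc]
  rw [h0]
  have hm : AEMeasurable (fun v => ENNReal.ofReal (μ v) ^ 2 * ‖f v‖ₑ ^ 2) volume :=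
    (hμ.ennreal_ofReal.pow_const 2).aemeasurable.mul
      ((Lp.aestronglyMeasurable f).enorm.pow_const 2)
  refine tendsto_lintegral_of_dominated_convergence' _ (fun n => ?_) (fun n => ?_) hf.ne ?_
  · exact (hμ.ennreal_ofReal.pow_const 2).aemeasurable.mul
      (((Lp.aestronglyMeasurable f).indicator
        Metric.isClosed_closedBall.measurableSet.compl).enorm.pow_const 2)
  · refine Eventually.of_forall fun v => mul_le_mul_right (pow_le_pow_left' ?_ 2) _
    exact enorm_indicator_le_enorm_self _ _
  · refine Eventually.of_forall fun v => tendsto_const_nhds.congr' ?_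
    obtain ⟨m, hm⟩ := exists_nat_ge ‖v‖
    filter_upwards [eventually_ge_atTop m] with n hn
    have : v ∉ (Metric.closedBall (0 : E) (n : ℝ))ᶜ := by
      simp only [mem_compl_iff, mem_closedBall_zero_iff, not_not]
      exact hm.trans (by exact_mod_cast hn)
    rw [indicator_of_notMem this]
    simp

variable {d : ℕ}

theorem anisoRadius_le (z : SpaceTime d) : anisoRadius z ≤ 1 + ‖z‖ := by
  have h1 : ‖z.fst‖ ≤ ‖z‖ := WithLp.norm_fst_le _ z
  have h2 : |z.snd| ≤ ‖z‖ := WithLp.norm_snd_le _ z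
  refine le_of_sq_le_sq ?_ (by positivity)
  rw [anisoRadius_sq]
  nlinarith [norm_nonneg z, norm_nonneg z.fst]

/-- Compactly supported functions with enough derivatives lie in a given anisotropic space. -/
theorem exists_energy_lt_top_of_contDiff (s : ℝ) {φ : ℝ → ℝ} (hφ : ClassM φ) :
    ∃ N : ℕ, ∀ W : SpaceTime d → ℂ, ContDiff ℝ N W → HasCompactSupport W →
      ∃ f : L2 (SpaceTime d), (𝓕⁻ f : L2 (SpaceTime d)) =ᵐ[volume] W ∧
        energy volume (anisoIndex d s φ) f < ⊤ := by
  obtain ⟨C, hC0, hC⟩ := radial_potter (s := s) hφ one_pos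
  obtain ⟨M, hM⟩ := exists_nat_ge (s + 1)
  set D := Module.finrank ℝ (SpaceTime d) with hD
  have hμ : ∀ z : SpaceTime d, anisoIndex d s φ z ≤ C * radial s φ 1 * (1 + ‖z‖) ^ M := fun z => by
    have h1 := (hC 1 (anisoRadius z) le_rfl (one_le_anisoRadius z)).1
    have hr := radial_pos (s := s) hφ le_rfl
    rw [anisoIndex_eq_radial]
    refine h1.trans ?_
    rw [div_one, mul_right_comm, ← Real.rpow_natCast]
    refine mul_le_mul_of_nonneg_left ?_ (by positivity)
    refine (Real.rpow_le_rpow_of_exponent_le (one_le_anisoRadius z) hM).trans ?_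
    exact Real.rpow_le_rpow (zero_le_one.trans (one_le_anisoRadius z)) (anisoRadius_le z)
      (by positivity)
  -- Of the derivatives of `W`, `M` absorb the polynomial growth of the weight and `D + 1` make the
  -- remaining power integrable in dimension `D`.
  refine ⟨M + (D + 1), fun W hW hWc => ?_⟩
  obtain ⟨C₁, hC₁0, hC₁⟩ := exists_norm_fourier_le hW hWc
  have hWm : MemLp W 2 volume := hW.continuous.memLp_of_hasCompactSupport hWc
  have hWi : Integrable (hWm.toLp W) :=
    (hW.continuous.integrable_of_hasCompactSupport hWc).congr hWm.coeFn_toLp.symm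
  refine ⟨𝓕 (hWm.toLp W), ?_, ?_⟩
  · rw [FourierTransform.fourierInv_fourier_eq]
    exact hWm.coeFn_toLp
  have hF : (𝓕 (hWm.toLp W) : L2 (SpaceTime d)) =ᵐ[volume] 𝓕 W := by
    refine (fourier_ae_eq hWi).trans (Eventually.of_forall fun ξ => ?_)
    rw [Real.fourier_eq, Real.fourier_eq]
    exact integral_congr_ae (hWm.coeFn_toLp.mono fun v hv => by dsimp only; rw [hv])
  rw [energy_congr _ hF]
  set K := C * radial s φ 1 * C₁
  have hK : 0 ≤ K := mul_nonneg (mul_nonneg hC0.le (radial_pos hφ le_rfl).le) hC₁0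
  refine lt_of_le_of_lt (b := ∫⁻ z : SpaceTime d, ENNReal.ofReal (K ^ 2) *
    ENNReal.ofReal ((1 + ‖z‖) ^ (-((D : ℝ) + 1)))) (lintegral_mono fun z => ?_) ?_
  · rw [← ofReal_norm, ← ENNReal.ofReal_pow (norm_nonneg _),
      ← ENNReal.ofReal_pow (anisoIndex_pos hφ z).le, ← ENNReal.ofReal_mul (by positivity),
      ← ENNReal.ofReal_mul (by positivity), ← mul_pow]
    refine ENNReal.ofReal_le_ofReal ?_
    have h1 : anisoIndex d s φ z * ‖𝓕 W z‖ ≤ K * ((1 + ‖z‖) ^ (D + 1))⁻¹ := by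
      calc _ ≤ C * radial s φ 1 * (1 + ‖z‖) ^ M * (C₁ * ((1 + ‖z‖) ^ (M + (D + 1)))⁻¹) :=
            mul_le_mul (hμ z) (hC₁ z) (norm_nonneg _)
              ((anisoIndex_pos hφ z).le.trans (hμ z))
        _ = _ := by
          rw [pow_add]
          have : (1 + ‖z‖) ≠ 0 := by positivity
          simp only [K]
          field_simp
    have h2 : ((1 + ‖z‖) ^ (D + 1))⁻¹ ≤ 1 :=
      inv_le_one_of_one_le₀ (one_le_pow₀ (by linarith [norm_nonneg z]))
    have h3 : (0 : ℝ) ≤ ((1 + ‖z‖) ^ (D + 1))⁻¹ := by positivity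
    have h4 : (1 + ‖z‖) ^ (-((D : ℝ) + 1)) = ((1 + ‖z‖) ^ (D + 1))⁻¹ := by
      rw [Real.rpow_neg (by positivity)]
      norm_cast
    rw [h4]
    calc _ ≤ (K * ((1 + ‖z‖) ^ (D + 1))⁻¹) ^ 2 :=
          pow_le_pow_left₀ (mul_nonneg (anisoIndex_pos hφ z).le (norm_nonneg _)) h1 2
      _ = K ^ 2 * (((1 + ‖z‖) ^ (D + 1))⁻¹ * ((1 + ‖z‖) ^ (D + 1))⁻¹) := by ring
      _ ≤ K ^ 2 * ((1 + ‖z‖) ^ (D + 1))⁻¹ :=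
          mul_le_mul_of_nonneg_left (mul_le_of_le_one_left h3 h2) (by positivity)
  · rw [lintegral_const_mul' _ _ ENNReal.ofReal_ne_top]
    exact ENNReal.mul_lt_top ENNReal.ofReal_lt_top
      (finite_integral_one_add_norm (by linarith))

end FourierSmooth

end

end CauchyData

namespace CauchyData

noncomputable section

/-! ### Localization of functions on the lateral surface -/

theorem BoundedComp.coeFn_op_of_ae_eq {X Y : Type*} [MeasurableSpace X] [MeasurableSpace Y]
    {a : Y → ℂ} {ρ : Y → X} {ν : Measure Y} {μ : Measure X} (h : BoundedComp a ρ ν μ)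
    {f : Lp ℂ 2 μ} {f' : X → ℂ} (hf : f =ᵐ[μ] f') : h.op f =ᵐ[ν] fun y => a y * f' (ρ y) :=
  (h.coeFn_op f).trans (h.ae_eq hf)

section Energy

variable {X : Type*} [MeasurableSpace X] {ν : Measure X} {μ : X → ℝ}

theorem energy_zero : energy ν μ ((0 : Lp ℂ 2 ν) : X → ℂ) = 0 := by
  rw [energy_congr μ (Lp.coeFn_zero ℂ 2 ν)]
  simp [energy]

theorem energy_coeFn_add_le (hμ : Measurable μ) (f g : Lp ℂ 2 ν) :
    energy ν μ (f + g : Lp ℂ 2 ν) ≤ 2 * energy ν μ f + 2 * energy ν μ g := by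
  rw [energy_congr μ (Lp.coeFn_add f g)]
  exact energy_add_le hμ (Lp.aestronglyMeasurable f)

theorem energy_smul (c : ℂ) (f : Lp ℂ 2 ν) :
    energy ν μ (c • f : Lp ℂ 2 ν) = ‖c‖ₑ ^ 2 * energy ν μ f := by
  rw [energy_congr μ (Lp.coeFn_smul c f), energy, energy, ← lintegral_const_mul' _ _ (by finiteness)]
  refine lintegral_congr fun x => ?_
  rw [Pi.smul_apply, smul_eq_mul, enorm_mul]
  ring

theorem energy_sum_le (hμ : Measurable μ) {κ : Type*} (S : Finset κ) :
    ∃ C : ℝ≥0, ∀ f : κ → Lp ℂ 2 ν,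
      energy ν μ (∑ j ∈ S, f j : Lp ℂ 2 ν) ≤ C * ∑ j ∈ S, energy ν μ (f j) := by
  classical
  induction S using Finset.induction_on with
  | empty => exact ⟨0, fun f => by rw [Finset.sum_empty, energy_zero]; exact zero_le⟩
  | insert a S ha ih =>
    obtain ⟨C, hC⟩ := ih
    refine ⟨2 + 2 * C, fun f => ?_⟩
    rw [Finset.sum_insert ha, Finset.sum_insert ha]
    refine (energy_coeFn_add_le hμ _ _).trans ?_
    rw [ENNReal.coe_add, ENNReal.coe_mul, ENNReal.coe_ofNat]
    calc _ ≤ 2 * energy ν μ (f a) + 2 * (C * ∑ j ∈ S, energy ν μ (f j)) :=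
          add_le_add le_rfl (mul_le_mul_right (hC f) 2)
      _ ≤ (2 * energy ν μ (f a) + 2 * (C * ∑ j ∈ S, energy ν μ (f j))) +
          (2 * C * energy ν μ (f a) + 2 * ∑ j ∈ S, energy ν μ (f j)) := le_self_add
      _ = _ := by ring

end Energy

theorem rpow_half_sq (x : ℝ≥0∞) : (x ^ (1 / 2 : ℝ)) ^ 2 = x := by
  rw [← ENNReal.rpow_natCast, ← ENNReal.rpow_mul]
  norm_num

theorem le_sqrt_mul_of_sq_le {C : ℝ≥0} {a b : ℝ≥0∞} (h : a ^ 2 ≤ C * b ^ 2) :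
    a ≤ (NNReal.sqrt C : ℝ≥0) * b := by
  refine (ENNReal.pow_right_strictMono two_ne_zero).le_iff_le.1 ?_
  rwa [mul_pow, ← ENNReal.coe_pow, NNReal.sq_sqrt]

/-- Quotient norms are infima, so estimates are proved for every number above the norm and then
passed to the limit. -/
theorem le_mul_sq_of_forall_lt {C : ℝ≥0} {a b : ℝ≥0∞} (hb : b < ⊤)
    (h : ∀ c, b < c → a ≤ C * c ^ 2) : a ≤ C * b ^ 2 := by
  have hc : Continuous fun c : ℝ≥0∞ => (C : ℝ≥0∞) * c ^ 2 :=
    (ENNReal.continuous_const_mul ENNReal.coe_ne_top).comp (ENNReal.continuous_pow 2)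
  have : (𝓝[>] b).NeBot := nhdsGT_neBot_of_exists_gt ⟨⊤, hb⟩
  have h1 : Tendsto (fun c : ℝ≥0∞ => (C : ℝ≥0∞) * c ^ 2) (𝓝[>] b) (𝓝 (C * b ^ 2)) :=
    (hc.tendsto b).mono_left nhdsWithin_le_nhds
  have h2 : ∀ᶠ c in 𝓝[>] b, a ≤ C * c ^ 2 := eventually_mem_nhdsWithin.mono fun c hc => h c hc
  exact ge_of_tendsto h1 h2

theorem isOpen_strip (d : ℕ) (τ : ℝ) : IsOpen (strip d τ) :=
  isOpen_Ioo.preimage (sndCLM d).continuous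

/-! ### Restrictions of inverse Fourier transforms to the strip. -/

section StripRestriction

variable {d : ℕ} {τ : ℝ}

/-- The space `L₂` over the strip. -/
abbrev L2Strip (d : ℕ) (τ : ℝ) : Type :=
  Lp ℂ 2 ((volume : Measure (Eucl d)).prod (volume.restrict (Ioo 0 τ)))

/-- The restriction of the inverse Fourier transform to the strip. -/
def stripInv (d : ℕ) (τ : ℝ) : L2 (SpaceTime d) →ₗ[ℂ] L2Strip d τ :=
  (boundedComp_toLp Measure.restrict_le_self).op ∘ₗ
    (FourierTransform.fourierInvCLM ℂ (L2 (SpaceTime d))).toLinearMap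

theorem stripInv_apply (f : L2 (SpaceTime d)) :
    stripInv d τ f = (boundedComp_toLp Measure.restrict_le_self).op (𝓕⁻ f) := rfl

theorem coeFn_stripInv (f : L2 (SpaceTime d)) :
    stripInv d τ f =ᵐ[(volume : Measure (Eucl d)).prod (volume.restrict (Ioo 0 τ))]
      fun p => (𝓕⁻ f : L2 (SpaceTime d)) (WithLp.toLp 2 p) :=
  coeFn_toLp_op Measure.restrict_le_self _

theorem map_toLp_prod_restrict :
    ((volume : Measure (Eucl d)).prod (volume.restrict (Ioo 0 τ))).map (WithLp.toLp 2) =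
      (volume : Measure (SpaceTime d)).restrict (strip d τ) := by
  have h1 : (volume : Measure (Eucl d)).prod (volume.restrict (Ioo 0 τ)) =
      (volume : Measure (Eucl d × ℝ)).restrict (WithLp.toLp 2 ⁻¹' strip d τ) := by
    rw [Measure.volume_eq_prod]
    have : (WithLp.toLp 2 ⁻¹' strip d τ : Set (Eucl d × ℝ)) = univ ×ˢ Ioo 0 τ := by
      ext p; simp [strip]
    rw [this, ← Measure.prod_restrict, Measure.restrict_univ]
  rw [h1]
  exact ((WithLp.volume_preserving_toLp (Eucl d) ℝ).restrict_preimage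
    (isOpen_strip d τ).measurableSet).map_eq

theorem ae_strip_iff {u w : SpaceTime d → ℂ} :
    u =ᵐ[volume.restrict (strip d τ)] w ↔
      (fun p : Eucl d × ℝ => u (WithLp.toLp 2 p))
        =ᵐ[(volume : Measure (Eucl d)).prod (volume.restrict (Ioo 0 τ))]
          fun p => w (WithLp.toLp 2 p) := by
  rw [← map_toLp_prod_restrict]
  exact (MeasurableEquiv.toLp 2 (Eucl d × ℝ)).measurableEmbedding.ae_map_iff

end StripRestriction

/-! ### Localization by the partition of unity, gluing and change of charts. -/

namespace AtlasWithPartition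

variable {d : ℕ} {Γ : Set (Eucl (d + 1))} {ι : Type} [Fintype ι] (A : AtlasWithPartition Γ ι)

/-- The function `χ_j` in the `j`-th chart. -/
def coeff (j : ι) (x : Eucl d) : ℂ := A.χ j (A.θ j x)

theorem contDiff_coeff (j : ι) : ContDiff ℝ ∞ (A.coeff j) := A.smooth j j

/-- The support of `χ_j` is a compact subset of the range of the embedding `θ_j`, so its preimage is
compact. -/
theorem hasCompactSupport_coeff (hΓ : IsCompact Γ) (j : ι) : HasCompactSupport (A.coeff j) := by
  have hK : IsCompact (closure {y ∈ Γ | A.χ j y ≠ 0}) :=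
    hΓ.of_isClosed_subset isClosed_closure (closure_minimal (fun y hy => hy.1) hΓ.isClosed)
  have hc := (A.isChart j).embedding.isInducing.isCompact_preimage_iff (A.supp j) |>.2 hK
  refine HasCompactSupport.of_support_subset_isCompact hc fun x hx => ?_
  exact subset_closure ⟨(A.isChart j).subset ⟨x, rfl⟩, hx⟩

theorem exists_cut (hΓ : IsCompact Γ) (j : ι) : ∃ κ : Eucl d → ℂ, ContDiff ℝ ∞ κ ∧
    HasCompactSupport κ ∧ ∀ x ∈ tsupport (A.coeff j), κ x = 1 :=
  exists_complex_cutoff (A.hasCompactSupport_coeff hΓ j)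

variable (hΓ : IsCompact Γ)

/-- A smooth compactly supported function equal to one on the support of `coeff j`. -/
def cut (j : ι) : Eucl d → ℂ := (A.exists_cut hΓ j).choose

theorem contDiff_cut (j : ι) : ContDiff ℝ ∞ (A.cut hΓ j) := (A.exists_cut hΓ j).choose_spec.1

theorem hasCompactSupport_cut (j : ι) : HasCompactSupport (A.cut hΓ j) :=
  (A.exists_cut hΓ j).choose_spec.2.1

theorem cut_mul_coeff (j : ι) (x : Eucl d) : A.cut hΓ j x * A.coeff j x = A.coeff j x := by
  by_cases hx : x ∈ tsupport (A.coeff j)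
  · rw [cut, (A.exists_cut hΓ j).choose_spec.2.2 x hx, one_mul]
  · rw [image_eq_zero_of_notMem_tsupport hx, mul_zero]

/-- Pulling back with `χ_j` and pushing forward with the cutoff amounts to multiplication by `χ_j`:
the cutoff is one on the support of `χ_j`, and `χ_j` vanishes off the chart. Summation over `j` then
recovers the function. -/
theorem extend_cut_mul {j : ι} {y : Eucl (d + 1)} (hy : y ∈ Γ) (F : Eucl (d + 1) → ℂ) :
    Function.extend (A.θ j) (A.cut hΓ j) 0 y *
      (A.coeff j (chartInv (A.θ j) y) * F (A.θ j (chartInv (A.θ j) y))) = A.χ j y * F y := by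
  by_cases h : y ∈ range (A.θ j)
  · obtain ⟨x, rfl⟩ := h
    rw [(A.isChart j).embedding.injective.extend_apply, (A.isChart j).chartInv_apply, ← mul_assoc,
      cut_mul_coeff]
    rfl
  · have h0 : A.χ j y = 0 := by
      by_contra hne
      exact h (A.supp j (subset_closure ⟨hy, hne⟩))
    rw [Function.extend_apply' _ _ _ h, h0]
    simp

theorem isFiniteMeasure_surfaceMeasure (A : AtlasWithPartition Γ ι) (hΓ : IsCompact Γ) :
    IsFiniteMeasure (surfaceMeasure Γ) := by
  constructor
  have hsub : Γ ⊆ ⋃ j, A.θ j '' tsupport (A.coeff j) := fun y hy => by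
    have h1 := A.sum_eq_one y hy
    obtain ⟨j, -, hj⟩ := Finset.exists_ne_zero_of_sum_ne_zero (h1.trans_ne one_ne_zero)
    obtain ⟨x, rfl⟩ := A.supp j (subset_closure ⟨hy, hj⟩)
    exact mem_iUnion.2 ⟨j, x, subset_tsupport _ hj, rfl⟩
  have h2 : surfaceMeasure Γ univ = surfaceMeasure Γ Γ := by
    simp only [surfaceMeasure, Measure.restrict_apply_univ, Measure.restrict_apply_self]
  rw [h2]
  refine (measure_mono hsub).trans_lt ((measure_iUnion_fintype_le _ _).trans_lt ?_)
  exact ENNReal.sum_lt_top.2 fun j _ =>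
    (A.isChart j).surfaceMeasure_image_lt_top hΓ.isClosed (A.hasCompactSupport_coeff hΓ j)

theorem boundedComp_pull (hΓ : IsCompact Γ) (j : ι) :
    BoundedComp (A.coeff j) (A.θ j) volume (surfaceMeasure Γ) :=
  (A.isChart j).boundedComp_pull (A.contDiff_coeff j).continuous (A.hasCompactSupport_coeff hΓ j)

theorem boundedComp_push (j : ι) :
    BoundedComp (Function.extend (A.θ j) (A.cut hΓ j) 0) (chartInv (A.θ j)) (surfaceMeasure Γ)
      volume :=
  (A.isChart j).boundedComp_push hΓ.isClosed (A.contDiff_cut hΓ j).continuous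
    (A.hasCompactSupport_cut hΓ j)

/-- The localization `v ↦ (χ_j v) ∘ θ_j`. -/
def pull (j : ι) : L2Γ Γ →ₗ[ℂ] L2 (Eucl d) := (A.boundedComp_pull hΓ j).op

/-- Gluing from the `j`-th chart. -/
def push (j : ι) : L2 (Eucl d) →ₗ[ℂ] L2Γ Γ := (A.boundedComp_push hΓ j).op

theorem coeFn_pull (j : ι) (v : L2Γ Γ) :
    A.pull hΓ j v =ᵐ[volume] fun x => A.coeff j x * v (A.θ j x) :=
  (A.boundedComp_pull hΓ j).coeFn_op v

theorem ae_mem (hΓ : IsCompact Γ) : ∀ᵐ y ∂surfaceMeasure Γ, y ∈ Γ :=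
  ae_restrict_mem hΓ.isClosed.measurableSet

theorem sum_push_pull (v : L2Γ Γ) : ∑ j, A.push hΓ j (A.pull hΓ j v) = v := by
  apply Lp.ext
  have h : ∀ᵐ y ∂surfaceMeasure Γ, ∀ j,
      A.push hΓ j (A.pull hΓ j v) y = A.χ j y * v y := by
    rw [ae_all_iff]
    intro j
    filter_upwards [(A.boundedComp_push hΓ j).coeFn_op_of_ae_eq (A.coeFn_pull hΓ j v), ae_mem hΓ]
      with y h1 h2
    exact h1.trans (A.extend_cut_mul hΓ h2 v)
  filter_upwards [h, Lp.coeFn_finsetSum Finset.univ fun j => A.push hΓ j (A.pull hΓ j v),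
    ae_mem hΓ] with y h1 h2 h3
  rw [h2, Finset.sum_apply]
  simp only [h1, ← Finset.sum_mul, A.sum_eq_one y h3, one_mul]

theorem ae_mem_lateral (hΓ : IsCompact Γ) (τ : ℝ) :
    ∀ᵐ p ∂lateralMeasure Γ τ, p.1 ∈ Γ ∧ p.2 ∈ Ioo 0 τ := by
  have h1 : ∀ᵐ p ∂lateralMeasure Γ τ, p.1 ∈ Γ :=
    Measure.quasiMeasurePreserving_fst.ae (ae_mem hΓ)
  have h2 : ∀ᵐ p ∂lateralMeasure Γ τ, p.2 ∈ Ioo 0 τ :=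
    Measure.quasiMeasurePreserving_snd.ae (ae_restrict_mem measurableSet_Ioo)
  exact h1.and h2

variable [IsFiniteMeasure (surfaceMeasure Γ)] {τ : ℝ}

theorem boundedComp_pullS (hΓ : IsCompact Γ) (τ : ℝ) (j : ι) :
    BoundedComp (fun p : Eucl d × ℝ => A.coeff j p.1) (Prod.map (A.θ j) id)
      (volume.prod (volume.restrict (Ioo 0 τ))) (lateralMeasure Γ τ) :=
  (A.boundedComp_pull hΓ j).prod (volume.restrict (Ioo 0 τ))

theorem boundedComp_pushS (τ : ℝ) (j : ι) :
    BoundedComp (fun p : Eucl (d + 1) × ℝ => Function.extend (A.θ j) (A.cut hΓ j) 0 p.1)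
      (Prod.map (chartInv (A.θ j)) id) (lateralMeasure Γ τ)
      (volume.prod (volume.restrict (Ioo 0 τ))) :=
  (A.boundedComp_push hΓ j).prod (volume.restrict (Ioo 0 τ))

/-- The localization of functions on the lateral surface. -/
def pullS (j : ι) : L2S Γ τ →ₗ[ℂ] L2Strip d τ := (A.boundedComp_pullS hΓ τ j).op

/-- Gluing of functions on the lateral surface. -/
def pushS (j : ι) : L2Strip d τ →ₗ[ℂ] L2S Γ τ := (A.boundedComp_pushS hΓ τ j).op

theorem coeFn_pullS (j : ι) (g : L2S Γ τ) :
    A.pullS hΓ j g =ᵐ[volume.prod (volume.restrict (Ioo 0 τ))]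
      fun p => A.coeff j p.1 * g (A.θ j p.1, p.2) :=
  (A.boundedComp_pullS hΓ τ j).coeFn_op g

/-- A function is glued from functions which coincide with its localizations. -/
theorem ae_eq_sum_pushS {g : Eucl (d + 1) × ℝ → ℂ} {u : ι → L2Strip d τ}
    (hu : ∀ j, u j =ᵐ[volume.prod (volume.restrict (Ioo 0 τ))]
      fun p => A.coeff j p.1 * g (A.θ j p.1, p.2)) :
    (∑ j, A.pushS hΓ j (u j) : L2S Γ τ) =ᵐ[lateralMeasure Γ τ] g := by
  have h : ∀ᵐ p ∂lateralMeasure Γ τ, ∀ j, A.pushS hΓ j (u j) p = A.χ j p.1 * g p := by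
    rw [ae_all_iff]
    intro j
    filter_upwards [(A.boundedComp_pushS hΓ τ j).coeFn_op_of_ae_eq (hu j), ae_mem_lateral hΓ τ]
      with p h1 h2
    exact h1.trans (A.extend_cut_mul hΓ h2.1 fun y => g (y, p.2))
  filter_upwards [h, Lp.coeFn_finsetSum Finset.univ fun j => A.pushS hΓ j (u j),
    ae_mem_lateral hΓ τ] with p h1 h2 h3
  rw [h2, Finset.sum_apply]
  simp only [h1, ← Finset.sum_mul, A.sum_eq_one p.1 h3.1, one_mul]

/-- The function on the lateral surface glued from the functions with given Fourier transforms. -/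
def glue (τ : ℝ) : (ι → L2 (SpaceTime d)) →ₗ[ℂ] L2S Γ τ :=
  ∑ j, A.pushS hΓ j ∘ₗ stripInv d τ ∘ₗ LinearMap.proj j

theorem glue_apply (f : ι → L2 (SpaceTime d)) :
    A.glue hΓ τ f = ∑ j, A.pushS hΓ j (stripInv d τ (f j)) := by
  simp [glue]

theorem glue_eq {f : ι → L2 (SpaceTime d)} {g : L2S Γ τ}
    (h : ∀ j, stripInv d τ (f j) = A.pullS hΓ j g) : A.glue hΓ τ f = g := by
  rw [glue_apply]
  exact Lp.ext (A.ae_eq_sum_pushS hΓ fun j => h j ▸ A.coeFn_pullS hΓ j g)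

/-- The change of charts. -/
theorem exists_stripInv_eq_pullS_pushS {s : ℝ} (hs : 0 < s) {φ : ℝ → ℝ} (hφ : ClassM φ) (i j : ι) :
    ∃ C : ℝ≥0, ∀ f : L2 (SpaceTime d), ∃ f' : L2 (SpaceTime d),
      stripInv d τ f' = A.pullS hΓ i (A.pushS hΓ j (stripInv d τ f)) ∧
        energy volume (anisoIndex d s φ) f' ≤ C * energy volume (anisoIndex d s φ) f := by
  obtain ⟨M, α, hα, hM, hb, heq⟩ := (A.isChart i).exists_transition (A.isChart j) hΓ.isClosed
    (A.contDiff_coeff i) (A.hasCompactSupport_coeff hΓ i) (A.contDiff_cut hΓ j)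
    (A.hasCompactSupport_cut hΓ j)
  obtain ⟨C, hC⟩ := energy_aniso_comp_le hα hM hb hs hφ
  -- The change of variables is performed on the full space-time before restriction to the strip;
  -- the two operations commute because the change leaves time fixed.
  refine ⟨C, fun f => ⟨_, ?_, hC f⟩⟩
  rw [stripInv_apply, FourierTransform.fourierInv_fourier_eq]
  apply Lp.ext
  have h1 := (boundedComp_toLp (d := d) (κ := volume.restrict (Ioo 0 τ))
    Measure.restrict_le_self).coeFn_op_of_ae_eq ((hb.boundedComp hM).lift.coeFn_op (𝓕⁻ f))
  have h2 := (A.boundedComp_pullS hΓ τ i).coeFn_op_of_ae_eq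
    ((A.boundedComp_pushS hΓ τ j).coeFn_op_of_ae_eq (coeFn_stripInv f))
  filter_upwards [h1, h2] with p hp1 hp2
  rw [hp1]
  refine Eq.trans ?_ hp2.symm
  obtain ⟨x, t⟩ := p
  simp only [Prod.map_apply, id_eq, one_mul, ← mul_assoc]
  by_cases h0 : A.coeff i x * Function.extend (A.θ j) (A.cut hΓ j) 0 (A.θ i x) = 0
  · rw [h0, zero_mul]
    exact mul_eq_zero_of_left h0 _
  · rw [heq x h0]
    rfl

/-! ### Norms in terms of localizations -/

theorem normS_sq_le (s : ℝ) (φ : ℝ → ℝ) {f : ι → L2 (SpaceTime d)} {g : L2S Γ τ}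
    (h : ∀ j, stripInv d τ (f j) = A.pullS hΓ j g) :
    A.normS τ s φ g ^ 2 ≤ ∑ j, energy volume (anisoIndex d s φ) (f j) := by
  rw [normS, rpow_half_sq]
  refine Finset.sum_le_sum fun j _ => ?_
  rw [← rpow_half_sq (energy volume (anisoIndex d s φ) (f j))]
  refine pow_le_pow_left' (hormanderNormOn_le (ae_strip_iff.2 ?_)) 2
  have h1 := coeFn_stripInv (τ := τ) (f j)
  rw [h j] at h1
  exact h1.symm.trans (A.coeFn_pullS hΓ j g)

theorem exists_of_normS_lt {s : ℝ} (hs : 0 < s) {φ : ℝ → ℝ} (hφ : ClassM φ) {g : L2S Γ τ}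
    {b : ℝ≥0∞} (h : A.normS τ s φ g < b) :
    ∃ f : ι → L2 (SpaceTime d), (∀ j, stripInv d τ (f j) = A.pullS hΓ j g) ∧
      ∀ j, energy volume (anisoIndex d s φ) (f j) ≤ b ^ 2 := by
  obtain ⟨c, hc0, hc⟩ := exists_le_anisoIndex (d := d) hs hφ
  have hj : ∀ j, hormanderNormOn (anisoIndex d s φ) (strip d τ)
      (fun z => A.χ j (A.θ j z.fst) * g (A.θ j z.fst, z.snd)) < b := fun j => by
    refine lt_of_le_of_lt ?_ h
    refine (ENNReal.pow_right_strictMono two_ne_zero).le_iff_le.1 ?_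
    rw [normS, rpow_half_sq]
    exact Finset.single_le_sum (f := fun j => hormanderNormOn (anisoIndex d s φ) (strip d τ)
      (fun z => A.χ j (A.θ j z.fst) * g (A.θ j z.fst, z.snd)) ^ 2) (fun _ _ => zero_le)
      (Finset.mem_univ j)
  choose f hf hfb using fun j => exists_of_hormanderNormOn_lt (isOpen_strip d τ) hc0 hc (hj j)
  refine ⟨f, fun j => Lp.ext ?_, fun j => ?_⟩
  · exact (coeFn_stripInv (f j)).trans ((ae_strip_iff.1 (hf j)).trans (A.coeFn_pullS hΓ j g).symm)
  · rw [← rpow_half_sq (energy volume (anisoIndex d s φ) (f j))]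
    exact pow_le_pow_left' (hfb j).le 2

/-- In the chart `i`, the glued function is a sum over `j` of pieces transported from the chart `j`,
each bounded by the change of charts. -/
theorem normS_glue_sq_le (τ : ℝ) {s : ℝ} (hs : 0 < s) {φ : ℝ → ℝ} (hφ : ClassM φ) :
    ∃ C : ℝ≥0, ∀ f : ι → L2 (SpaceTime d), A.normS τ s φ (A.glue hΓ τ f) ^ 2 ≤
      C * ∑ j, energy volume (anisoIndex d s φ) (f j) := by
  choose C hC using fun i j => A.exists_stripInv_eq_pullS_pushS (τ := τ) hΓ hs hφ i j
  obtain ⟨D, hD⟩ := energy_sum_le (ν := volume) (measurable_anisoIndex (d := d) s hφ)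
    (Finset.univ (α := ι))
  refine ⟨D * ∑ i, ∑ j, C i j, fun f => ?_⟩
  choose F hF hFC using fun i j => hC i j (f j)
  refine (A.normS_sq_le hΓ s φ (f := fun i => ∑ j, F i j) fun i => ?_).trans ?_
  · rw [glue_apply, map_sum, map_sum]
    exact Finset.sum_congr rfl fun j _ => hF i j
  · rw [ENNReal.coe_mul, ENNReal.ofNNReal_finsetSum, mul_assoc, Finset.sum_mul, Finset.mul_sum]
    refine Finset.sum_le_sum fun i _ => (hD (F i)).trans (mul_le_mul_right ?_ _)
    rw [ENNReal.ofNNReal_finsetSum, Finset.sum_mul]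
    refine Finset.sum_le_sum fun j _ => (hFC i j).trans (mul_le_mul_right ?_ _)
    exact Finset.single_le_sum (f := fun j => energy volume (anisoIndex d s φ) (f j))
      (fun _ _ => zero_le) (Finset.mem_univ j)

/-- The functions of finite norm are the image, under the linear map `glue`, of the families of
finite energy. Linearity of the space and approximation within it can thus be treated on the Fourier
side. -/
theorem normS_lt_top_iff {s : ℝ} (hs : 0 < s) {φ : ℝ → ℝ} (hφ : ClassM φ) {g : L2S Γ τ} :
    A.normS τ s φ g < ⊤ ↔ ∃ f : ι → L2 (SpaceTime d),
      (∀ j, energy volume (anisoIndex d s φ) (f j) < ⊤) ∧ A.glue hΓ τ f = g := by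
  constructor
  · intro h
    obtain ⟨b, hb, hb'⟩ := exists_between h
    obtain ⟨f, hf, hfb⟩ := A.exists_of_normS_lt hΓ hs hφ hb
    exact ⟨f, fun j => (hfb j).trans_lt (ENNReal.pow_lt_top hb'), A.glue_eq hΓ hf⟩
  · rintro ⟨f, hf, rfl⟩
    obtain ⟨C, hC⟩ := A.normS_glue_sq_le hΓ τ hs hφ
    have h := (hC f).trans_lt (ENNReal.mul_lt_top (by simp) (ENNReal.sum_lt_top.2 fun j _ => hf j))
    exact lt_top_iff_ne_top.2 fun h' => by simp [h'] at h

end AtlasWithPartition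

end

end CauchyData

namespace CauchyData

noncomputable section

/-! ### Initial traces -/

theorem memLp_initialSchwartz {τ : ℝ} (hτ : 0 < τ) (k n : ℕ) :
    MemLp (initialSchwartz hτ k n) 2 (volume.restrict (Ioo 0 τ)) :=
  ((initialSchwartz hτ k n).memLp 2 volume).restrict _

section IsTrace

variable {X Y : Type*} [MeasurableSpace X] [MeasurableSpace Y] {ν : Measure X} {μ : Measure Y}
  {τ : ℝ}

/-- `v` is the trace at `t = 0` of the `k`-th derivative in time of `g`. -/
def IsTrace (hτ : 0 < τ) (k : ℕ) (g : Lp ℂ 2 (ν.prod (volume.restrict (Ioo 0 τ))))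
    (v : Lp ℂ 2 ν) : Prop :=
  Tendsto (fun n => average (memLp_initialSchwartz hτ k n) g) atTop (𝓝 v)

namespace IsTrace

variable {hτ : 0 < τ} {k : ℕ} {g g' : Lp ℂ 2 (ν.prod (volume.restrict (Ioo 0 τ)))}
  {v v' : Lp ℂ 2 ν}

theorem unique (h : IsTrace hτ k g v) (h' : IsTrace hτ k g v') : v = v' :=
  tendsto_nhds_unique h h'

theorem add (h : IsTrace hτ k g v) (h' : IsTrace hτ k g' v') :
    IsTrace hτ k (g + g') (v + v') := by
  simp only [IsTrace, map_add]
  exact Tendsto.add h h'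

theorem const_smul (h : IsTrace hτ k g v) (c : ℂ) : IsTrace hτ k (c • g) (c • v) := by
  simp only [IsTrace, map_smul]
  exact Tendsto.const_smul h c

theorem sum {ι : Type*} {S : Finset ι} {G : ι → Lp ℂ 2 (ν.prod (volume.restrict (Ioo 0 τ)))}
    {V : ι → Lp ℂ 2 ν} (h : ∀ j ∈ S, IsTrace hτ k (G j) (V j)) :
    IsTrace hτ k (∑ j ∈ S, G j) (∑ j ∈ S, V j) := by
  simp only [IsTrace, map_sum]
  exact tendsto_finsetSum S h

theorem op [SFinite ν] [SFinite μ] {a : Y → ℂ} {ρ : Y → X} (hb : BoundedComp a ρ μ ν)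
    (h : IsTrace hτ k g v) :
    IsTrace hτ k ((hb.prod (volume.restrict (Ioo 0 τ))).op g) (hb.op v) := by
  refine ((hb.continuous_op.tendsto v).comp h).congr fun n => ?_
  exact (average_prod_op hb (memLp_initialSchwartz hτ k n) g).symm

/-- The trace of a function with smooth dependence on time. -/
theorem ae_eq_iteratedDerivWithin [SFinite ν] {G : X × ℝ → ℂ}
    (hG : g =ᵐ[ν.prod (volume.restrict (Ioo 0 τ))] G)
    (hs : ∀ᵐ y ∂ν, ContDiffOn ℝ ∞ (fun t => G (y, t)) (Icc 0 τ)) (h : IsTrace hτ k g v) :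
    v =ᵐ[ν] fun y => iteratedDerivWithin k (fun t => G (y, t)) (Icc 0 τ) 0 := by
  -- Convergence in `L₂` gives convergence almost everywhere along a subsequence, whose pointwise
  -- limits are the classical one-sided derivatives.
  obtain ⟨ns, hns, hlim⟩ := (tendstoInMeasure_of_tendsto_Lp h).exists_seq_tendsto_ae
  have hav : ∀ᵐ y ∂ν, ∀ n, average (memLp_initialSchwartz hτ k n) g y =
      ∫ t in Ioo 0 τ, G (y, t) * initialSchwartz hτ k n t :=
    ae_all_iff.2 fun n => coeFn_average_congr (memLp_initialSchwartz hτ k n) hG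
  filter_upwards [hlim, hav, hs] with y h1 h2 h3
  simp only [h2] at h1
  exact tendsto_nhds_unique h1
    ((tendsto_integral_mul_initialSchwartz hτ h3 k).comp hns.tendsto_atTop)

end IsTrace

end IsTrace

/-- The averages of `𝓕⁻ f` over the strip are inverse transforms of averages of `f` against the
symbols of the kernels. These symbols are dominated by `|2πη|^k` and converge to `(2πiη)^k`, so the
limit is the moment. -/
theorem exists_isTrace_stripInv {d : ℕ} {τ : ℝ} (hτ : 0 < τ) {s : ℝ} {φ : ℝ → ℝ} (hφ : ClassM φ)
    {k : ℕ} (hs : 2 * k + 1 < s) : ∃ C : ℝ≥0, ∀ f : L2 (SpaceTime d),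
      energy volume (anisoIndex d s φ) f < ⊤ → ∃ p : L2 (Eucl d), p =ᵐ[volume] moment k f ∧
        energy volume (isoIndex d (s - 2 * k - 1) φ) p ≤ C * energy volume (anisoIndex d s φ) f ∧
        IsTrace hτ k (stripInv d τ f) (𝓕⁻ p) := by
  obtain ⟨C, hC⟩ := exists_moment (d := d) hφ hs
  refine ⟨C, fun f hf => ?_⟩
  obtain ⟨p, hp, hpC, hlim⟩ := hC f hf
  refine ⟨p, hp, hpC, ?_⟩
  have h1 := hlim (fun n => (𝓕⁻ (initialSchwartz hτ k n) : 𝓢(ℝ, ℂ)))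
    (fun n => (𝓕⁻ (initialSchwartz hτ k n) : 𝓢(ℝ, ℂ)).memLp 2 volume)
    (fun n η => norm_fourierInv_initialSchwartz_le hτ k n η)
    (fun η => tendsto_fourierInv_initialSchwartz hτ k η)
  have h2 := ((FourierTransform.fourierInvCLM ℂ (L2 (Eucl d))).continuous.tendsto p).comp h1
  refine h2.congr fun n => ?_
  rw [stripInv_apply, average_fourierInv Measure.restrict_le_self (initialSchwartz hτ k n)
    (hasCompactSupport_initialKernel hτ k n) (integral_mul_initialSchwartz hτ k n)]
  rfl

namespace AtlasWithPartition

variable {d : ℕ} {Γ : Set (Eucl (d + 1))} {ι : Type} [Fintype ι] (A : AtlasWithPartition Γ ι)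
  (hΓ : IsCompact Γ)

/-- Over all of `ℝ^d` a function has only one extension, so the infimum in the quotient norm is the
energy of its transform. -/
theorem normΓ_sq {σ : ℝ} (hσ : 0 < σ) {φ : ℝ → ℝ} (hφ : ClassM φ) (v : L2Γ Γ) :
    A.normΓ σ φ v ^ 2 = ∑ j, energy volume (isoIndex d σ φ) (𝓕 (A.pull hΓ j v) : L2 (Eucl d)) := by
  rw [normΓ, rpow_half_sq]
  refine Finset.sum_congr rfl fun j _ => ?_
  rw [← rpow_half_sq (energy volume (isoIndex d σ φ) (𝓕 (A.pull hΓ j v) : L2 (Eucl d)))]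
  congr 1
  refine le_antisymm (hormanderNormOn_le ?_) (le_of_forall_gt fun b hb => ?_)
  · rw [FourierTransform.fourierInv_fourier_eq, Measure.restrict_univ]
    exact A.coeFn_pull hΓ j v
  · obtain ⟨c, hc0, hc⟩ := exists_le_isoIndex (d := d) hσ hφ
    obtain ⟨f, hf, hfb⟩ := exists_of_hormanderNormOn_lt isOpen_univ hc0 hc hb
    rw [Measure.restrict_univ] at hf
    have h1 : 𝓕⁻ f = A.pull hΓ j v := Lp.ext (hf.trans (A.coeFn_pull hΓ j v).symm)
    rwa [← h1, FourierTransform.fourier_fourierInv_eq]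

theorem normData_sq {r : ℕ} {s : ℝ} (hs : 2 * (r : ℝ) - 1 < s) {φ : ℝ → ℝ} (hφ : ClassM φ)
    (v : Fin r → L2Γ Γ) :
    A.normData s φ v ^ 2 = ∑ k : Fin r, ∑ j,
      energy volume (isoIndex d (s - 2 * (k : ℕ) - 1) φ) (𝓕 (A.pull hΓ j (v k)) : L2 (Eucl d)) := by
  rw [normData, rpow_half_sq]
  refine Finset.sum_congr rfl fun k _ => A.normΓ_sq hΓ ?_ hφ (v k)
  have : ((k : ℕ) : ℝ) + 1 ≤ r := by exact_mod_cast k.2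
  linarith

/-- The embedding of the data space in `L₂`. -/
theorem exists_enorm_le_normData {r : ℕ} {s : ℝ} (hs : 2 * (r : ℝ) - 1 < s) {φ : ℝ → ℝ}
    (hφ : ClassM φ) (hΓ : IsCompact Γ) (k : Fin r) : ∃ C : ℝ≥0, ∀ v : Fin r → L2Γ Γ,
      ‖v k‖ₑ ^ 2 ≤ C * A.normData s φ v ^ 2 := by
  have hk : 0 < s - 2 * ((k : ℕ) : ℝ) - 1 := by
    have : ((k : ℕ) : ℝ) + 1 ≤ r := by exact_mod_cast k.2
    linarith
  obtain ⟨c, hc0, hc⟩ := exists_le_isoIndex (d := d) hk hφ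
  obtain ⟨C₁, hC₁⟩ := lintegral_sq_le_energy (ν := volume) hc0 hc
  choose C₂ hC₂ using fun j => (A.boundedComp_push hΓ j).lintegral_le
  obtain ⟨C₃, hC₃⟩ := energy_sum_le (ν := surfaceMeasure Γ) (μ := fun _ => 1) measurable_const
    (Finset.univ (α := ι))
  have he : ∀ w : L2Γ Γ, energy (surfaceMeasure Γ) (fun _ => 1) w = ‖w‖ₑ ^ 2 := fun w => by
    rw [Lp.enorm_def, eLpNorm_two_sq, energy]
    simp
  refine ⟨C₃ * ((∑ j, C₂ j) * C₁), fun v => ?_⟩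
  have h1 := hC₃ fun j => A.push hΓ j (A.pull hΓ j (v k))
  rw [sum_push_pull, he] at h1
  refine h1.trans ?_
  rw [ENNReal.coe_mul, mul_assoc]
  refine mul_le_mul_right ?_ _
  rw [ENNReal.coe_mul, ENNReal.ofNNReal_finsetSum, mul_assoc, Finset.sum_mul]
  refine Finset.sum_le_sum fun j _ => ?_
  rw [he, Lp.enorm_def, eLpNorm_two_sq, push, lintegral_sq_congr (BoundedComp.coeFn_op _ _)]
  refine (hC₂ j _ (Lp.aestronglyMeasurable _)).trans (mul_le_mul_right ?_ _)
  rw [← lintegral_enorm_fourier_sq]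
  refine (hC₁ _).trans (mul_le_mul_right ?_ _)
  rw [A.normData_sq hΓ hs hφ]
  refine le_trans ?_ (Finset.single_le_sum (f := fun k : Fin r => ∑ j,
    energy volume (isoIndex d (s - 2 * (k : ℕ) - 1) φ) (𝓕 (A.pull hΓ j (v k)) : L2 (Eucl d)))
      (fun _ _ => zero_le) (Finset.mem_univ k))
  exact Finset.single_le_sum (f := fun j => energy volume (isoIndex d (s - 2 * (k : ℕ) - 1) φ)
    (𝓕 (A.pull hΓ j (v k)) : L2 (Eucl d))) (fun _ _ => zero_le) (Finset.mem_univ j)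

theorem SmoothOnClosure.contDiffOn_time {A : AtlasWithPartition Γ ι}
    {τ : ℝ} {g : Eucl (d + 1) × ℝ → ℂ} (hg : A.SmoothOnClosure τ g) {y : Eucl (d + 1)} (hy : y ∈ Γ) :
    ContDiffOn ℝ ∞ (fun t => g (y, t)) (Icc 0 τ) := by
  obtain ⟨j, x, rfl⟩ := mem_iUnion.1 (A.cover hy)
  exact (hg j).comp (contDiff_const.prodMk contDiff_id).contDiffOn fun t ht => ⟨mem_univ _, ht⟩

variable [IsFiniteMeasure (surfaceMeasure Γ)] {τ : ℝ} (hτ : 0 < τ)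

theorem isTrace_pullS {k : ℕ} {g : L2S Γ τ} {v : L2Γ Γ} (h : IsTrace hτ k g v) (j : ι) :
    IsTrace hτ k (A.pullS hΓ j g) (A.pull hΓ j v) :=
  IsTrace.op (A.boundedComp_pull hΓ j) h

theorem isTrace_glue {k : ℕ} {f : ι → L2 (SpaceTime d)} {p : ι → L2 (Eucl d)}
    (h : ∀ j, IsTrace hτ k (stripInv d τ (f j)) (𝓕⁻ (p j))) :
    IsTrace hτ k (A.glue hΓ τ f : L2S Γ τ) (∑ j, A.push hΓ j (𝓕⁻ (p j))) := by
  rw [glue_apply]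
  exact IsTrace.sum fun j _ => IsTrace.op (A.boundedComp_push hΓ j) (h j)

theorem exists_isTrace {s : ℝ} {φ : ℝ → ℝ} (hφ : ClassM φ) (hΓ : IsCompact Γ) {k : ℕ}
    (hs : 2 * k + 1 < s) {g : L2S Γ τ} (hg : A.normS τ s φ g < ⊤) :
    ∃ v : L2Γ Γ, IsTrace hτ k g v := by
  have hs0 : 0 < s := by have := k.cast_nonneg (α := ℝ); linarith
  obtain ⟨f, hf, rfl⟩ := (A.normS_lt_top_iff hΓ hs0 hφ).1 hg
  obtain ⟨C, hC⟩ := exists_isTrace_stripInv (d := d) hτ hφ hs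
  choose p _ _ hp using fun j => hC (f j) (hf j)
  exact ⟨_, A.isTrace_glue hΓ hτ hp⟩

/-- Localization commutes with traces, so by uniqueness the localized trace is given by a moment of
a nearly optimal extension in the same chart. No change of charts enters. -/
theorem exists_normΓ_isTrace_le {s : ℝ} {φ : ℝ → ℝ} (hφ : ClassM φ) (hΓ : IsCompact Γ) {k : ℕ}
    (hs : 2 * k + 1 < s) : ∃ C : ℝ≥0, ∀ (g : L2S Γ τ) (v : L2Γ Γ), A.normS τ s φ g < ⊤ →
      IsTrace hτ k g v → A.normΓ (s - 2 * k - 1) φ v ^ 2 ≤ C * A.normS τ s φ g ^ 2 := by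
  have hs0 : 0 < s := by have := k.cast_nonneg (α := ℝ); linarith
  obtain ⟨C, hC⟩ := exists_isTrace_stripInv (d := d) hτ hφ hs
  refine ⟨Fintype.card ι * C, fun g v hg hv => le_mul_sq_of_forall_lt hg fun b hb => ?_⟩
  -- An intermediate value is finite even if `b` is infinite.
  obtain ⟨b', hb', hbb'⟩ := exists_between hb
  have hb'' : b' < ⊤ := hbb'.trans_le le_top
  obtain ⟨f, hf, hfb⟩ := A.exists_of_normS_lt hΓ hs0 hφ hb'
  rw [A.normΓ_sq hΓ (by linarith) hφ]
  have hj : ∀ j, energy volume (isoIndex d (s - 2 * k - 1) φ) (𝓕 (A.pull hΓ j v) : L2 (Eucl d)) ≤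
      C * b ^ 2 := fun j => by
    obtain ⟨p, -, hpC, hp⟩ := hC (f j) ((hfb j).trans_lt (ENNReal.pow_lt_top hb''))
    rw [hf j] at hp
    rw [(A.isTrace_pullS hΓ hτ hv j).unique hp, FourierTransform.fourier_fourierInv_eq]
    exact hpC.trans (mul_le_mul_right ((hfb j).trans (pow_le_pow_left' hbb'.le 2)) _)
  refine (Finset.sum_le_sum fun j _ => hj j).trans ?_
  rw [Finset.sum_const, Finset.card_univ, nsmul_eq_mul, ENNReal.coe_mul, mul_assoc]
  simp

/-- Each smooth function belongs to the anisotropic spaces. -/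
theorem exists_normS_lt_top_of_smooth (hτ : 0 < τ) (hΓ : IsCompact Γ) {s : ℝ} (hs : 0 < s)
    {φ : ℝ → ℝ} (hφ : ClassM φ) {g : Eucl (d + 1) × ℝ → ℂ} (hg : A.SmoothOnClosure τ g) :
    ∃ h : L2S Γ τ, A.normS τ s φ h < ⊤ ∧ h =ᵐ[lateralMeasure Γ τ] g := by
  obtain ⟨N, hN⟩ := exists_energy_lt_top_of_contDiff (d := d) s hφ
  have hU : ∀ j, ∃ U : Eucl d × ℝ → ℂ, ContDiff ℝ N U ∧ HasCompactSupport U ∧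
      EqOn U (fun p => A.coeff j p.1 * g (A.θ j p.1, p.2)) (univ ×ˢ Icc 0 τ) := fun j => by
    refine exists_contDiff_extension hτ ?_ (A.hasCompactSupport_coeff hΓ j) (fun p hp => ?_) N
    · exact (((A.contDiff_coeff j).comp contDiff_fst).contDiffOn).mul (hg j)
    · rw [image_eq_zero_of_notMem_tsupport hp, zero_mul]
  choose U hU hUc hUe using hU
  have hF : ∀ j, ∃ f : L2 (SpaceTime d),
      (𝓕⁻ f : L2 (SpaceTime d)) =ᵐ[volume] (fun z => U j (WithLp.ofLp z)) ∧
        energy volume (anisoIndex d s φ) f < ⊤ := fun j => by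
    refine hN _ ?_ ?_
    · exact (hU j).comp (WithLp.prodContinuousLinearEquiv 2 ℝ (Eucl d) ℝ).contDiff
    · exact (hUc j).comp_homeomorph
        (WithLp.prodContinuousLinearEquiv 2 ℝ (Eucl d) ℝ).toHomeomorph
  choose f hf hfe using hF
  refine ⟨A.glue hΓ τ f, (A.normS_lt_top_iff hΓ hs hφ).2 ⟨f, hfe, rfl⟩, ?_⟩
  rw [glue_apply]
  refine A.ae_eq_sum_pushS hΓ fun j => ?_
  have h1 := (boundedComp_toLp (d := d) (κ := volume.restrict (Ioo 0 τ))
    Measure.restrict_le_self).coeFn_op_of_ae_eq (hf j)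
  have h2 : ∀ᵐ p ∂(volume : Measure (Eucl d)).prod (volume.restrict (Ioo 0 τ)), p.2 ∈ Ioo 0 τ :=
    Measure.quasiMeasurePreserving_snd.ae (ae_restrict_mem measurableSet_Ioo)
  filter_upwards [h1, h2] with p hp1 hp2
  rw [stripInv_apply, hp1, one_mul]
  exact hUe j ⟨mem_univ _, Ioo_subset_Icc_self hp2⟩

/-- The operator of the initial traces. -/
theorem exists_traceOperator (r : ℕ) (hΓ : IsCompact Γ) {s : ℝ} (hs : 2 * (r : ℝ) - 1 < s)
    (hs0 : 0 < s) {φ : ℝ → ℝ} (hφ : ClassM φ) :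
    ∃ R : L2S Γ τ →ₗ.[ℂ] (Fin r → L2Γ Γ), A.IsCauchyDataOperator τ r s φ R ∧
      ∀ (g : R.domain) (k : Fin r), IsTrace hτ k (g : L2S Γ τ) (R g k) := by
  have hk : ∀ k : Fin r, 2 * ((k : ℕ) : ℝ) + 1 < s := fun k => by
    have : ((k : ℕ) : ℝ) + 1 ≤ r := by exact_mod_cast k.2
    linarith
  have hμ := measurable_anisoIndex (d := d) s hφ
  let D : Submodule ℂ (L2S Γ τ) :=
    { carrier := {g | A.normS τ s φ g < ⊤}
      zero_mem' := (A.normS_lt_top_iff hΓ hs0 hφ).2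
        ⟨0, fun j => by rw [Pi.zero_apply, energy_zero]; simp, map_zero _⟩
      add_mem' := fun {g g'} hg hg' => by
        obtain ⟨f, hf, rfl⟩ := (A.normS_lt_top_iff hΓ hs0 hφ).1 hg
        obtain ⟨f', hf', rfl⟩ := (A.normS_lt_top_iff hΓ hs0 hφ).1 hg'
        refine (A.normS_lt_top_iff hΓ hs0 hφ).2 ⟨f + f', fun j => ?_, map_add _ _ _⟩
        refine (energy_coeFn_add_le hμ _ _).trans_lt (ENNReal.add_lt_top.2 ⟨?_, ?_⟩)
        · exact ENNReal.mul_lt_top (by simp) (hf j)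
        · exact ENNReal.mul_lt_top (by simp) (hf' j)
      smul_mem' := fun c g hg => by
        obtain ⟨f, hf, rfl⟩ := (A.normS_lt_top_iff hΓ hs0 hφ).1 hg
        refine (A.normS_lt_top_iff hΓ hs0 hφ).2 ⟨c • f, fun j => ?_, map_smul _ _ _⟩
        rw [Pi.smul_apply, energy_smul]
        exact ENNReal.mul_lt_top (by finiteness) (hf j) }
  choose R₀ hR₀ using fun (g : D) (k : Fin r) => A.exists_isTrace hτ hφ hΓ (hk k) g.2
  -- Linearity follows from uniqueness of traces: the sum of two traces is a trace of the sum.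
  let R : L2S Γ τ →ₗ.[ℂ] (Fin r → L2Γ Γ) :=
    { domain := D
      toFun :=
        { toFun := R₀
          map_add' := fun g g' => funext fun k =>
            (hR₀ (g + g') k).unique ((hR₀ g k).add (hR₀ g' k))
          map_smul' := fun c g => funext fun k =>
            (hR₀ (c • g) k).unique ((hR₀ g k).const_smul c) } }
  refine ⟨R, ⟨fun g => Iff.rfl, ?_, fun g hg => ?_⟩, hR₀⟩
  · choose C hC using fun k : Fin r => A.exists_normΓ_isTrace_le hτ hφ hΓ (hk k)
    refine ⟨NNReal.sqrt (∑ k, C k), fun g => le_sqrt_mul_of_sq_le ?_⟩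
    rw [normData, rpow_half_sq, ENNReal.ofNNReal_finsetSum, Finset.sum_mul]
    exact Finset.sum_le_sum fun k _ => hC k g (R g k) g.2 (hR₀ g k)
  · obtain ⟨h, hh, he⟩ := A.exists_normS_lt_top_of_smooth hτ hΓ hs0 hφ hg
    refine ⟨⟨h, hh⟩, he, fun k => ?_⟩
    exact (hR₀ ⟨h, hh⟩ k).ae_eq_iteratedDerivWithin he
      ((ae_mem hΓ).mono fun y hy => hg.contDiffOn_time hy)

end AtlasWithPartition

end

end CauchyData

namespace CauchyData

noncomputable section

/-! ### Uniqueness of the operator and its right inverse -/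

namespace AtlasWithPartition

variable {d : ℕ} {Γ : Set (Eucl (d + 1))} {ι : Type} [Fintype ι] (A : AtlasWithPartition Γ ι)
  (hΓ : IsCompact Γ) [IsFiniteMeasure (surfaceMeasure Γ)] {τ : ℝ}

/-- Functions glued from functions with compactly supported Fourier transforms are smooth. -/
theorem exists_smooth_glue_truncate (τ : ℝ) (n : ℕ) (f : ι → L2 (SpaceTime d)) :
    ∃ g : Eucl (d + 1) × ℝ → ℂ, A.SmoothOnClosure τ g ∧
      A.glue hΓ τ (fun j => truncate n (f j)) =ᵐ[lateralMeasure Γ τ] g := by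
  choose W hW hWe using fun j => exists_contDiff_fourierInv_truncate n (f j)
  refine ⟨fun p => ∑ j, Function.extend (A.θ j) (A.cut hΓ j) 0 p.1 *
    W j (WithLp.toLp 2 (chartInv (A.θ j) p.1, p.2)), fun i => ?_, ?_⟩
  · refine ContDiff.contDiffOn (ContDiff.sum fun j _ => ?_)
    exact (A.isChart i).contDiff_push (A.isChart j) (A.contDiff_cut hΓ j)
      (A.hasCompactSupport_cut hΓ j)
      (F := fun p => W j (WithLp.toLp 2 p))
      ((hW j).comp (WithLp.prodContinuousLinearEquiv 2 ℝ (Eucl d) ℝ).symm.contDiff)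
  · rw [glue_apply]
    have h : ∀ᵐ p ∂lateralMeasure Γ τ, ∀ j, A.pushS hΓ j (stripInv d τ (truncate n (f j))) p =
        Function.extend (A.θ j) (A.cut hΓ j) 0 p.1 *
          W j (WithLp.toLp 2 (chartInv (A.θ j) p.1, p.2)) := by
      rw [ae_all_iff]
      intro j
      have h1 := (boundedComp_toLp (d := d) (κ := volume.restrict (Ioo 0 τ))
        Measure.restrict_le_self).coeFn_op_of_ae_eq (hWe j)
      filter_upwards [(A.boundedComp_pushS hΓ τ j).coeFn_op_of_ae_eq h1] with p hp
      refine hp.trans ?_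
      rw [one_mul]
      rfl
    filter_upwards [h, Lp.coeFn_finsetSum Finset.univ
      fun j => A.pushS hΓ j (stripInv d τ (truncate n (f j)))] with p h1 h2
    rw [h2, Finset.sum_apply]
    exact Finset.sum_congr rfl fun j _ => h1 j

/-- Truncating the frequencies of the glued pieces gives smooth functions `G n` that converge to `g`
in the norm of the space. Both operators have the same classical values on them, and both are
continuous into `L₂(Γ)`. -/
theorem IsCauchyDataOperator.eq {A : AtlasWithPartition Γ ι} (hΓ : IsCompact Γ) {r : ℕ} {s : ℝ}
    (hs : 2 * (r : ℝ) - 1 < s) (hs0 : 0 < s) {φ : ℝ → ℝ} (hφ : ClassM φ)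
    {R R' : L2S Γ τ →ₗ.[ℂ] (Fin r → L2Γ Γ)} (hR : A.IsCauchyDataOperator τ r s φ R)
    (hR' : A.IsCauchyDataOperator τ r s φ R') : R = R' := by
  have hdom : R.domain = R'.domain := Submodule.ext fun g => (hR.domain g).trans (hR'.domain g).symm
  refine LinearPMap.ext hdom fun g hg hg' => funext fun k => ?_
  obtain ⟨f, hf, hfg⟩ := (A.normS_lt_top_iff hΓ hs0 hφ).1 ((hR.domain g).1 hg)
  obtain ⟨C, hC⟩ := hR.bounded
  obtain ⟨C', hC'⟩ := hR'.bounded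
  obtain ⟨K, hK⟩ := A.exists_enorm_le_normData hs hφ hΓ k
  obtain ⟨D, hD⟩ := A.normS_glue_sq_le hΓ τ hs0 hφ
  set G : ℕ → L2S Γ τ := fun n => A.glue hΓ τ fun j => truncate n (f j) with hG
  have hsm : ∀ n, ∃ (h : G n ∈ R.domain) (h' : G n ∈ R'.domain),
      R ⟨G n, h⟩ k = R' ⟨G n, h'⟩ k := fun n => by
    obtain ⟨u, hu, hue⟩ := A.exists_smooth_glue_truncate hΓ τ n f
    obtain ⟨h, he, hk⟩ := hR.extends_smooth u hu
    obtain ⟨h', he', hk'⟩ := hR'.extends_smooth u hu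
    have e1 : (h : L2S Γ τ) = G n := Lp.ext (he.trans hue.symm)
    have e2 : (h' : L2S Γ τ) = G n := Lp.ext (he'.trans hue.symm)
    refine ⟨e1 ▸ h.2, e2 ▸ h'.2, ?_⟩
    have e3 : (⟨G n, e1 ▸ h.2⟩ : R.domain) = h := Subtype.ext e1.symm
    have e4 : (⟨G n, e2 ▸ h'.2⟩ : R'.domain) = h' := Subtype.ext e2.symm
    rw [e3, e4]
    exact Lp.ext ((hk k).trans (hk' k).symm)
  choose hGd hGd' hGe using hsm
  have hlim : Tendsto (fun n => A.normS τ s φ (g - G n) ^ 2) atTop (𝓝 0) := by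
    have h1 : Tendsto (fun n => (D : ℝ≥0∞) * ∑ j, energy volume (anisoIndex d s φ)
        (f j - truncate n (f j) : L2 (SpaceTime d))) atTop (𝓝 0) := by
      have h2 := tendsto_finsetSum (Finset.univ (α := ι)) fun j _ =>
        tendsto_energy_sub_truncate (measurable_anisoIndex s hφ) (hf j)
      rw [Finset.sum_const_zero] at h2
      have h3 := ENNReal.Tendsto.const_mul (a := (D : ℝ≥0∞)) h2 (Or.inr ENNReal.coe_ne_top)
      rwa [mul_zero] at h3
    refine tendsto_of_tendsto_of_tendsto_of_le_of_le tendsto_const_nhds h1 (fun _ => zero_le)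
      fun n => ?_
    have h4 : g - G n = A.glue hΓ τ fun j => f j - truncate n (f j) := by
      rw [← hfg, hG, ← map_sub]
      rfl
    rw [h4]
    exact hD _
  -- Continuity is measured in `L₂(Γ)`, into which the data space embeds; there limits are unique.
  have hbd : ∀ (Q : L2S Γ τ →ₗ.[ℂ] (Fin r → L2Γ Γ)) (B : ℝ≥0),
      (∀ h : Q.domain, A.normData s φ (Q h) ≤ B * A.normS τ s φ (h : L2S Γ τ)) →
      ∀ (hg : g ∈ Q.domain) (hG : ∀ n, G n ∈ Q.domain),
        Tendsto (fun n => Q ⟨G n, hG n⟩ k) atTop (𝓝 (Q ⟨g, hg⟩ k)) := by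
    intro Q B hB hg hG
    rw [tendsto_iff_edist_tendsto_0]
    have h1 : Tendsto (fun n => (K * B ^ 2 : ℝ≥0∞) * A.normS τ s φ (g - G n) ^ 2) atTop (𝓝 0) := by
      have h3 := ENNReal.Tendsto.const_mul (a := (K * B ^ 2 : ℝ≥0∞)) hlim
        (Or.inr (by finiteness))
      rwa [mul_zero] at h3
    have h2 : Tendsto (fun n => edist (Q ⟨G n, hG n⟩ k) (Q ⟨g, hg⟩ k) ^ 2) atTop (𝓝 0) := by
      refine tendsto_of_tendsto_of_tendsto_of_le_of_le tendsto_const_nhds h1 (fun _ => zero_le)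
        fun n => ?_
      have h4 : Q ⟨g, hg⟩ k - Q ⟨G n, hG n⟩ k =
          Q (⟨g, hg⟩ - ⟨G n, hG n⟩) k := by rw [Q.map_sub]; rfl
      rw [edist_comm, edist_eq_enorm_sub, h4]
      refine (hK _).trans ?_
      rw [mul_assoc, ← mul_pow]
      exact mul_le_mul_right (pow_le_pow_left' (hB _) 2) _
    have h5 := ((ENNReal.continuous_rpow_const (y := (1 / 2 : ℝ))).tendsto 0).comp h2
    rw [ENNReal.zero_rpow_of_pos (by norm_num)] at h5
    refine h5.congr fun n => ?_
    rw [Function.comp, ← ENNReal.rpow_natCast, ← ENNReal.rpow_mul]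
    norm_num
  refine tendsto_nhds_unique (hbd R C hC hg hGd) ?_
  simp only [hGe]
  exact hbd R' C' hC' hg' hGd'

/-- The right inverse of the operator of the initial traces, for given profiles in time. -/
def extension (τ : ℝ) (B : ℕ → 𝓢(ℝ, ℂ)) (r : ℕ) : (Fin r → L2Γ Γ) →ₗ[ℂ] L2S Γ τ :=
  ∑ k : Fin r, A.glue hΓ τ ∘ₗ LinearMap.pi (fun j => scaleOp k (B k) ∘ₗ
    (FourierTransform.fourierCLM ℂ (L2 (Eucl d))).toLinearMap ∘ₗ A.pull hΓ j) ∘ₗ LinearMap.proj k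

theorem extension_apply (B : ℕ → 𝓢(ℝ, ℂ)) {r : ℕ} (v : Fin r → L2Γ Γ) :
    A.extension hΓ τ B r v = ∑ k : Fin r, A.glue hΓ τ fun j =>
      scaleOp k (B k) (𝓕 (A.pull hΓ j (v k))) := by
  rw [extension, LinearMap.sum_apply]
  rfl

theorem extension_eq_glue (B : ℕ → 𝓢(ℝ, ℂ)) {r : ℕ} (v : Fin r → L2Γ Γ) :
    A.extension hΓ τ B r v = A.glue hΓ τ fun j => ∑ k : Fin r,
      scaleOp k (B k) (𝓕 (A.pull hΓ j (v k))) := by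
  rw [extension_apply, ← map_sum]
  congr 1
  ext1 j
  rw [Finset.sum_apply]

theorem normS_extension_le (τ : ℝ) (B : ℕ → 𝓢(ℝ, ℂ)) {r : ℕ} {s : ℝ} (hs : 2 * (r : ℝ) - 1 < s)
    (hs0 : 0 < s) {φ : ℝ → ℝ} (hφ : ClassM φ) : ∃ C : ℝ≥0, ∀ v : Fin r → L2Γ Γ,
      A.normS τ s φ (A.extension hΓ τ B r v) ≤ C * A.normData s φ v := by
  obtain ⟨D, hD⟩ := A.normS_glue_sq_le hΓ τ hs0 hφ
  obtain ⟨K, hK⟩ := energy_sum_le (ν := volume) (measurable_anisoIndex (d := d) s hφ)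
    (Finset.univ (α := Fin r))
  choose C hC using fun k : Fin r => energy_scaleOp_le (d := d) (s := s) hφ k (B k)
  refine ⟨NNReal.sqrt (D * (K * ∑ k, C k)), fun v => le_sqrt_mul_of_sq_le ?_⟩
  rw [extension_eq_glue, A.normData_sq hΓ hs hφ, Finset.sum_comm]
  refine (hD _).trans ?_
  rw [ENNReal.coe_mul, mul_assoc, Finset.mul_sum (s := Finset.univ (α := ι)) (a := ((K * ∑ k, C k : ℝ≥0) : ℝ≥0∞))]
  refine mul_le_mul_right (Finset.sum_le_sum fun j _ => (hK _).trans ?_) _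
  rw [ENNReal.coe_mul, mul_assoc, ENNReal.ofNNReal_finsetSum, Finset.sum_mul]
  refine mul_le_mul_right (Finset.sum_le_sum fun k _ => (hC k _).trans (mul_le_mul_right ?_ _)) _
  exact Finset.single_le_sum (f := fun k : Fin r => energy volume
    (isoIndex d (s - 2 * (k : ℕ) - 1) φ) (𝓕 (A.pull hΓ j (v k)) : L2 (Eucl d)))
    (fun _ _ => zero_le) (Finset.mem_univ k)

/-- In each chart, the `l`-th moment of the piece built from `v k` is the transform of the localized
`v k` for `l = k`, and zero otherwise. Gluing the localizations reassembles `v k`. -/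
theorem isTrace_extension (hτ : 0 < τ) {B : ℕ → 𝓢(ℝ, ℂ)}
    (hB : ∀ k l : ℕ, ∫ η : ℝ, (2 * Real.pi * Complex.I * η) ^ l * B k η = if l = k then 1 else 0)
    {r : ℕ} {s : ℝ} (hs : 2 * (r : ℝ) - 1 < s) {φ : ℝ → ℝ} (hφ : ClassM φ)
    {v : Fin r → L2Γ Γ} (hv : A.normData s φ v < ⊤) (l : Fin r) :
    IsTrace hτ l (A.extension hΓ τ B r v : L2S Γ τ) (v l) := by
  have hl : 2 * ((l : ℕ) : ℝ) + 1 < s := by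
    have : ((l : ℕ) : ℝ) + 1 ≤ r := by exact_mod_cast l.2
    linarith
  have hfin : ∀ (k : Fin r) j, energy volume (isoIndex d (s - 2 * (k : ℕ) - 1) φ)
      (𝓕 (A.pull hΓ j (v k)) : L2 (Eucl d)) < ⊤ := fun k j => by
    have h1 : A.normData s φ v ^ 2 < ⊤ := ENNReal.pow_lt_top hv
    rw [A.normData_sq hΓ hs hφ] at h1
    exact ENNReal.sum_lt_top.1 (ENNReal.sum_lt_top.1 h1 k (Finset.mem_univ k)) j (Finset.mem_univ j)
  obtain ⟨C, hC⟩ := exists_isTrace_stripInv (d := d) hτ hφ hl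
  have key : ∀ k : Fin r, IsTrace hτ l (A.glue hΓ τ fun j =>
      scaleOp k (B k) (𝓕 (A.pull hΓ j (v k))) : L2S Γ τ) (if l = k then v k else 0) := fun k => by
    have hp : ∀ j, IsTrace hτ l (stripInv d τ (scaleOp k (B k) (𝓕 (A.pull hΓ j (v k)))))
        (𝓕⁻ (if l = k then 𝓕 (A.pull hΓ j (v k)) else 0 : L2 (Eucl d))) := fun j => by
      obtain ⟨C', hC'⟩ := energy_scaleOp_le (d := d) (s := s) hφ k (B k)
      obtain ⟨p, hp, -, hpt⟩ := hC (scaleOp k (B k) (𝓕 (A.pull hΓ j (v k))))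
        ((hC' _).trans_lt (ENNReal.mul_lt_top (by simp) (hfin k j)))
      have h2 : p = if l = k then 𝓕 (A.pull hΓ j (v k)) else 0 := by
        apply Lp.ext
        refine (hp.trans (moment_scaleOp (hB k l) _)).trans ?_
        by_cases hlk : l = k
        · simp only [hlk, if_true]
          rfl
        · have : (l : ℕ) ≠ k := fun h => hlk (Fin.ext h)
          rw [if_neg hlk, if_neg this]
          exact (Lp.coeFn_zero ℂ 2 volume).symm
      rwa [← h2]
    have h3 := A.isTrace_glue hΓ hτ hp
    by_cases hlk : l = k
    · simp only [hlk, if_true, FourierTransform.fourierInv_fourier_eq, sum_push_pull] at h3 ⊢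
      exact h3
    · have h0 : (𝓕⁻ (0 : L2 (Eucl d)) : L2 (Eucl d)) = 0 :=
        map_zero (FourierTransform.fourierInvCLM ℂ (L2 (Eucl d)))
      simp only [hlk, if_false, h0, map_zero, Finset.sum_const_zero] at h3 ⊢
      exact h3
  have h4 := IsTrace.sum fun k (_ : k ∈ Finset.univ) => key k
  rw [Finset.sum_ite_eq Finset.univ l v, if_pos (Finset.mem_univ l)] at h4
  rw [extension_apply]
  exact h4

end AtlasWithPartition

end

end CauchyData

open CauchyData in
theorem lemma1 {d : ℕ} (hd : 1 ≤ d) {τ : ℝ} (hτ : 0 < τ)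
    {G : Set (Eucl (d + 1))} (hGo : IsOpen G) (hGc : IsConnected G)
    (hGb : Bornology.IsBounded G) (hGs : HasSmoothBoundary G)
    {ι : Type} [Fintype ι] (A : AtlasWithPartition (frontier G) ι)
    (r : ℕ) (hr : 1 ≤ r) :
    (∀ (s : ℝ) (φ : ℝ → ℝ), 2 * (r : ℝ) - 1 < s → ClassM φ →
      ∃! R : L2S (frontier G) τ →ₗ.[ℂ] (Fin r → L2Γ (frontier G)),
        A.IsCauchyDataOperator τ r s φ R) ∧
    ∃ T : (Fin r → L2Γ (frontier G)) →ₗ[ℂ] L2S (frontier G) τ,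
      ∀ (s : ℝ) (φ : ℝ → ℝ), 2 * (r : ℝ) - 1 < s → ClassM φ →
        (∃ C : ℝ≥0, ∀ v : Fin r → L2Γ (frontier G), A.normData s φ v < ⊤ →
          A.normS τ s φ (T v) ≤ C * A.normData s φ v) ∧
        ∀ R : L2S (frontier G) τ →ₗ.[ℂ] (Fin r → L2Γ (frontier G)),
          A.IsCauchyDataOperator τ r s φ R →
          ∀ v : Fin r → L2Γ (frontier G), A.normData s φ v < ⊤ →
            ∃ h : T v ∈ R.domain, R ⟨T v, h⟩ = v := by
  have hΓ : IsCompact (frontier G) := hGb.isCompact_closure.of_isClosed_subset isClosed_frontier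
    frontier_subset_closure
  have hfin := A.isFiniteMeasure_surfaceMeasure hΓ
  have hpos : ∀ s : ℝ, 2 * (r : ℝ) - 1 < s → 0 < s := fun s hs => by
    have : (1 : ℝ) ≤ r := by exact_mod_cast hr
    linarith
  refine ⟨fun s φ hs hφ => ?_, ?_⟩
  · obtain ⟨R, hR, -⟩ := A.exists_traceOperator hτ r hΓ hs (hpos s hs) hφ
    exact ⟨R, hR, fun R' hR' => hR'.eq hΓ hs (hpos s hs) hφ hR⟩
  -- The profiles are fixed before `s` and `φ`, so one operator `T` works for all of them.
  · obtain ⟨B, hB⟩ := exists_schwartz_moments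
    refine ⟨A.extension hΓ τ B r, fun s φ hs hφ => ?_⟩
    obtain ⟨C, hC⟩ := A.normS_extension_le hΓ τ B hs (hpos s hs) hφ
    refine ⟨⟨C, fun v _ => hC v⟩, fun R hR v hv => ?_⟩
    obtain ⟨R₀, hR₀, htr⟩ := A.exists_traceOperator hτ r hΓ hs (hpos s hs) hφ
    -- By uniqueness an arbitrary `R` is the trace operator, so `R (T v)` may be computed by traces.
    obtain rfl := hR.eq hΓ hs (hpos s hs) hφ hR₀
    have hd : A.extension hΓ τ B r v ∈ R.domain :=
      (hR.domain _).2 ((hC v).trans_lt (ENNReal.mul_lt_top (by simp) hv))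
    exact ⟨hd, funext fun k =>
      (htr ⟨_, hd⟩ k).unique (A.isTrace_extension hΓ hτ hB hs hφ hv k)⟩
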